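/- Let $Z$ be a smooth complex algebraic variety of dimension $n$ (integral, separated, of finite type over $\mathbb C$), let $L$ be a line bundle on $Z$, let $d\ge 1$, and let $s$ be a global section of $L^{d}$ whose divisor of zeros $D$ is an effective, not necessarily reduced, divisor with simple normal crossings (so $\mathcal O_Z(D)\cong L^d$). Multiplication by $s$, viewed as a map $L^{-d}\to\mathcal O_Z$, makes $\bigoplus_{i=0}^{d-1}L^{-i}$ an $\mathcal O_Z$-algebra; let $$\pi\colon Y=\text{Normalization of }\mathbf{Spec}_Z\Big(\bigoplus_{i=0}^{d-1}L^{-i}\Big)\longrightarrow Z$$ be the normal $d$-fold cyclic cover branched over $D$. For $a=(a_1,\dots,a_n)\in\mathbb N^n$ let $R_{a,d}=\mathbb C[x_1,\dots,x_n,y]/(y^d-x_1^{a_1}\cdots x_n^{a_n})$, and let $\tilde R_{a,d}$ be its normalization (the integral closure in its total ring of fractions). Let $v_i=d\,e_i\in\mathbb Z^n$ for $1\le i\le n$, $v_{n+1}=(a_1,\dots,a_n)$, let $\Lambda_{a,d}\subset\mathbb Z^n$ be the lattice generated by $v_1,\dots,v_{n+1}$, and let $\tilde S_{a,d}=\Lambda_{a,d}\cap\{\sum_k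 r_kv_k \mid r_k\in\mathbb R_{\ge0}\}$. Let $g=\gcd(a_1,\dots,a_n,d)$. Then: 1. $Y$ is locally analytically isomorphic to a toric variety with finite quotient singularities: for every $p\in Y(\mathbb C)$ there are a normal toric variety $T$ all of whose singularities are finite quotient singularities (every point has an analytic neighbourhood isomorphic to an open subset of $\mathbb C^m/G$ for some $m$ and some finite $G\subset GL_m(\mathbb C)$) and a point $t\in T(\mathbb C)$ such that the germs of complex spaces $(Y^{an},p)$ and $(T^{an},t)$ are isomorphic. 2. More precisely, let $p\in Y(\mathbb C)$, let $x_1,\dots,x_n$ be a regular system of parameters of $\mathcal O_{Z,\pi(p)}$, and suppose that $D$ is cut out at $\pi(p)$ by $x_1^{a_1}\cdots x_n^{a_n}$. Then the germ $(Y^{an},p)$ is isomorphic to the germ of $\operatorname{Spec}\tilde R_{a,d}$ at some point at which the functions $x_1,\dots,x_n$ of $\tilde R_{a,d}$ vanish. 3. For every $a\in\mathbb N^n$ there is an isomorphism of $\mathbb C$-algebras $\tilde R_{a,d}\cong\mathbb C[\tilde S_{a,d}]^{g}$ (a product of $g$ copies) whose component number $k\in\{0,\dots,g-1\}$ maps $x_i$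 to the monomial of $v_i=d\,e_i$ and $y$ to $e^{2\pi\sqrt{-1}\,k/d}$ times the monomial of $v_{n+1}=a$. The semigroup $\tilde S_{a,d}$ is simplicial in $\Lambda_{a,d}$ (the intersection of $\Lambda_{a,d}$ with the real cone generated by elements of $\Lambda_{a,d}$ that are linearly independent over $\mathbb R$), and $\operatorname{Spec}\mathbb C[\tilde S_{a,d}]$ is a normal toric variety with finite quotient singularities. -/

import Mathlib

open CategoryTheory Limits AlgebraicGeometry

namespace CyclicCover

noncomputable section

/-! ### Line bundles, sections of their powers, SNC divisors, and `Spec_Z (⊕ L^{-i})` -/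

/-- A section `e` of `L` over `U` is a frame if it trivializes `L` on `U`: the map
`O_V → L|_V`, `f ↦ f • e|_V`, is bijective on sections over every open `V ⊆ U`. -/
def IsFrame {Z : Scheme.{0}} (L : Z.Modules) {U : Z.Opens} (e : Γ(L, U)) : Prop :=
  ∀ (V : Z.Opens) (h : V ≤ U), Function.Bijective fun f : Γ(Z, V) ↦
    (f • (L.presheaf.map (homOfLE h).op e : Γ(L, V)) : Γ(L, V))

/-- A sheaf of modules is a line bundle (invertible sheaf) if it is locally free of rank one:
every point has an open neighbourhood on which there is a frame. -/
def IsLineBundle {Z : Scheme.{0}} (L : Z.Modules) : Prop :=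
  ∀ z : Z, ∃ (U : Z.Opens) (e : Γ(L, U)), z ∈ U ∧ IsFrame L e

/-- A global section `s` of `L^{⊗ d}`, for a line bundle `L`, in local coordinates: for every frame
`e` of `L` over an open set `U` it has a coordinate `s_e ∈ O(U)`, that is `s|_U = s_e · e^{⊗ d}`.
The coordinates are compatible with restriction, and since
`s = s_{w e} · (w e)^{⊗ d} = s_{w e} w^d · e^{⊗ d}` they satisfy `s_{w e} w^d = s_e`. -/
structure PowerSection {Z : Scheme.{0}} (L : Z.Modules) (d : ℕ) where
  coord : ∀ {U : Z.Opens} (e : Γ(L, U)), IsFrame L e → Γ(Z, U)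
  coord_map : ∀ {U V : Z.Opens} (h : V ≤ U) (e : Γ(L, U)) (he : IsFrame L e)
    (he' : IsFrame L (L.presheaf.map (homOfLE h).op e : Γ(L, V))),
    coord (L.presheaf.map (homOfLE h).op e : Γ(L, V)) he' =
      Z.presheaf.map (homOfLE h).op (coord e he)
  coord_smul : ∀ {U : Z.Opens} (w : Γ(Z, U)) (e : Γ(L, U)) (he : IsFrame L e)
    (he' : IsFrame L (w • e)), coord (w • e) he' * w ^ d = coord e he

/-- `D` is the divisor of zeros of the section `s` of `L^{⊗ d}`: on every affine open with a frame
`e` its ideal is generated by the coordinate `s_e`. -/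
def PowerSection.IsDivisorOfZeros {Z : Scheme.{0}} {L : Z.Modules} {d : ℕ} (s : PowerSection L d)
    (D : Z.IdealSheafData) : Prop :=
  ∀ (U : Z.affineOpens) (e : Γ(L, U.1)) (he : IsFrame L e), D.ideal U = Ideal.span {s.coord e he}

/-- The closed subscheme `D` is cut out at the point `z` by the element `h` of the local ring. -/
def IsCutOutAt {Z : Scheme.{0}} (D : Z.IdealSheafData) (z : Z) (h : Z.presheaf.stalk z) : Prop :=
  ∀ (U : Z.affineOpens) (hz : z ∈ U.1),
    (D.ideal U).map (Z.presheaf.germ U.1 z hz).hom = Ideal.span {h}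

/-- `D` is an effective, not necessarily reduced, divisor with simple normal crossings: at every
point `z` there is a regular system of parameters `x_1, …, x_k` of the (regular) local ring
`O_{Z,z}` itself such that `D` is cut out at `z` by a monomial `x_1^{a_1} ⋯ x_k^{a_k}`. -/
def IsSNCDivisor {Z : Scheme.{0}} (D : Z.IdealSheafData) : Prop :=
  ∀ z : Z, ∃ (k : ℕ) (x : Fin k → Z.presheaf.stalk z) (a : Fin k → ℕ),
    ringKrullDim (Z.presheaf.stalk z) = k ∧
    Ideal.span (Set.range x) = IsLocalRing.maximalIdeal (Z.presheaf.stalk z) ∧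
    IsCutOutAt D z (∏ i, x i ^ a i)

lemma map_map_apply {Z : Scheme.{0}} (L : Z.Modules) {U V W : Z.Opens} (h : V ≤ U) (h' : W ≤ V)
    (e : Γ(L, U)) : (L.presheaf.map (homOfLE h').op (L.presheaf.map (homOfLE h).op e : Γ(L, V)) : Γ(L, W)) =
      L.presheaf.map (homOfLE (h'.trans h)).op e := by
  rw [← homOfLE_comp h' h, op_comp, L.presheaf.map_comp]
  rfl

lemma IsFrame.map {Z : Scheme.{0}} {L : Z.Modules} {U V : Z.Opens} (h : V ≤ U) {e : Γ(L, U)}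
    (he : IsFrame L e) : IsFrame L (L.presheaf.map (homOfLE h).op e : Γ(L, V)) := by
  intro W h'
  rw [map_map_apply]
  exact he W _

section Gluing

variable {Z : Scheme.{0}} (L : Z.Modules)

/-- The affine open subsets of `Z` on which `L` has a frame, ordered by inclusion of
distinguished open subsets. -/
abbrev FramedSite : Type := {U : Z.AffineZariskiSite // ∃ e : Γ(L, U.toOpens), IsFrame L e}
namespace FramedSite
variable {L}

/-- A chosen frame `e_U` of `L` over `U`. -/
def frame (U : FramedSite L) : Γ(L, U.1.toOpens) := U.2.choose
lemma isFrame_frame (U : FramedSite L) : IsFrame L U.frame := U.2.choose_spec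

lemma toOpens_le {U V : FramedSite L} (h : V ≤ U) : V.1.toOpens ≤ U.1.toOpens :=
  Scheme.AffineZariskiSite.toOpens_mono h

/-- The restriction of the chosen frame on `U` to `V`. -/
def resFrame {U V : FramedSite L} (h : V ≤ U) : Γ(L, V.1.toOpens) :=
  L.presheaf.map (homOfLE (toOpens_le h)).op U.frame

lemma isFrame_resFrame {U V : FramedSite L} (h : V ≤ U) : IsFrame L (resFrame h) :=
  U.isFrame_frame.map _

lemma exists_transition {U V : FramedSite L} (h : V ≤ U) :
    ∃ w : Γ(Z, V.1.toOpens), w • resFrame h = V.frame := by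
  obtain ⟨w, hw⟩ := (U.isFrame_frame V.1.toOpens (toOpens_le h)).2 V.frame
  exact ⟨w, hw⟩

/-- The transition function `w`, with `e_V = w • e_U|_V`. -/
def transition {U V : FramedSite L} (h : V ≤ U) : Γ(Z, V.1.toOpens) := (exists_transition h).choose

lemma transition_smul {U V : FramedSite L} (h : V ≤ U) :
    transition h • resFrame h = V.frame := (exists_transition h).choose_spec

lemma smul_injective {U : Z.Opens} {e : Γ(L, U)} (he : IsFrame L e) {f g : Γ(Z, U)}
    (h : f • e = g • e) : f = g := by
  refine (he U le_rfl).1 ?_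
  have : (L.presheaf.map (homOfLE (le_refl U)).op e : Γ(L, U)) = e := by
    have : (homOfLE (le_refl U)).op = 𝟙 _ := rfl
    rw [this, L.presheaf.map_id]; rfl
  simpa only [this] using h

lemma transition_refl (U : FramedSite L) : transition (le_refl U) = 1 := by
  apply smul_injective (isFrame_resFrame (le_refl U))
  rw [transition_smul, one_smul]
  have : (homOfLE (toOpens_le (le_refl U))).op = 𝟙 _ := rfl
  rw [resFrame, this, L.presheaf.map_id]; rfl

lemma transition_trans {U V W : FramedSite L} (h : V ≤ U) (h' : W ≤ V) :
    transition (h'.trans h) =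
      transition h' * Z.presheaf.map (homOfLE (toOpens_le h')).op (transition h) := by
  apply smul_injective (isFrame_resFrame (h'.trans h))
  have : resFrame (h'.trans h) = L.presheaf.map (homOfLE (toOpens_le h')).op (resFrame h) := by
    rw [resFrame, resFrame, map_map_apply]
  rw [transition_smul, mul_smul, this, ← Scheme.Modules.map_smul, transition_smul]
  exact (transition_smul h').symm

lemma isUnit_transition {U V : FramedSite L} (h : V ≤ U) : IsUnit (transition h) := by
  obtain ⟨v, hv⟩ := (V.isFrame_frame V.1.toOpens le_rfl).2 (resFrame h)
  have e : (L.presheaf.map (homOfLE (le_refl V.1.toOpens)).op V.frame) = V.frame := by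
    have : (homOfLE (le_refl V.1.toOpens)).op = 𝟙 _ := rfl
    rw [this, L.presheaf.map_id]; rfl
  simp only [e] at hv
  refine .of_mul_eq_one v ?_
  apply smul_injective (isFrame_resFrame h)
  rw [mul_comm, mul_smul, transition_smul, hv, one_smul]

end FramedSite

namespace PowerSection
open FramedSite Polynomial
variable {L} {d : ℕ} (s : PowerSection L d)

/-- The coordinate of `s` in the chosen frame. -/
def loc (U : FramedSite L) : Γ(Z, U.1.toOpens) := s.coord U.frame U.isFrame_frame

lemma loc_mul {U V : FramedSite L} (h : V ≤ U) :
    s.loc V * transition h ^ d = Z.presheaf.map (homOfLE (toOpens_le h)).op (s.loc U) := by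
  have h1 : IsFrame L (transition h • resFrame h) := by
    rw [transition_smul]; exact V.isFrame_frame
  have := s.coord_smul (transition h) (resFrame h) (isFrame_resFrame h) h1
  have h2 : s.coord _ h1 = s.loc V := by
    unfold loc
    congr 1
    exact transition_smul h
  rw [← h2, this]
  exact s.coord_map (toOpens_le h) _ U.isFrame_frame (isFrame_resFrame h)

/-- The algebra `O(U)[y]/(y^d - s_U)`. -/
abbrev Alg (U : FramedSite L) : Type := AdjoinRoot (X ^ d - C (s.loc U))

lemma root_pow (U : FramedSite L) :
    (AdjoinRoot.root (X ^ d - C (s.loc U))) ^ d = AdjoinRoot.of _ (s.loc U) := by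
  have := AdjoinRoot.eval₂_root (X ^ d - C (s.loc U))
  simpa [sub_eq_zero] using this

/-- The restriction map `O(U)[y_U]/(y_U^d - s_U) → O(V)[y_V]/(y_V^d - s_V)`. Here `y_U` is the local
generator of `L^{-1}` dual to the frame `e_U`, so that `y_U|_V = w y_V` if `e_V = w e_U|_V`. -/
def algMap {U V : FramedSite L} (h : V ≤ U) : s.Alg U →+* s.Alg V :=
  AdjoinRoot.lift ((AdjoinRoot.of _).comp (Z.presheaf.map (homOfLE (toOpens_le h)).op).hom)
    (AdjoinRoot.of _ (transition h) * AdjoinRoot.root _) (by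
      simp only [eval₂_sub, eval₂_pow, eval₂_X, eval₂_C, RingHom.comp_apply, mul_pow, root_pow]
      rw [← map_pow, ← map_mul, mul_comm, loc_mul, sub_self])

lemma algMap_of {U V : FramedSite L} (h : V ≤ U) (f) :
    s.algMap h (AdjoinRoot.of _ f) =
      AdjoinRoot.of _ (Z.presheaf.map (homOfLE (toOpens_le h)).op f) :=
  AdjoinRoot.lift_of _

lemma algMap_root {U V : FramedSite L} (h : V ≤ U) :
    s.algMap h (AdjoinRoot.root _) = AdjoinRoot.of _ (transition h) * AdjoinRoot.root _ :=
  AdjoinRoot.lift_root _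

lemma algHom_ext {R : Type*} [CommRing R] {U : FramedSite L} {f g : s.Alg U →+* R}
    (h : f.comp (AdjoinRoot.of _) = g.comp (AdjoinRoot.of _))
    (h' : f (AdjoinRoot.root _) = g (AdjoinRoot.root _)) : f = g := 
  AdjoinRoot.ringHom_ext h h'

/-- The quasi-coherent algebra `⊕_{i<d} L^{-i}` on the framed affine opens of `Z`:
over `U` it is `O(U)[y_U]/(y_U^d - s_U)`, where `y_U` is the generator of `L^{-1}(U)` dual to `e_U`.
The product of `L^{-i}` and `L^{-j}` with `i + j ≥ d` is `L^{-i-j} ⊂ L^{-i-j+d}` through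
multiplication with `s`. -/
def algFunctor : (FramedSite L)ᵒᵖ ⥤ CommRingCat where
  obj U := .of (s.Alg U.unop)
  map {U V} i := CommRingCat.ofHom (s.algMap i.unop.le)
  map_id U := by
    ext1
    refine s.algHom_ext ?_ ?_
    · ext f
      simp [algMap_of]
    · simp [transition_refl, algMap_root]
  map_comp {U V W} i j := by
    ext1
    refine s.algHom_ext ?_ ?_
    · ext f
      simp only [CommRingCat.hom_ofHom, RingHom.comp_apply, algMap_of, CommRingCat.hom_comp]
      rw [← homOfLE_comp (toOpens_le j.unop.le) (toOpens_le i.unop.le), op_comp, Z.presheaf.map_comp]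
      rfl
    · simp only [CommRingCat.hom_ofHom, RingHom.comp_apply, algMap_root, CommRingCat.hom_comp,
        map_mul, algMap_of]
      rw [transition_trans i.unop.le j.unop.le, map_mul]
      ring

end PowerSection

namespace FramedSite
/-- The functor sending a framed affine open to the affine open. -/
def toAffine : FramedSite L ⥤ Z.AffineZariskiSite := Monotone.functor (f := fun U : FramedSite L ↦ U.1) (fun _ _ h ↦ h)

variable {L}

lemma exists_mem (hL : IsLineBundle L) (z : Z) : ∃ U : FramedSite L, z ∈ U.1.toOpens := by
  obtain ⟨U, e, hz, he⟩ := hL z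
  obtain ⟨_, ⟨V, hV, rfl⟩, hzV, hVU⟩ := Z.isBasis_affineOpens.exists_subset_of_mem_open hz U.2
  exact ⟨⟨⟨V, hV⟩, _, he.map hVU⟩, hzV⟩

/-- A framed affine open restricts to a framed basic open. -/
def restrict (U : FramedSite L) (V : Z.AffineZariskiSite) (h : V ≤ U.1) : FramedSite L :=
  ⟨V, _, U.isFrame_frame.map (Scheme.AffineZariskiSite.toOpens_mono h)⟩

/-- The open cover of `Z` by the framed affine opens. -/
@[simps] abbrev cover (hL : IsLineBundle L) : Z.OpenCover where
  I₀ := FramedSite L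
  X U := U.1.toOpens
  f U := U.1.toOpens.ι
  mem₀ := by
    rw [Scheme.presieve₀_mem_precoverage_iff]
    refine ⟨fun x ↦ ?_, inferInstance⟩
    obtain ⟨U, hxU⟩ := exists_mem hL x
    exact ⟨U, ⟨x, hxU⟩, rfl⟩


instance (hL : IsLineBundle L) : (cover hL).LocallyDirected where
  trans {U V} f := Z.homOfLE (toOpens_le (U := V) (V := U) f.le)
  directed {U V} x := by
    let a := (pullback.fst _ _ ≫ U.1.toOpens.ι) x
    have haU : a ∈ U.1.toOpens := (pullback.fst U.1.toOpens.ι V.1.toOpens.ι x).2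
    have haV : a ∈ V.1.toOpens := by
      unfold a; rw [pullback.condition]; exact (pullback.snd U.1.toOpens.ι V.1.toOpens.ι x).2
    obtain ⟨f, g, e, hxf⟩ := exists_basicOpen_le_affine_inter U.1.2 V.1.2 _ ⟨haU, haV⟩
    have hV : U.1.basicOpen f ≤ V.1 := ⟨g, e.symm⟩
    refine ⟨restrict U (U.1.basicOpen f) (U.1.basicOpen_le f), homOfLE (U.1.basicOpen_le f), homOfLE hV, ⟨a, hxf⟩, ?_⟩
    apply (pullback.fst _ _ ≫ U.1.toOpens.ι).isOpenEmbedding.injective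
    dsimp
    change (pullback.lift _ _ _ ≫ pullback.fst _ _ ≫ U.1.toOpens.ι) _ = _
    simp only [pullback.lift_fst_assoc, Scheme.homOfLE_ι, Scheme.Opens.ι_apply]
    rfl

end FramedSite

namespace PowerSection
open FramedSite Polynomial
variable {L} {d : ℕ} (s : PowerSection L d)

/-- The structure map `O_Z → ⊕_{i<d} L^{-i}`. -/
def algUnit : (toAffine L ⋙ Scheme.AffineZariskiSite.toOpensFunctor Z).op ⋙ Z.presheaf ⟶ s.algFunctor where
  app U := CommRingCat.ofHom (AdjoinRoot.of _)
  naturality U V i := by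
    ext f
    exact (s.algMap_of i.unop.le f).symm

/-- The universal property of `O(V) ⊗_{O(U)} A(U)` for `A(V)`, with `A = ⊕_{i<d} L^{-i}`. -/
def pushoutDesc {U V : FramedSite L} (h : V ≤ U) (v : (Γ(Z, V.1.toOpens))ˣ) (hv : ↑v = transition h)
    {R : Type*} [CommRing R] (a : Γ(Z, V.1.toOpens) →+* R) (b : s.Alg U →+* R)
    (hab : ∀ f : Γ(Z, U.1.toOpens), a (Z.presheaf.map (homOfLE (toOpens_le h)).op f) = b (AdjoinRoot.of _ f)) :
    s.Alg V →+* R :=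
  AdjoinRoot.lift a (a ↑v⁻¹ * b (AdjoinRoot.root _)) (by
    simp only [eval₂_sub, eval₂_pow, eval₂_X, eval₂_C, mul_pow]
    rw [← map_pow b, root_pow, ← hab, ← s.loc_mul h, ← hv, ← map_pow, ← map_mul, mul_comm, mul_assoc,
      ← mul_pow, Units.mul_inv, one_pow, mul_one, sub_self])

lemma pushoutDesc_of {U V : FramedSite L} (h : V ≤ U) (v : (Γ(Z, V.1.toOpens))ˣ)
    (hv : ↑v = transition h) {R : Type*} [CommRing R] (a : Γ(Z, V.1.toOpens) →+* R)
    (b : s.Alg U →+* R) (hab) (f) : s.pushoutDesc h v hv a b hab (AdjoinRoot.of _ f) = a f :=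
  AdjoinRoot.lift_of _

lemma pushoutDesc_root {U V : FramedSite L} (h : V ≤ U) (v : (Γ(Z, V.1.toOpens))ˣ)
    (hv : ↑v = transition h) {R : Type*} [CommRing R] (a : Γ(Z, V.1.toOpens) →+* R)
    (b : s.Alg U →+* R) (hab) : s.pushoutDesc h v hv a b hab (AdjoinRoot.root _) =
      a ↑v⁻¹ * b (AdjoinRoot.root _) :=
  AdjoinRoot.lift_root _

lemma pushoutDesc_algMap {U V : FramedSite L} (h : V ≤ U) (v : (Γ(Z, V.1.toOpens))ˣ)
    (hv : ↑v = transition h) {R : Type*} [CommRing R] (a : Γ(Z, V.1.toOpens) →+* R)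
    (b : s.Alg U →+* R) (hab) : (s.pushoutDesc h v hv a b hab).comp (s.algMap h) = b := by
  refine s.algHom_ext ?_ ?_
  · ext f
    simp only [RingHom.comp_apply, algMap_of, pushoutDesc_of]
    exact hab f
  · simp only [RingHom.comp_apply, algMap_root, map_mul, pushoutDesc_of, pushoutDesc_root, ← hv]
    rw [← mul_assoc, ← map_mul, Units.mul_inv, map_one, one_mul]

lemma pushoutDesc_unique {U V : FramedSite L} (h : V ≤ U) (v : (Γ(Z, V.1.toOpens))ˣ)
    (hv : ↑v = transition h) {R : Type*} [CommRing R] (a : Γ(Z, V.1.toOpens) →+* R)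
    (b : s.Alg U →+* R) (hab) (m : s.Alg V →+* R) (h1 : m.comp (AdjoinRoot.of _) = a)
    (h2 : m.comp (s.algMap h) = b) : m = s.pushoutDesc h v hv a b hab := by
  subst h1 h2
  refine s.algHom_ext ?_ ?_
  · ext f
    exact (s.pushoutDesc_of h v hv _ _ hab f).symm
  · rw [pushoutDesc_root]
    simp only [RingHom.comp_apply, algMap_root, map_mul, ← hv]
    rw [← mul_assoc, ← map_mul m, ← map_mul (AdjoinRoot.of _), Units.inv_mul, map_one, map_one,
      one_mul]

lemma algUnit_coequifibered : s.algUnit.Coequifibered := by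
  intro U V i
  have h : V.unop ≤ U.unop := i.unop.le
  obtain ⟨v, hv⟩ := isUnit_transition h
  have hc (c : PushoutCocone (((toAffine L ⋙
      Scheme.AffineZariskiSite.toOpensFunctor Z).op ⋙ Z.presheaf).map i) (s.algUnit.app U))
      (f : Γ(Z, U.unop.1.toOpens)) : c.inl.hom (Z.presheaf.map (homOfLE (toOpens_le h)).op f) =
        c.inr.hom (AdjoinRoot.of _ f) := congrArg (fun k ↦ k.hom f) c.condition
  refine ⟨⟨s.algUnit.naturality i⟩, ⟨PushoutCocone.IsColimit.mk _ (fun c ↦ CommRingCat.ofHom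
    (s.pushoutDesc h v hv c.inl.hom c.inr.hom (hc c))) ?_ ?_ ?_⟩⟩
  · intro c
    ext f
    exact s.pushoutDesc_of h v hv c.inl.hom c.inr.hom (hc c) f
  · intro c
    ext1
    exact s.pushoutDesc_algMap h v hv c.inl.hom c.inr.hom (hc c)
  · intro c m h1 h2
    ext1
    exact s.pushoutDesc_unique h v hv c.inl.hom c.inr.hom (hc c) m.hom
      (congrArg (fun k ↦ k.hom) h1) (congrArg (fun k ↦ k.hom) h2)

/-- The relative gluing datum for `Spec_Z (⊕_{i<d} L^{-i})`. -/
def gluingData (hL : IsLineBundle L) : (cover hL).RelativeGluingData where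
  functor := s.algFunctor.rightOp ⋙ Scheme.Spec
  natTrans := Functor.whiskerRight s.algUnit.rightOp Scheme.Spec ≫ Functor.whiskerLeft (toAffine L) (Scheme.AffineZariskiSite.restrictIsoSpec Z).inv
  equifibered := (s.algUnit_coequifibered.rightOp.whiskerRight _).comp
    (.of_isIso (Functor.isoWhiskerLeft (toAffine L) (Scheme.AffineZariskiSite.restrictIsoSpec Z).symm).hom)

/-- The scheme `Spec_Z (⊕_{i<d} L^{-i})` over `Z`, glued from the affine schemes
`Spec O(U)[y_U]/(y_U^d - s_U)`. -/
def coverSpec (hL : IsLineBundle L) : Over Z := Over.mk (s.gluingData hL).toBase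

end PowerSection

end Gluing

/-! ### Normalization -/

/-- The generic points of the irreducible components of `X`: the points without proper
generization. -/
abbrev MaximalPoint (X : Scheme.{0}) : Type := {x : X // ∀ y : X, y ⤳ x → y = x}

/-- The morphism to `X` from the disjoint union of the spectra of the residue fields at the generic
points of its irreducible components. -/
def fromMaximalPoints (X : Scheme.{0}) :
    (∐ fun x : MaximalPoint X ↦ Spec (X.residueField x.1)) ⟶ X :=
  Sigma.desc fun x ↦ X.fromSpecResidueField x.1

open Classical in
/-- The normalization of a scheme `X`: the relative normalization of `X` in the disjoint union of
the spectra of the residue fields at the generic points of its irreducible components. It is defined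
if that disjoint union is quasi-compact and quasi-separated over `X`, for instance if `X` is
Noetherian (otherwise the value is a dummy). -/
def normalization (X : Scheme.{0}) : Over X :=
  if h : QuasiCompact (fromMaximalPoints X) ∧ QuasiSeparated (fromMaximalPoints X) then
    haveI := h.1
    haveI := h.2
    Over.mk (fromMaximalPoints X).fromNormalization
  else Over.mk (𝟙 X)

/-! ### Schemes over `ℂ` and the analytic topology -/

/-- Schemes over `ℂ`. -/
abbrev CScheme : Type 1 := Over (Spec (CommRingCat.of ℂ))

/-- The spectrum of a `ℂ`-algebra, as a scheme over `ℂ`. -/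
abbrev specC (A : Type) [CommRing A] [Algebra ℂ A] : CScheme :=
  (Spec (CommRingCat.of A)).asOver (Spec (CommRingCat.of ℂ))

/-- The set `X(ℂ)` of complex points of `X`. If `X` is locally of finite type, these are its closed
points. -/
def CPoint (X : CScheme) : Type :=
  {p : Spec (CommRingCat.of ℂ) ⟶ X.left // p ≫ X.hom = 𝟙 _}

namespace CPoint

/-- The underlying (closed) point of the scheme. -/
def pt {X : CScheme} (p : CPoint X) : X.left := p.1 (IsLocalRing.closedPoint ℂ)

/-- The evaluation `O_{X,p} → ℂ`. -/
def stalkEval {X : CScheme} (p : CPoint X) : X.left.presheaf.stalk p.pt →+* ℂ :=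
  (Scheme.stalkClosedPointTo p.1).hom

open Classical in
/-- The value `g(p)` of a regular function `g` on `U` at a point `p ∈ U(ℂ)` (and `0` at other
points). -/
def eval {X : CScheme} (p : CPoint X) {U : X.left.Opens} (g : Γ(X.left, U)) : ℂ :=
  if h : p.pt ∈ U then p.stalkEval (X.left.presheaf.germ U p.pt h g) else 0

/-- The evaluation `A → ℂ` at a complex point of `Spec A`. -/
def evalSpec {A : Type} [CommRing A] [Algebra ℂ A] (p : CPoint (specC A)) : A →+* ℂ :=
  (Spec.preimage p.1).hom

/-- The analytic topology on `X(ℂ)`: the coarsest topology for which `U(ℂ)` is open for every Zariski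
open `U`, and every regular function on `U` is continuous on `U(ℂ)`. -/
instance (X : CScheme) : TopologicalSpace (CPoint X) :=
  .generateFrom {S | ∃ (U : X.left.Opens) (g : Γ(X.left, U)) (W : Set ℂ), IsOpen W ∧
    S = {p | p.pt ∈ U ∧ p.eval g ∈ W}}

end CPoint

open Filter Topology in
/-- The function `h` on `X(ℂ)` is holomorphic at `p`: in an analytic neighbourhood of `p` it is
`F(g_1, …, g_N)` with regular functions `g_i` on a Zariski neighbourhood of `p` and a function `F`
of `N` complex variables that is analytic at `(g_1(p), …, g_N(p))`. -/
def HolomorphicAt {X : CScheme} (h : CPoint X → ℂ) (p : CPoint X) : Prop :=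
  ∃ (U : X.left.Opens) (N : ℕ) (g : Fin N → Γ(X.left, U)) (F : (Fin N → ℂ) → ℂ),
    p.pt ∈ U ∧ AnalyticAt ℂ F (fun i ↦ p.eval (g i)) ∧
    ∀ᶠ q in 𝓝 p, h q = F (fun i ↦ q.eval (g i))

/-- For reduced `X` and `Y` locally of finite type over `ℂ`: the germs of complex spaces
`(X^an, x)` and `(Y^an, y)` are isomorphic. That is, there is a homeomorphism `φ` from an analytic
neighbourhood of `x` to an analytic neighbourhood of `y`, with `φ x = y`, such that `φ` and its
inverse pull holomorphic functions back to holomorphic functions. (The structure sheaf of a reduced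
complex space is the sheaf of its holomorphic functions.) -/
def LocallyAnalyticallyIso {X Y : CScheme} (x : CPoint X) (y : CPoint Y) : Prop :=
  ∃ φ : OpenPartialHomeomorph (CPoint X) (CPoint Y), x ∈ φ.source ∧ φ x = y ∧
    ∀ q ∈ φ.source, ∀ h : CPoint Y → ℂ, HolomorphicAt h (φ q) ↔ HolomorphicAt (h ∘ φ) q

/-! ### Toric varieties and quotient singularities -/

/-- The algebraic torus `(ℂ^*)^n = Spec ℂ[ℤ^n]`; its group structure is Mathlib's. -/
abbrev torus (n : ℕ) : CScheme := specC (AddMonoidAlgebra ℂ (Fin n → ℤ))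

open scoped MonoidalCategory MonObj in
/-- A (normal) toric variety: a normal variety over `ℂ` that contains a torus as an open
subset, such that the action of the torus on itself extends to an action on the variety. -/
structure IsToricVariety (X : CScheme) : Prop where
  integral : IsIntegral X.left
  separated : IsSeparated X.hom
  locallyOfFiniteType : LocallyOfFiniteType X.hom
  quasiCompact : QuasiCompact X.hom
  normal : ∀ x : X.left, IsIntegrallyClosed (X.left.presheaf.stalk x)
  exists_torus_action : ∃ (n : ℕ) (j : torus n ⟶ X) (act : torus n ⊗ X ⟶ X),
    IsOpenImmersion j.left ∧
    η[torus n] ▷ X ≫ act = (λ_ X).hom ∧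
    μ[torus n] ▷ X ≫ act = (α_ _ _ _).hom ≫ torus n ◁ act ≫ act ∧
    torus n ◁ j ≫ act = μ[torus n] ≫ j

/-- The algebra of polynomials on `ℂ^m` that are invariant under a group `G` of linear
transformations: `f(g x) = f(x)` for all `g ∈ G`. -/
def invariants {m : ℕ} (G : Subgroup (GL (Fin m) ℂ)) : Subalgebra ℂ (MvPolynomial (Fin m) ℂ) :=
  ⨅ g ∈ G, AlgHom.equalizer
    (MvPolynomial.aeval fun i ↦ ∑ j, MvPolynomial.C (g.val i j) * MvPolynomial.X j)
    (AlgHom.id ℂ (MvPolynomial (Fin m) ℂ))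

/-- `X` has finite quotient singularities: every point has an analytic neighbourhood that is
isomorphic to an open subset of `ℂ^m / G` for a finite group `G` of linear transformations, where
`ℂ^m / G = Spec ℂ[x_1, …, x_m]^G`. -/
def HasFiniteQuotientSingularities (X : CScheme) : Prop :=
  ∀ x : CPoint X, ∃ (m : ℕ) (G : Subgroup (GL (Fin m) ℂ)), Finite G ∧
    ∃ q : CPoint (specC (invariants G)), LocallyAnalyticallyIso x q

/-! ### The normal cyclic cover -/

/-- The normal cyclic cover `π : Y → Z`, where `Y` is the normalization of
`Spec_Z (⊕_{i<d} L^{-i})`. -/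
def normalCyclicCover {Z : Scheme.{0}} {L : Z.Modules} {d : ℕ} (hL : IsLineBundle L)
    (s : PowerSection L d) : Over Z :=
  Over.mk ((normalization (s.coverSpec hL).left).hom ≫ (s.coverSpec hL).hom)

/-- The total space `Y` of the normal cyclic cover of a scheme `Z` over `ℂ`, as a scheme
over `ℂ`. -/
def normalCyclicCoverC {Z : CScheme} {L : Z.left.Modules} {d : ℕ} (hL : IsLineBundle L)
    (s : PowerSection L d) : CScheme :=
  Over.mk ((normalCyclicCover hL s).hom ≫ Z.hom)

/-- The projection `π` on complex points, with values in the scheme `Z`. -/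
def coverProj {Z : CScheme} {L : Z.left.Modules} {d : ℕ} (hL : IsLineBundle L)
    (s : PowerSection L d) (y : CPoint (normalCyclicCoverC hL s)) : Z.left :=
  (normalCyclicCover hL s).hom y.pt

/-! ### The local model -/

open Polynomial in
/-- The ring `R = ℂ[x_1, …, x_n, y]/(y^d - x_1^{a_1} ⋯ x_n^{a_n})`. -/
abbrev ModelRing {n : ℕ} (a : Fin n → ℕ) (d : ℕ) : Type :=
  AdjoinRoot (X ^ d - C (∏ i, MvPolynomial.X i ^ a i) : (MvPolynomial (Fin n) ℂ)[X])

/-- The class of `x_i` in `R`. -/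
def ModelRing.x {n : ℕ} (a : Fin n → ℕ) (d : ℕ) (i : Fin n) : ModelRing a d :=
  AdjoinRoot.of _ (MvPolynomial.X i)

/-- The class of `y` in `R`. -/
def ModelRing.y {n : ℕ} (a : Fin n → ℕ) (d : ℕ) : ModelRing a d := AdjoinRoot.root _

/-- The normalization of `R`: its integral closure in its total ring of fractions. -/
abbrev NormalizedModelRing {n : ℕ} (a : Fin n → ℕ) (d : ℕ) : Type :=
  integralClosure (ModelRing a d) (FractionRing (ModelRing a d))

/-- The inclusion `ℤ^n → ℝ^n`. -/
def toReal (n : ℕ) : (Fin n → ℤ) →+ (Fin n → ℝ) := (Int.castAddHom ℝ).compLeft (Fin n)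

/-- The real cone `{∑ r_k w_k | r_k ≥ 0}` spanned by the vectors `w_k` of `ℤ^n`, intersected
with `ℤ^n`. -/
def latticeCone {ι : Type} {n : ℕ} (w : ι → Fin n → ℤ) : AddSubmonoid (Fin n → ℤ) :=
  (Submodule.span NNReal (Set.range fun k ↦ toReal n (w k))).toAddSubmonoid.comap (toReal n)

/-- The vectors `v_1 = (d, 0, …, 0), …, v_n = (0, …, 0, d)` and `v_{n+1} = (a_1, …, a_n)` (the last
one has the index `none`). -/
def modelGen {n : ℕ} (a : Fin n → ℕ) (d : ℕ) : Option (Fin n) → Fin n → ℤ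
  | some i => Pi.single i (d : ℤ)
  | none => fun i ↦ (a i : ℤ)

/-- The lattice generated by `v_1, …, v_{n+1}`. -/
def modelLattice {n : ℕ} (a : Fin n → ℕ) (d : ℕ) : AddSubgroup (Fin n → ℤ) :=
  AddSubgroup.closure (Set.range (modelGen a d))

/-- The saturation of the semigroup generated by `v_1, …, v_{n+1}`: the intersection of the lattice
with the real cone generated by these vectors. -/
def modelSemigroup {n : ℕ} (a : Fin n → ℕ) (d : ℕ) : AddSubmonoid (Fin n → ℤ) :=
  (modelLattice a d).toAddSubmonoid ⊓ latticeCone (modelGen a d)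

lemma modelGen_mem {n : ℕ} (a : Fin n → ℕ) (d : ℕ) (k : Option (Fin n)) :
    modelGen a d k ∈ modelSemigroup a d :=
  ⟨AddSubgroup.subset_closure ⟨k, rfl⟩, Submodule.subset_span ⟨k, rfl⟩⟩

/-- The generator `v_k`, as an element of the saturated semigroup. -/
def modelGenS {n : ℕ} (a : Fin n → ℕ) (d : ℕ) (k : Option (Fin n)) : modelSemigroup a d :=
  ⟨modelGen a d k, modelGen_mem a d k⟩

/-- The complex semigroup ring of the saturated semigroup. -/
abbrev ModelSemigroupRing {n : ℕ} (a : Fin n → ℕ) (d : ℕ) : Type :=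
  AddMonoidAlgebra ℂ (modelSemigroup a d)

/-- A semigroup in `ℤ^n` is (saturated and) simplicial in the lattice `Λ` if it is the intersection
of `Λ` with the real cone generated by elements of `Λ` that are linearly independent over `ℝ`. -/
def IsSimplicialIn {n : ℕ} (T : AddSubmonoid (Fin n → ℤ)) (Λ : AddSubgroup (Fin n → ℤ)) : Prop :=
  ∃ (k : ℕ) (w : Fin k → Fin n → ℤ), (∀ j, w j ∈ Λ) ∧
    LinearIndependent ℝ (fun j ↦ toReal n (w j)) ∧ T = Λ.toAddSubmonoid ⊓ latticeCone w

end

end CyclicCover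

open CyclicCover

/-!
# Local structure of normal cyclic covers

The proof reduces everything to one explicit algebraic object. Suppose that `A` is étale over
`ℂ[x_1, …, x_n]`, that `u` is a unit of `A` and that `y^d = u x^a`. The integral closure of `A` in the
total ring of fractions of `A[y]/(y^d - u x^a)` is free over `A` with basis the elements
`b_j = y^j / x^⌊j a / d⌋` for `0 ≤ j < d`. Their multiplication table only involves `x`, `u`, `a` and
`d`; an algebra with a basis of this kind (`IsCyclicBasis`) is determined by these data.

*The integral closure* (`exists_isCyclicBasis`). Averaging over the automorphisms `y ↦ ζ y` shows that in
an integral element `∑ f_j y^j` every term `f_j y^j` is integral, so that `g = f_j x^⌊j a / d⌋` is an element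
of the fraction field of `A` with `g^d x^r` integral for exponents `r_i < d`. After adjoining `d`-th roots
`t_i` of the `x_i` the element `g t^r` is integral, and `A ⊗ ℂ[t_1, …, t_n]` is integrally closed because
integral closure commutes with smooth base change. Reading off the coefficient at `t^r` gives `g ∈ A`
(`mem_range_of_isIntegral_pow_mul`).

*The local model.* In the product of `g = gcd(a_1, …, a_n, d)` copies of the semigroup ring, the elements
`(ζ^{k j} χ^{j a mod d})_k` are a cyclic basis over `ℂ[x_1, …, x_n]` with `u = 1`, by Fourier inversion on
the group of `g`-th roots of unity (`isCyclicBasis_model`). Comparison with the integral closure yields the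
isomorphism `exists_normalizedModelRing_algEquiv`. The cone is the orthant, so the semigroup consists of the
vectors in `ℕ^n` that lie in the lattice `Λ`, and its ring consists of the polynomials that are invariant
under the finite diagonal group of characters of `ℤ^n / Λ` (`range_modelToPolynomial`). This gives both
normality and quotient singularities; the torus action comes from the coaction `χ^s ↦ χ^s ⊗ χ^s`
(`isToricVariety_model`).

*The germs of the cover.* Regular parameters at a point of the smooth variety are étale coordinates on a
neighbourhood, by Nakayama's lemma and the Jacobi–Zariski sequence (`exists_etale_coordinates`), and there the
section is a unit times a monomial (`exists_local_equation`). Over such a neighbourhood the normalization is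
the spectrum of the integral closure above (`PowerSection.exists_isIntegralClosure_cover`), hence has a cyclic
basis. Étale coordinates are analytic coordinates by the implicit function theorem
(`exists_analytic_section`), and dividing `y` by an analytic `d`-th root of `u` turns the multiplication table
into that of the model with `u = 1`. This identifies the germs
(`exists_locallyAnalyticallyIso_model`). Finally, a point of the disjoint union of `g` copies of the toric
variety lies on one of them (`exists_locallyAnalyticallyIso_component`), and the number of parameters in the
normal crossings condition is the dimension `n` (`eq_of_ringKrullDim_stalk_eq`).
-/

namespace CyclicCover

noncomputable section

open Filter Topology

/-! ### Complex points and analytic germs -/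

namespace CPoint

lemma eval_of_mem {X : CScheme} (p : CPoint X) {U : X.left.Opens} (h : p.pt ∈ U) (g : Γ(X.left, U)) :
    p.eval g = p.stalkEval (X.left.presheaf.germ U p.pt h g) := dif_pos h

lemma eval_restrict {X : CScheme} (p : CPoint X) {U V : X.left.Opens} (i : V ⟶ U) (h : p.pt ∈ V)
    (g : Γ(X.left, U)) : p.eval (X.left.presheaf.map i.op g) = p.eval g := by
  rw [eval_of_mem p h, eval_of_mem p (i.le h), TopCat.Presheaf.germ_res_apply]

/-- The map `X(ℂ) → Y(ℂ)` induced by a morphism. -/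
def map {X Y : CScheme} (f : X ⟶ Y) (p : CPoint X) : CPoint Y :=
  ⟨p.1 ≫ f.left, by rw [Category.assoc, Over.w, p.2]⟩

lemma map_eval {X Y : CScheme} (f : X ⟶ Y) (p : CPoint X) {U : Y.left.Opens} (g : Γ(Y.left, U)) :
    (map f p).eval g = p.eval (f.left.app U g) := by
  by_cases h : (map f p).pt ∈ U
  · have h' : p.pt ∈ f.left ⁻¹ᵁ U := h
    rw [eval_of_mem _ h, eval_of_mem _ h']
    have h1 := Scheme.germ_stalkClosedPointTo (map f p).1 U h
    have h2 := Scheme.germ_stalkClosedPointTo p.1 (f.left ⁻¹ᵁ U) h'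
    have h3 : (map f p).1.app U = f.left.app U ≫ p.1.app (f.left ⁻¹ᵁ U) := Scheme.Hom.comp_app _ _ _
    have e1 := congrArg (fun k ↦ k.hom g) h1
    have e2 := congrArg (fun k ↦ k.hom (f.left.app U g)) h2
    refine e1.trans (Eq.trans ?_ e2.symm)
    rw [h3]; rfl
  · have h' : ¬ p.pt ∈ f.left ⁻¹ᵁ U := h
    rw [eval, eval, dif_neg h, dif_neg h']

lemma eval_mul {X : CScheme} (p : CPoint X) {U : X.left.Opens} (g h : Γ(X.left, U)) :
    p.eval (g * h) = p.eval g * p.eval h := by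
  by_cases hp : p.pt ∈ U
  · simp only [eval_of_mem p hp, map_mul]
  · simp [eval, hp]

/-- A regular function does not vanish at a complex point exactly on its basic open set: the evaluation
of germs is a local homomorphism. -/
lemma eval_ne_zero_iff {X : CScheme} (p : CPoint X) {U : X.left.Opens} (g : Γ(X.left, U)) :
    p.eval g ≠ 0 ↔ p.pt ∈ X.left.basicOpen g := by
  constructor
  · intro h
    have hp : p.pt ∈ U := by
      by_contra hp
      exact h (by simp [eval, hp])
    rw [eval_of_mem p hp] at h
    rw [Scheme.mem_basicOpen _ _ _ hp]
    have hl : IsLocalHom (Scheme.stalkClosedPointTo p.1).hom :=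
      Scheme.isLocalHom_stalkClosedPointTo' (R := ℂ) p.1
    exact hl.map_nonunit _ (isUnit_iff_ne_zero.2 h)
  · intro h
    have hp : p.pt ∈ U := X.left.basicOpen_le g h
    rw [Scheme.mem_basicOpen _ _ _ hp] at h
    rw [eval_of_mem p hp]
    exact (h.map p.stalkEval).ne_zero

lemma continuous_map {X Y : CScheme} (f : X ⟶ Y) : Continuous (map f) := by
  refine continuous_generateFrom_iff.2 ?_
  rintro _ ⟨U, g, W, hW, rfl⟩
  refine TopologicalSpace.isOpen_generateFrom_of_mem ⟨f.left ⁻¹ᵁ U, f.left.app U g, W, hW, ?_⟩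
  ext p
  simp only [Set.mem_preimage, Set.mem_ofPred_eq, map_eval]
  rfl

lemma isOpen_setOf_eval_mem {X : CScheme} (U : X.left.Opens) (g : Γ(X.left, U)) {W : Set ℂ}
    (hW : IsOpen W) : IsOpen {p : CPoint X | p.pt ∈ U ∧ p.eval g ∈ W} :=
  TopologicalSpace.isOpen_generateFrom_of_mem ⟨U, g, W, hW, rfl⟩

lemma isOpen_setOf_pt_mem {X : CScheme} (U : X.left.Opens) : IsOpen {p : CPoint X | p.pt ∈ U} := by
  simpa using isOpen_setOf_eval_mem U 0 isOpen_univ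

end CPoint

open CPoint

lemma HolomorphicAt.congr {X : CScheme} {h h' : CPoint X → ℂ} {p : CPoint X}
    (hh : HolomorphicAt h p) (e : h =ᶠ[𝓝 p] h') : HolomorphicAt h' p := by
  obtain ⟨U, N, g, F, hp, hF, hq⟩ := hh
  refine ⟨U, N, g, F, hp, hF, ?_⟩
  filter_upwards [hq, e] with q h1 h2
  rw [← h2, h1]

/-- Holomorphic functions pull back along algebraic morphisms. -/
lemma HolomorphicAt.comp_map {X Y : CScheme} (f : X ⟶ Y) {h : CPoint Y → ℂ} {p : CPoint X}
    (hh : HolomorphicAt h (map f p)) : HolomorphicAt (h ∘ map f) p := by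
  obtain ⟨U, N, g, F, hp, hF, hq⟩ := hh
  refine ⟨f.left ⁻¹ᵁ U, N, fun i ↦ f.left.app U (g i), F, hp, ?_, ?_⟩
  · simpa only [map_eval] using hF
  · have := (continuous_map f).continuousAt.eventually hq
    filter_upwards [this] with q hq
    simpa only [map_eval, Function.comp_apply] using hq

section OpenImmersion

variable {X Y : CScheme} (f : X ⟶ Y) [IsOpenImmersion f.left]

lemma CPoint.map_injective : Function.Injective (map f) := by
  intro p q h
  have := congrArg Subtype.val h
  exact Subtype.ext ((cancel_mono f.left).1 this)

lemma CPoint.exists_map_eq {q : CPoint Y} (hq : q.pt ∈ f.left.opensRange) : ∃ p, map f p = q := by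
  have hr : Set.range q.1 ⊆ Set.range f.left := by
    rintro _ ⟨z, rfl⟩
    have : z = IsLocalRing.closedPoint ℂ := Subsingleton.elim _ _
    rw [this]
    exact hq
  refine ⟨⟨IsOpenImmersion.lift f.left q.1 hr, ?_⟩, ?_⟩
  · rw [← Over.w f, IsOpenImmersion.lift_fac_assoc]
    exact q.2
  · exact Subtype.ext (IsOpenImmersion.lift_fac _ _ _)

lemma CPoint.eval_eq_eval_image (p : CPoint X) {U : X.left.Opens} (g : Γ(X.left, U)) :
    p.eval g = (map f p).eval ((f.left.appIso U).inv g) := by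
  rw [map_eval]
  have : f.left.app (f.left ''ᵁ U) ((f.left.appIso U).inv g) =
      X.left.presheaf.map (eqToHom (f.left.preimage_image_eq U)).op g := by
    have := congrArg (fun k ↦ k.hom g) (Scheme.Hom.appIso_inv_app f.left U)
    exact this
  rw [this]
  by_cases hp : p.pt ∈ U
  · rw [eval_restrict]
    rw [f.left.preimage_image_eq]; exact hp
  · have hp' : ¬ p.pt ∈ f.left ⁻¹ᵁ f.left ''ᵁ U := by rwa [f.left.preimage_image_eq]
    rw [eval, eval, dif_neg hp, dif_neg hp']

lemma CPoint.pt_mem_iff (p : CPoint X) (U : X.left.Opens) :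
    p.pt ∈ U ↔ (map f p).pt ∈ f.left ''ᵁ U := by
  conv_lhs => rw [← f.left.preimage_image_eq U]
  rfl

/-- The analytic topology of an open subscheme is the subspace topology. -/
lemma CPoint.isOpenEmbedding_map : IsOpenEmbedding (map f) := by
  refine .of_continuous_injective_isOpenMap (continuous_map f) (map_injective f) ?_
  have hr : IsOpen (Set.range (map f)) := by
    convert isOpen_setOf_pt_mem (X := Y) f.left.opensRange using 1
    ext q
    constructor
    · rintro ⟨p, rfl⟩
      exact ⟨_, rfl⟩
    · exact fun hq ↦ exists_map_eq f hq
  refine (Topology.IsInducing.isOpenMap (f := map f) ?_ hr)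
  refine ⟨le_antisymm (continuous_iff_le_induced.1 (continuous_map f)) ?_⟩
  refine le_generateFrom ?_
  rintro _ ⟨U, g, W, hW, rfl⟩
  refine ⟨_, isOpen_setOf_eval_mem (X := Y) (f.left ''ᵁ U) ((f.left.appIso U).inv g) hW, ?_⟩
  ext p
  simp only [Set.mem_preimage, Set.mem_ofPred_eq, ← eval_eq_eval_image, ← pt_mem_iff]

lemma HolomorphicAt.of_comp_map {h : CPoint Y → ℂ} {p : CPoint X}
    (hh : HolomorphicAt (h ∘ map f) p) : HolomorphicAt h (map f p) := by
  obtain ⟨U, N, g, F, hp, hF, hq⟩ := hh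
  refine ⟨f.left ''ᵁ U, N, fun i ↦ (f.left.appIso U).inv (g i), F, (pt_mem_iff f p U).1 hp, ?_, ?_⟩
  · simpa only [← eval_eq_eval_image] using hF
  · rw [← (isOpenEmbedding_map f).map_nhds_eq, eventually_map]
    filter_upwards [hq] with q hq
    simpa only [← eval_eq_eval_image, Function.comp_apply] using hq

end OpenImmersion

/-- An open immersion is a local isomorphism for the analytic structures. -/
lemma LocallyAnalyticallyIso.of_isOpenImmersion {X Y : CScheme} (f : X ⟶ Y)
    [IsOpenImmersion f.left] (p : CPoint X) : LocallyAnalyticallyIso p (map f p) := by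
  have : Nonempty (CPoint X) := ⟨p⟩
  refine ⟨(isOpenEmbedding_map f).toOpenPartialHomeomorph _, Set.mem_univ _, rfl, ?_⟩
  intro q _ h
  exact ⟨fun hh ↦ hh.comp_map f, fun hh ↦ hh.of_comp_map f⟩

lemma LocallyAnalyticallyIso.symm {X Y : CScheme} {x : CPoint X} {y : CPoint Y}
    (h : LocallyAnalyticallyIso x y) : LocallyAnalyticallyIso y x := by
  obtain ⟨φ, hx, rfl, hφ⟩ := h
  refine ⟨φ.symm, φ.map_source hx, φ.left_inv hx, ?_⟩
  intro q hq h
  have hs : φ.symm q ∈ φ.source := φ.map_target hq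
  have := hφ _ hs (h ∘ φ.symm)
  rw [φ.right_inv hq] at this
  rw [this]
  have e : h =ᶠ[𝓝 (φ.symm q)] (h ∘ φ.symm) ∘ φ := by
    filter_upwards [φ.open_source.mem_nhds hs] with z hz
    simp [φ.left_inv hz]
  exact ⟨fun k ↦ k.congr e, fun k ↦ k.congr e.symm⟩

lemma LocallyAnalyticallyIso.trans {X Y Z : CScheme} {x : CPoint X} {y : CPoint Y} {z : CPoint Z}
    (h : LocallyAnalyticallyIso x y) (h' : LocallyAnalyticallyIso y z) :
    LocallyAnalyticallyIso x z := by
  obtain ⟨φ, hx, rfl, hφ⟩ := h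
  obtain ⟨ψ, hy, rfl, hψ⟩ := h'
  refine ⟨φ.trans ψ, ⟨hx, hy⟩, rfl, ?_⟩
  rintro q ⟨hq, hq'⟩ h
  exact (hψ _ hq' h).trans (hφ q hq (h ∘ ψ))

/-! ### Complex points of affine schemes -/

section Affine

variable {A : Type} [CommRing A] [Algebra ℂ A] {B : Type} [CommRing B] [Algebra ℂ B]

/-- The morphism of affine schemes over `ℂ` given by a homomorphism of `ℂ`-algebras. -/
def specCMap (φ : A →ₐ[ℂ] B) : specC B ⟶ specC A :=
  Over.homMk (Spec.map (CommRingCat.ofHom φ.toRingHom)) (by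
    change Spec.map _ ≫ Spec.map _ = Spec.map _
    rw [← Spec.map_comp, ← CommRingCat.ofHom_comp]
    congr 2
    exact φ.comp_algebraMap)

namespace CPoint

lemma specMap_evalSpec (p : CPoint (specC A)) : Spec.map (CommRingCat.ofHom p.evalSpec) = p.1 :=
  Spec.map_preimage (R := CommRingCat.of A) (S := CommRingCat.of ℂ) p.1

lemma evalSpec_injective {p q : CPoint (specC A)} (h : p.evalSpec = q.evalSpec) : p = q := by
  apply Subtype.ext
  rw [← specMap_evalSpec, ← specMap_evalSpec, h]

lemma evalSpec_algebraMap (p : CPoint (specC A)) (c : ℂ) : p.evalSpec (algebraMap ℂ A c) = c := by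
  have h := p.2
  rw [← specMap_evalSpec] at h
  change Spec.map _ ≫ Spec.map _ = _ at h
  rw [← Spec.map_comp, ← Spec.map_id] at h
  exact congrArg (fun k ↦ k.hom c) (Spec.map_injective h)

/-- The evaluation at a complex point of `Spec A`, as a homomorphism of `ℂ`-algebras. -/
def evalAlgHom (p : CPoint (specC A)) : A →ₐ[ℂ] ℂ := ⟨p.evalSpec, p.evalSpec_algebraMap⟩

@[simp] lemma evalAlgHom_apply (p : CPoint (specC A)) (f : A) : p.evalAlgHom f = p.evalSpec f := rfl

/-- The complex point of `Spec A` given by a homomorphism `A → ℂ`. -/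
def ofAlgHom (φ : A →ₐ[ℂ] ℂ) : CPoint (specC A) :=
  ⟨Spec.map (CommRingCat.ofHom φ.toRingHom), by
    change Spec.map _ ≫ Spec.map _ = _
    rw [← Spec.map_comp, ← CommRingCat.ofHom_comp, ← Spec.map_id]
    congr 1
    ext x
    exact φ.commutes x⟩

@[simp] lemma evalSpec_ofAlgHom (φ : A →ₐ[ℂ] ℂ) (f : A) : (ofAlgHom φ).evalSpec f = φ f := by
  have : CommRingCat.ofHom (ofAlgHom φ).evalSpec = CommRingCat.ofHom φ.toRingHom :=
    Spec.map_injective (specMap_evalSpec _)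
  exact congrArg (fun k ↦ k.hom f) this

lemma evalSpec_map (φ : A →ₐ[ℂ] B) (p : CPoint (specC B)) (f : A) :
    (map (specCMap φ) p).evalSpec f = p.evalSpec (φ f) := by
  have : CommRingCat.ofHom (map (specCMap φ) p).evalSpec =
      CommRingCat.ofHom (p.evalSpec.comp φ.toRingHom) := by
    apply Spec.map_injective
    rw [specMap_evalSpec, CommRingCat.ofHom_comp, Spec.map_comp, specMap_evalSpec]
    rfl
  exact congrArg (fun k ↦ k.hom f) this

/-- A function `f ∈ A` as a global section of `Spec A`. -/
def section_ (f : A) : Γ((specC A).left, ⊤) := (Scheme.ΓSpecIso (CommRingCat.of A)).inv f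

lemma section_surjective : Function.Surjective (section_ (A := A)) := fun f ↦
  ⟨(Scheme.ΓSpecIso (CommRingCat.of A)).hom f,
    congrArg (fun k ↦ k.hom f) (Scheme.ΓSpecIso (CommRingCat.of A)).hom_inv_id⟩

lemma eval_section (p : CPoint (specC A)) (f : A) : p.eval (section_ f) = p.evalSpec f := by
  rw [eval_of_mem p (by trivial)]
  have hp := specMap_evalSpec p
  have h := Scheme.germ_stalkClosedPointTo_Spec (CommRingCat.ofHom p.evalSpec)
  have h' : ((Spec (CommRingCat.of A)).presheaf.germ ⊤ _ trivial ≫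
      Scheme.stalkClosedPointTo p.1) = (Scheme.ΓSpecIso _).hom ≫ CommRingCat.ofHom p.evalSpec := by
    rw [← h]
    rw [hp]
    rfl
  have := congrArg (fun k ↦ k.hom (section_ f)) h'
  refine this.trans ?_
  change p.evalSpec ((Scheme.ΓSpecIso (CommRingCat.of A)).hom
    ((Scheme.ΓSpecIso (CommRingCat.of A)).inv f)) = _
  rw [← CommRingCat.comp_apply, Iso.inv_hom_id]; rfl

lemma pt_mem_basicOpen (p : CPoint (specC A)) (f : A) :
    p.pt ∈ PrimeSpectrum.basicOpen f ↔ p.evalSpec f ≠ 0 := by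
  rw [← eval_section, eval_ne_zero_iff]
  have : (specC A).left.basicOpen (section_ f) = PrimeSpectrum.basicOpen f :=
    basicOpen_eq_of_affine (R := CommRingCat.of A) f
  rw [this]
  rfl

/-- Near a complex point of `Spec A`, a regular function is a quotient of elements of `A`. -/
lemma exists_eval_eq_div (p : CPoint (specC A)) {U : (specC A).left.Opens} (hp : p.pt ∈ U)
    (g : Γ((specC A).left, U)) : ∃ f h : A, p.evalSpec h ≠ 0 ∧
      ∀ q : CPoint (specC A), q.evalSpec h ≠ 0 → q.pt ∈ U ∧ q.eval g = q.evalSpec f / q.evalSpec h := by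
  obtain ⟨_, ⟨_, ⟨(h : A), rfl⟩, rfl⟩, hph, hU⟩ :=
    PrimeSpectrum.isBasis_basic_opens.exists_subset_of_mem_open hp U.2
  have hb : (specC A).left.basicOpen (section_ h) = PrimeSpectrum.basicOpen h :=
    basicOpen_eq_of_affine (R := CommRingCat.of A) h
  have hU' : (specC A).left.basicOpen (section_ h) ≤ U := by rw [hb]; exact hU
  have hmem (q : CPoint (specC A)) : q.pt ∈ (specC A).left.basicOpen (section_ h) ↔
      q.evalSpec h ≠ 0 := by rw [← eval_ne_zero_iff, eval_section]
  have haff : IsAffine (specC A).left := inferInstanceAs (IsAffine (Spec (CommRingCat.of A)))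
  have hloc := (isAffineOpen_top (specC A).left).isLocalization_basicOpen (section_ h)
  obtain ⟨k, f, hf⟩ := IsLocalization.Away.surj (section_ h)
    ((specC A).left.presheaf.map (homOfLE hU').op g)
  obtain ⟨f, rfl⟩ := section_surjective (A := A) f
  have hres (q : CPoint (specC A)) (hq : q.evalSpec h ≠ 0) (f' : A) :
      q.eval (algebraMap _ Γ((specC A).left, (specC A).left.basicOpen (section_ h)) (section_ f')) =
        q.evalSpec f' := by
    rw [← eval_section]
    exact eval_restrict q _ ((hmem q).2 hq) _
  -- the extra factor `h` in the denominator makes it vanish outside the basic open set even if `k = 0`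
  refine ⟨f * h, h ^ (k + 1), ?_, fun q hq ↦ ?_⟩
  · rw [map_pow]
    exact pow_ne_zero _ ((pt_mem_basicOpen p h).1 hph)
  · rw [map_pow] at hq
    have hq' : q.evalSpec h ≠ 0 := fun h0 ↦ hq (by rw [h0, zero_pow (Nat.succ_ne_zero k)])
    have hqm := (hmem q).2 hq'
    refine ⟨hU' hqm, ?_⟩
    have := congrArg q.eval hf
    rw [← map_pow, eval_mul, hres q hq' f, eval_restrict q _ hqm] at this
    have hpow : q.eval (algebraMap _ Γ((specC A).left, (specC A).left.basicOpen (section_ h))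
        (section_ h ^ k)) = q.evalSpec h ^ k := by
      rw [← map_pow, ← hres q hq' (h ^ k)]
      congr 2
      exact (map_pow (Scheme.ΓSpecIso (CommRingCat.of A)).inv.hom h k).symm
    rw [hpow] at this
    rw [map_mul, map_pow, eq_div_iff hq, ← this]
    ring

end CPoint
end Affine

/-! ### Affine coordinates on complex points -/

lemma analyticAt_mvPolynomial_eval {ι : Type} [Fintype ι] (F : MvPolynomial ι ℂ) (v : ι → ℂ) :
    AnalyticAt ℂ (fun w ↦ MvPolynomial.eval w F) v :=
  AnalyticOnNhd.eval_mvPolynomial F v trivial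

section Coordinates

variable {A : Type} [CommRing A] [Algebra ℂ A] {ι : Type} (β : ι → A)

/-- The coordinates of a complex point of `Spec A` with respect to a family of elements of `A`. -/
def CPoint.coords (p : CPoint (specC A)) : ι → ℂ := fun i ↦ p.evalSpec (β i)

variable {β}

/-- Every element of `A` is a polynomial function of the coordinates. -/
lemma exists_evalSpec_eq_eval (hβ : Algebra.adjoin ℂ (Set.range β) = ⊤) (f : A) :
    ∃ F : MvPolynomial ι ℂ, ∀ p : CPoint (specC A), p.evalSpec f = MvPolynomial.eval (p.coords β) F := by
  have hf : f ∈ Algebra.adjoin ℂ (Set.range β) := hβ ▸ Algebra.mem_top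
  rw [Algebra.adjoin_range_eq_range_aeval] at hf
  obtain ⟨F, rfl⟩ := hf
  refine ⟨F, fun p ↦ ?_⟩
  have : (p.evalAlgHom.comp (MvPolynomial.aeval β)) = MvPolynomial.aeval (p.coords β) := by
    ext i
    simp [CPoint.coords]
  have := congrArg (fun k ↦ k F) this
  simpa [MvPolynomial.aeval_eq_eval] using this

lemma coords_injective (hβ : Algebra.adjoin ℂ (Set.range β) = ⊤) :
    Function.Injective (CPoint.coords β) := by
  intro p q h
  apply CPoint.evalSpec_injective
  ext f
  obtain ⟨F, hF⟩ := exists_evalSpec_eq_eval hβ f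
  rw [hF, hF, h]

lemma CPoint.continuous_evalSpec (f : A) : Continuous fun p : CPoint (specC A) ↦ p.evalSpec f := by
  refine continuous_def.2 fun W hW ↦ ?_
  convert CPoint.isOpen_setOf_eval_mem (X := specC A) ⊤ (CPoint.section_ f) hW using 1
  ext p
  simp only [Set.mem_preimage, Set.mem_ofPred_eq, CPoint.eval_section]
  exact ⟨fun h ↦ ⟨trivial, h⟩, fun h ↦ h.2⟩

/-- The analytic topology on the complex points of `Spec A` is the one induced by the coordinates with
respect to generators of `A`. -/
lemma isInducing_coords (hβ : Algebra.adjoin ℂ (Set.range β) = ⊤) :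
    IsInducing (CPoint.coords β) := by
  refine ⟨le_antisymm (continuous_iff_le_induced.1
    (continuous_pi fun i ↦ CPoint.continuous_evalSpec (β i))) (le_generateFrom ?_)⟩
  rintro _ ⟨U, g, W, hW, rfl⟩
  rw [@isOpen_iff_mem_nhds _ (_)]
  rintro p ⟨hp, hg⟩
  obtain ⟨f, h, hh, hq⟩ := p.exists_eval_eq_div hp g
  obtain ⟨F, hF⟩ := exists_evalSpec_eq_eval hβ f
  obtain ⟨H, hH⟩ := exists_evalSpec_eq_eval hβ h
  rw [nhds_induced]
  have hc : ContinuousAt (fun v ↦ MvPolynomial.eval v F / MvPolynomial.eval v H) (p.coords β) :=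
    ((MvPolynomial.continuous_eval F).continuousAt).div (MvPolynomial.continuous_eval H).continuousAt
      (by rwa [← hH])
  have h1 : ∀ᶠ v in 𝓝 (p.coords β), MvPolynomial.eval v H ≠ 0 :=
    (MvPolynomial.continuous_eval H).continuousAt.eventually_ne (by rwa [← hH])
  have h2 : ∀ᶠ v in 𝓝 (p.coords β), MvPolynomial.eval v F / MvPolynomial.eval v H ∈ W := by
    refine hc.eventually_mem (hW.mem_nhds ?_)
    rwa [← hH, ← hF, ← (hq p hh).2]
  refine ⟨_, h1.and h2, ?_⟩
  rintro q ⟨hq1, hq2⟩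
  rw [← hH] at hq1
  have := hq q hq1
  exact ⟨this.1, by rw [this.2, hH, hF]; exact hq2⟩

variable [Fintype ι]

/-- A function on the complex points of `Spec A` is holomorphic if it is locally an analytic function of
the coordinates with respect to generators of `A`. -/
lemma holomorphicAt_iff (hβ : Algebra.adjoin ℂ (Set.range β) = ⊤) {h : CPoint (specC A) → ℂ}
    {p : CPoint (specC A)} : HolomorphicAt h p ↔ ∃ F : (ι → ℂ) → ℂ,
      AnalyticAt ℂ F (p.coords β) ∧ ∀ᶠ q in 𝓝 p, h q = F (q.coords β) := by
  constructor
  · rintro ⟨U, N, g, F, hp, hF, hq⟩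
    choose f k hk hfk using fun i ↦ p.exists_eval_eq_div hp (g i)
    choose f' hf' using fun i ↦ exists_evalSpec_eq_eval hβ (f i)
    choose k' hk' using fun i ↦ exists_evalSpec_eq_eval hβ (k i)
    refine ⟨fun v ↦ F fun i ↦ MvPolynomial.eval v (f' i) / MvPolynomial.eval v (k' i), ?_, ?_⟩
    · refine AnalyticAt.fun_comp (g := F) ?_ ?_
      · convert hF using 2 with i
        rw [← hf', ← hk', (hfk i p (hk i)).2]
      · refine AnalyticAt.pi fun i ↦ ?_
        exact (analyticAt_mvPolynomial_eval _ _).div (analyticAt_mvPolynomial_eval _ _)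
          (by rw [← hk']; exact hk i)
    · have hne : ∀ᶠ q in 𝓝 p, ∀ i, q.evalSpec (k i) ≠ 0 :=
        eventually_all.2 fun i ↦ (CPoint.continuous_evalSpec (k i)).continuousAt.eventually_ne (hk i)
      filter_upwards [hq, hne] with q hq hne
      rw [hq]
      congr 1
      ext i
      rw [← hf', ← hk', (hfk i q (hne i)).2]
  · rintro ⟨F, hF, hq⟩
    let e := Fintype.equivFin ι
    refine ⟨⊤, Fintype.card ι, fun i ↦ CPoint.section_ (β (e.symm i)), fun v ↦ F fun i ↦ v (e i),
      trivial, ?_, ?_⟩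
    · refine AnalyticAt.fun_comp (g := F) ?_ ?_
      · convert hF using 2 with i
        simp [CPoint.eval_section, CPoint.coords]
      · refine AnalyticAt.pi fun i ↦ ?_
        exact (ContinuousLinearMap.proj (R := ℂ) (φ := fun _ ↦ ℂ) (e i)).analyticAt _
    · filter_upwards [hq] with q hq
      rw [hq]
      congr 1
      ext i
      simp [CPoint.eval_section, CPoint.coords]

/-- A criterion for a local analytic isomorphism between affine schemes in terms of coordinates:
it suffices to have analytic maps between the ambient affine spaces that are defined near the
points in question and restrict to mutually inverse maps of the sets of complex points. -/
lemma LocallyAnalyticallyIso.of_coords {B : Type} [CommRing B] [Algebra ℂ B] {κ : Type} [Fintype κ]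
    {γ : κ → B} (hβ : Algebra.adjoin ℂ (Set.range β) = ⊤) (hγ : Algebra.adjoin ℂ (Set.range γ) = ⊤)
    (p : CPoint (specC A)) (t : CPoint (specC B)) (Φ : (ι → ℂ) → κ → ℂ) (Ψ : (κ → ℂ) → ι → ℂ)
    (hΦ : AnalyticAt ℂ Φ (p.coords β)) (hΨ : AnalyticAt ℂ Ψ (t.coords γ))
    (hpt : Φ (p.coords β) = t.coords γ)
    (h₁ : ∀ᶠ q in 𝓝 p, ∃ q' : CPoint (specC B),
      q'.coords γ = Φ (q.coords β) ∧ Ψ (q'.coords γ) = q.coords β)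
    (h₂ : ∀ᶠ q' in 𝓝 t, ∃ q : CPoint (specC A),
      q.coords β = Ψ (q'.coords γ) ∧ Φ (q.coords β) = q'.coords γ) :
    LocallyAnalyticallyIso p t := by
  classical
  have iβ := isInducing_coords hβ
  have iγ := isInducing_coords hγ
  have jβ := coords_injective hβ
  have jγ := coords_injective hγ
  -- neighbourhoods on which all the hypotheses hold; `f` and `g` are the maps on complex points
  obtain ⟨O₁, hO₁, oO₁, pO₁⟩ := eventually_nhds_iff.1
    (h₁.and (iβ.continuous.continuousAt.eventually hΦ.eventually_analyticAt))
  obtain ⟨O₂, hO₂, oO₂, tO₂⟩ := eventually_nhds_iff.1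
    (h₂.and (iγ.continuous.continuousAt.eventually hΨ.eventually_analyticAt))
  have : Nonempty (CPoint (specC A)) := ⟨p⟩
  have : Nonempty (CPoint (specC B)) := ⟨t⟩
  choose! f hf hf' using fun q hq ↦ (hO₁ q hq).1
  choose! g hg hg' using fun q hq ↦ (hO₂ q hq).1
  -- continuity may be tested on the coordinates, where `f` is given by `Φ`
  have cf : ContinuousOn f O₁ := by
    intro q hq
    rw [iγ.continuousWithinAt_iff]
    have : ContinuousWithinAt (fun q ↦ Φ (q.coords β)) O₁ q :=
      (ContinuousAt.comp (f := CPoint.coords β) (hO₁ q hq).2.continuousAt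
        iβ.continuous.continuousAt).continuousWithinAt
    exact this.congr (fun q hq ↦ hf q hq) (hf q hq)
  have cg : ContinuousOn g O₂ := by
    intro q hq
    rw [iβ.continuousWithinAt_iff]
    have : ContinuousWithinAt (fun q ↦ Ψ (q.coords γ)) O₂ q :=
      (ContinuousAt.comp (f := CPoint.coords γ) (hO₂ q hq).2.continuousAt
        iγ.continuous.continuousAt).continuousWithinAt
    exact this.congr (fun q hq ↦ hg q hq) (hg q hq)
  have hgf (q) (hq : q ∈ O₁) (hq' : f q ∈ O₂) : g (f q) = q := by
    apply jβ
    rw [hg _ hq', hf' q hq]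
  have hfg (q) (hq : q ∈ O₂) (hq' : g q ∈ O₁) : f (g q) = q := by
    apply jγ
    rw [hf _ hq', hg' q hq]
  have hfp : f p = t := jγ (by rw [hf p pO₁, hpt])
  let φ : OpenPartialHomeomorph (CPoint (specC A)) (CPoint (specC B)) :=
    { toFun := f
      invFun := g
      source := O₁ ∩ f ⁻¹' O₂
      target := O₂ ∩ g ⁻¹' O₁
      map_source' := fun q hq ↦ ⟨hq.2, by rw [Set.mem_preimage, hgf q hq.1 hq.2]; exact hq.1⟩
      map_target' := fun q hq ↦ ⟨hq.2, by rw [Set.mem_preimage, hfg q hq.1 hq.2]; exact hq.1⟩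
      left_inv' := fun q hq ↦ hgf q hq.1 hq.2
      right_inv' := fun q hq ↦ hfg q hq.1 hq.2
      open_source := cf.isOpen_inter_preimage oO₁ oO₂
      open_target := cg.isOpen_inter_preimage oO₂ oO₁
      continuousOn_toFun := cf.mono Set.inter_subset_left
      continuousOn_invFun := cg.mono Set.inter_subset_left }
  have key₁ (q) (hq : q ∈ φ.source) (h : CPoint (specC B) → ℂ) (hh : HolomorphicAt h (f q)) :
      HolomorphicAt (h ∘ f) q := by
    obtain ⟨F, hF, hFe⟩ := (holomorphicAt_iff hγ).1 hh
    refine (holomorphicAt_iff hβ).2 ⟨F ∘ Φ, ?_, ?_⟩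
    · rw [hf q hq.1] at hF
      exact hF.comp (hO₁ q hq.1).2
    · filter_upwards [(cf.continuousAt (oO₁.mem_nhds hq.1)).eventually hFe, oO₁.mem_nhds hq.1]
        with z hz hz'
      rw [Function.comp_apply, hz, hf z hz', Function.comp_apply]
  have key₂ (q) (hq : q ∈ φ.target) (h : CPoint (specC A) → ℂ) (hh : HolomorphicAt h (g q)) :
      HolomorphicAt (h ∘ g) q := by
    obtain ⟨F, hF, hFe⟩ := (holomorphicAt_iff hβ).1 hh
    refine (holomorphicAt_iff hγ).2 ⟨F ∘ Ψ, ?_, ?_⟩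
    · rw [hg q hq.1] at hF
      exact hF.comp (hO₂ q hq.1).2
    · filter_upwards [(cg.continuousAt (oO₂.mem_nhds hq.1)).eventually hFe, oO₂.mem_nhds hq.1]
        with z hz hz'
      rw [Function.comp_apply, hz, hg z hz', Function.comp_apply]
  refine ⟨φ, ⟨pO₁, by rw [Set.mem_preimage, hfp]; exact tO₂⟩, hfp, fun q hq h ↦
    ⟨key₁ q hq h, fun hh ↦ ?_⟩⟩
  have hq' := φ.map_source hq
  have := key₂ (φ q) hq' (h ∘ φ) (by
    change HolomorphicAt _ (φ.symm (φ q))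
    rwa [φ.left_inv hq])
  refine this.congr ?_
  filter_upwards [φ.open_target.mem_nhds hq'] with z hz
  exact congrArg h (φ.right_inv hz)

end Coordinates

/-! ### Analytic inverses of étale coordinates -/

/-- The differential of a polynomial function. -/
def mvPolynomialFDeriv {ι : Type} [Fintype ι] (F : MvPolynomial ι ℂ) (v : ι → ℂ) :
    (ι → ℂ) →L[ℂ] ℂ :=
  ∑ i, MvPolynomial.eval v (MvPolynomial.pderiv i F) •
    ContinuousLinearMap.proj (R := ℂ) (φ := fun _ : ι ↦ ℂ) i

lemma mvPolynomialFDeriv_apply {ι : Type} [Fintype ι] (F : MvPolynomial ι ℂ) (v w : ι → ℂ) :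
    mvPolynomialFDeriv F v w = ∑ i, MvPolynomial.eval v (MvPolynomial.pderiv i F) * w i := by
  simp [mvPolynomialFDeriv]

lemma hasStrictFDerivAt_mvPolynomial_eval {ι : Type} [Fintype ι] (F : MvPolynomial ι ℂ)
    (v : ι → ℂ) :
    HasStrictFDerivAt (fun w ↦ MvPolynomial.eval w F) (mvPolynomialFDeriv F v) v := by
  classical
  induction F using MvPolynomial.induction_on with
  | C a =>
    refine HasStrictFDerivAt.congr_fderiv (f' := 0) ?_ ?_
    · simpa using hasStrictFDerivAt_const a v
    · ext w; simp [mvPolynomialFDeriv_apply]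
  | add p q hp hq =>
    simp only [map_add]
    refine HasStrictFDerivAt.congr_fderiv (hp.fun_add hq) ?_
    ext w
    simp [mvPolynomialFDeriv_apply, add_mul, Finset.sum_add_distrib]
  | mul_X p j hp =>
    simp only [map_mul, MvPolynomial.eval_X]
    have hX : HasStrictFDerivAt (fun w : ι → ℂ ↦ w j)
        (ContinuousLinearMap.proj (R := ℂ) (φ := fun _ : ι ↦ ℂ) j) v :=
      (ContinuousLinearMap.proj (R := ℂ) (φ := fun _ : ι ↦ ℂ) j).hasStrictFDerivAt
    refine HasStrictFDerivAt.congr_fderiv (hp.mul hX) ?_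
    ext w
    change MvPolynomial.eval v p * w j + v j * mvPolynomialFDeriv p v w = _
    simp only [mvPolynomialFDeriv_apply, Derivation.leibniz, MvPolynomial.pderiv_X, smul_eq_mul,
      map_add, map_mul, MvPolynomial.eval_X, add_mul, Finset.sum_add_distrib, Finset.mul_sum]
    congr 1
    · rw [Finset.sum_eq_single j]
      · simp
      · intro i _ hij
        simp [hij]
      · simp
    · exact Finset.sum_congr rfl fun i _ ↦ by ring

lemma exists_ringHom_comp_eq {R S T : Type*} [CommRing R] [CommRing S] [CommRing T] (f : R →+* S)
    (hf : Function.Surjective f) (g : R →+* T) (h : RingHom.ker f ≤ RingHom.ker g) :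
    ∃ k : S →+* T, ∀ r, k (f r) = g r :=
  ⟨RingHom.liftOfSurjective f hf ⟨g, h⟩, fun r ↦
    RingHom.liftOfRightInverse_comp_apply f _ (Function.rightInverse_surjInv hf) ⟨g, h⟩ r⟩

set_option maxHeartbeats 400000 in
open MvPolynomial in
/-- Étale coordinates are analytic coordinates: if `A` is étale over `ℂ[x_1, …, x_n]`, then near a
complex point of `Spec A` the coordinates of a point are analytic functions of `x_1, …, x_n`. -/
lemma exists_analytic_section {n : ℕ} {A : Type} [CommRing A] [Algebra ℂ A]
    [Algebra (MvPolynomial (Fin n) ℂ) A] [IsScalarTower ℂ (MvPolynomial (Fin n) ℂ) A]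
    [Algebra.Etale (MvPolynomial (Fin n) ℂ) A] (p : CPoint (specC A)) :
    let x : Fin n → A := fun i ↦ algebraMap (MvPolynomial (Fin n) ℂ) A (X i)
    ∃ (κ : Type) (_ : Fintype κ) (α : κ → A) (G : (Fin n → ℂ) → κ → ℂ),
      Algebra.adjoin ℂ (Set.range α) = ⊤ ∧ AnalyticAt ℂ G (p.coords x) ∧
      (∀ᶠ q in 𝓝 p, G (q.coords x) = q.coords α) ∧
      ∀ᶠ ξ in 𝓝 (p.coords x), ∃ q : CPoint (specC A), q.coords x = ξ ∧ q.coords α = G ξ := by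
  classical
  intro x
  obtain ⟨ι, σ, hσ, hι, Q, hQ⟩ :=
    (Algebra.Etale.iff_isStandardSmoothOfRelativeDimension_zero.1 ‹_› :
      Algebra.IsStandardSmoothOfRelativeDimension 0 (MvPolynomial (Fin n) ℂ) A).out
  -- `A` is the quotient of a polynomial ring over `ℂ[x_1, …, x_n]` in the variables `ι` by as many
  -- relations `σ`, with invertible Jacobian; `e` is the bijection between relations and variables
  have := Fintype.ofFinite ι
  have := Fintype.ofFinite σ
  have hle := Q.card_relations_le_card_vars_of_isFinite
  have hcard : Fintype.card σ = Fintype.card ι := by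
    simp only [Algebra.Presentation.dimension, Nat.card_eq_fintype_card] at hQ hle
    omega
  have hmap : Function.Bijective Q.map :=
    (Fintype.bijective_iff_injective_and_card _).2 ⟨Q.map_inj, hcard⟩
  let e := Equiv.ofBijective Q.map hmap
  -- evaluation of a polynomial with coefficients in `ℂ[x_1, …, x_n]`
  let ev (ξ : Fin n → ℂ) (v : ι → ℂ) : MvPolynomial ι (MvPolynomial (Fin n) ℂ) →+* ℂ :=
    eval₂Hom (eval ξ) v
  have hev (q : CPoint (specC A)) (r : MvPolynomial ι (MvPolynomial (Fin n) ℂ)) :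
      ev (q.coords x) (q.coords Q.val) r = q.evalSpec (aeval Q.val r) := by
    have : ev (q.coords x) (q.coords Q.val) = q.evalSpec.comp (aeval Q.val).toRingHom := by
      ext i
      · simp [ev]
        have h1 := IsScalarTower.algebraMap_apply ℂ (MvPolynomial (Fin n) ℂ) A i
        rw [MvPolynomial.algebraMap_eq] at h1
        rw [← h1, CPoint.evalSpec_algebraMap]
      · simp [ev, CPoint.coords, x]
      · simp [ev, CPoint.coords]
    rw [this]; rfl
  have hev_joint (r : MvPolynomial ι (MvPolynomial (Fin n) ℂ)) (ξ : Fin n → ℂ) (v : ι → ℂ) :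
      ev ξ v r = eval (Sum.elim v ξ) ((sumAlgEquiv ℂ ι (Fin n)).symm r) := by
    obtain ⟨r, rfl⟩ := (sumAlgEquiv ℂ ι (Fin n)).surjective r
    rw [AlgEquiv.symm_apply_apply]
    have : (ev ξ v).comp (sumAlgEquiv ℂ ι (Fin n)).toRingEquiv.toRingHom = eval (Sum.elim v ξ) := by
      ext i
      · change ev ξ v (sumAlgEquiv ℂ ι (Fin n) (C i)) = _
        simp [ev, sumAlgEquiv_C_inl]
      · rcases i with i | i
        · change ev ξ v (sumAlgEquiv ℂ ι (Fin n) (X (Sum.inl i))) = _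
          rw [sumAlgEquiv_X_inl]
          simp [ev]
        · change ev ξ v (sumAlgEquiv ℂ ι (Fin n) (X (Sum.inr i))) = _
          rw [sumAlgEquiv_X_inr]
          simp [ev]
    rw [← this]; rfl
  have hev_map (r : MvPolynomial ι (MvPolynomial (Fin n) ℂ)) (ξ : Fin n → ℂ) (v : ι → ℂ) :
      ev ξ v r = eval v (map (eval ξ) r) := by
    simp only [ev, coe_eval₂Hom, MvPolynomial.eval_map]
  -- the system of equations `f = 0` that defines the set of complex points of `Spec A`
  let f : (Fin n → ℂ) × (ι → ℂ) → σ → ℂ := fun z j ↦ ev z.1 z.2 (Q.relation j)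
  have hfan (z) : AnalyticAt ℂ f z := by
    refine AnalyticAt.pi fun j ↦ ?_
    simp only [hev_joint]
    refine AnalyticAt.fun_comp (g := fun w ↦ eval w ((sumAlgEquiv ℂ ι (Fin n)).symm (Q.relation j)))
      (analyticAt_mvPolynomial_eval _ _) (AnalyticAt.pi fun i ↦ ?_)
    rcases i with i | i
    · exact ((ContinuousLinearMap.proj (R := ℂ) (φ := fun _ : ι ↦ ℂ) i).comp
        (ContinuousLinearMap.snd ℂ (Fin n → ℂ) (ι → ℂ))).analyticAt z
    · exact ((ContinuousLinearMap.proj (R := ℂ) (φ := fun _ : Fin n ↦ ℂ) i).comp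
        (ContinuousLinearMap.fst ℂ (Fin n → ℂ) (ι → ℂ))).analyticAt z
  let u : (Fin n → ℂ) × (ι → ℂ) := (p.coords x, p.coords Q.val)
  have hcd : ContDiffAt ℂ ⊤ f u := (hfan u).contDiffAt
  -- the partial derivative of `f` in the direction of the variables `ι` is the Jacobian matrix of the
  -- presentation, so that the implicit function theorem applies
  have hD (v : ι → ℂ) (j : σ) : (fderiv ℂ f u ∘L .inr ℂ (Fin n → ℂ) (ι → ℂ)) v j =
      ∑ i, p.evalSpec (aeval Q.val (pderiv i (Q.relation j))) * v i := by
    have h1 : HasFDerivAt (fun w ↦ f (u.1, w) j)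
        ((ContinuousLinearMap.proj (R := ℂ) (φ := fun _ : σ ↦ ℂ) j).comp
          (fderiv ℂ f u ∘L .inr ℂ (Fin n → ℂ) (ι → ℂ))) u.2 :=
      (ContinuousLinearMap.proj (R := ℂ) (φ := fun _ : σ ↦ ℂ) j).hasFDerivAt.comp u.2
        ((hfan u).differentiableAt.hasFDerivAt.comp u.2 (hasFDerivAt_prodMk_right u.1 u.2))
    have h2 := (hasStrictFDerivAt_mvPolynomial_eval (map (eval u.1) (Q.relation j)) u.2).hasFDerivAt
    have h3 : (fun w ↦ f (u.1, w) j) = fun w ↦ eval w (map (eval u.1) (Q.relation j)) :=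
      funext fun w ↦ hev_map _ _ _
    rw [h3] at h1
    have := congrArg (fun k ↦ k v) (h1.unique h2)
    rw [mvPolynomialFDeriv_apply] at this
    refine Eq.trans ?_ (this.trans (Finset.sum_congr rfl fun i _ ↦ ?_))
    · rfl
    rw [pderiv_map, ← hev_map, hev]
  have hinj : Function.Injective (fderiv ℂ f u ∘L .inr ℂ (Fin n → ℂ) (ι → ℂ)) := by
    rw [injective_iff_map_eq_zero]
    intro v hv
    let J : Matrix σ σ ℂ := (p.evalSpec.comp (aeval Q.val).toRingHom).mapMatrix Q.jacobiMatrix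
    have hJ : J.det ≠ 0 := by
      have h := Q.jacobian_isUnit
      rw [Q.jacobian_eq_jacobiMatrix_det, Q.algebraMap_eq] at h
      have := (h.map p.evalSpec).ne_zero
      rw [← RingHom.map_det]
      exact this
    have h0 : Matrix.vecMul (v ∘ e) J = 0 := by
      ext j
      have := congrFun hv j
      rw [hD] at this
      rw [Pi.zero_apply] at this ⊢
      rw [← this, ← e.sum_comp]
      simp only [Matrix.vecMul, dotProduct, J, RingHom.mapMatrix_apply, Matrix.map_apply,
        Q.jacobiMatrix_apply]
      exact Finset.sum_congr rfl fun i _ ↦ mul_comm _ _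
    have := Matrix.eq_zero_of_vecMul_eq_zero hJ h0
    ext i
    obtain ⟨k, rfl⟩ := e.surjective i
    exact congrFun this k
  have hinv : (fderiv ℂ f u ∘L .inr ℂ (Fin n → ℂ) (ι → ℂ)).IsInvertible := by
    let l := LinearEquiv.ofInjectiveOfFinrankEq
      (fderiv ℂ f u ∘L .inr ℂ (Fin n → ℂ) (ι → ℂ)).toLinearMap hinj (by simp [hcard])
    exact ⟨l.toContinuousLinearEquiv, by ext; rfl⟩
  have hfu (q : CPoint (specC A)) : f (q.coords x, q.coords Q.val) = 0 := by
    ext j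
    simp [f, hev]
  -- the solution of `f (ξ, v) = 0` for `v`
  let ψ := hcd.implicitFunction (by simp) hinv
  refine ⟨Fin n ⊕ ι, inferInstance, Sum.elim x Q.val, fun ξ ↦ Sum.elim ξ (ψ ξ), ?_, ?_, ?_, ?_⟩
  · rw [Algebra.eq_top_iff]
    intro a
    obtain ⟨r, rfl⟩ := Q.toGenerators.algebraMap_surjective a
    rw [Q.algebraMap_eq]
    clear * -
    induction r using MvPolynomial.induction_on with
    | C c =>
      simp only [RingHom.coe_coe, aeval_C]
      induction c using MvPolynomial.induction_on with
      | C c =>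
        have h1 := IsScalarTower.algebraMap_apply ℂ (MvPolynomial (Fin n) ℂ) A c
        rw [MvPolynomial.algebraMap_eq] at h1
        rw [← h1]
        exact Subalgebra.algebraMap_mem _ _
      | add p q hp hq => rw [map_add]; exact add_mem hp hq
      | mul_X p i hp =>
        rw [map_mul]
        exact mul_mem hp (Algebra.subset_adjoin ⟨Sum.inl i, rfl⟩)
    | add p q hp hq => rw [map_add]; exact add_mem hp hq
    | mul_X p i hp =>
      rw [map_mul]
      refine mul_mem hp (Algebra.subset_adjoin ⟨Sum.inr i, by simp⟩)
  · refine AnalyticAt.pi fun i ↦ ?_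
    rcases i with i | i
    · exact (ContinuousLinearMap.proj (R := ℂ) (φ := fun _ ↦ ℂ) i).analyticAt _
    · have h1 : AnalyticAt ℂ ψ u.1 := (hcd.contDiffAt_implicitFunction (by simp) hinv).analyticAt
      exact ((ContinuousLinearMap.proj (R := ℂ) (φ := fun _ : ι ↦ ℂ) i).analyticAt _).comp h1
  · have h1 := hcd.eventually_apply_eq_iff_implicitFunction (by simp) hinv
    have hc : ContinuousAt (fun q : CPoint (specC A) ↦ (q.coords x, q.coords Q.val)) p := by
      refine Continuous.continuousAt (Continuous.prodMk ?_ ?_)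
      · exact continuous_pi fun i ↦ CPoint.continuous_evalSpec _
      · exact continuous_pi fun i ↦ CPoint.continuous_evalSpec _
    filter_upwards [hc.eventually h1] with q hq
    have := hq.1 (by rw [hfu, hfu])
    ext i
    rcases i with i | i
    · rfl
    · exact congrFun this i
  · have h1 := hcd.eventually_apply_implicitFunction (by simp) hinv
    filter_upwards [h1] with ξ hξ
    rw [hfu] at hξ
    -- a solution of the equations is a complex point of `Spec A`
    let θ : MvPolynomial ι (MvPolynomial (Fin n) ℂ) →+* ℂ := ev ξ (ψ ξ)
    have hker : RingHom.ker (algebraMap Q.Ring A) ≤ RingHom.ker θ := by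
      have : RingHom.ker (algebraMap Q.Ring A) = Ideal.span (Set.range Q.relation) :=
        Q.span_range_relation_eq_ker.symm
      rw [this, Ideal.span_le]
      rintro _ ⟨j, rfl⟩
      exact congrFun hξ j
    obtain ⟨θ', hθ'⟩ : ∃ θ' : A →+* ℂ, ∀ r : Q.Ring, θ' (aeval Q.val r) = θ r := by
      have hs : Function.Surjective (aeval Q.val : Q.Ring →ₐ[_] A) := by
        have := Q.toGenerators.algebraMap_surjective
        rwa [Q.algebraMap_eq] at this
      rw [Q.algebraMap_eq] at hker
      exact exists_ringHom_comp_eq _ hs θ hker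
    have hθC (c : MvPolynomial (Fin n) ℂ) : θ' (algebraMap _ A c) = eval ξ c := by
      have := hθ' (C c)
      rw [aeval_C] at this
      rw [this]
      simp [θ, ev]
    let q : CPoint (specC A) := CPoint.ofAlgHom ⟨θ', fun c ↦ by
      have h1 := IsScalarTower.algebraMap_apply ℂ (MvPolynomial (Fin n) ℂ) A c
      change θ' (algebraMap ℂ A c) = c
      rw [h1, hθC, MvPolynomial.algebraMap_eq, eval_C]⟩
    have hq (g : A) : q.evalSpec g = θ' g := CPoint.evalSpec_ofAlgHom _ g
    have hqx : q.coords x = ξ := by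
      ext i
      simp only [CPoint.coords, hq, x, hθC, eval_X]
    refine ⟨q, hqx, ?_⟩
    ext i
    rcases i with i | i
    · exact congrFun hqx i
    · simp only [CPoint.coords, hq, Sum.elim_inr]
      have := hθ' (MvPolynomial.X i)
      rw [aeval_X] at this
      rw [this]
      simp [θ, ev]

/-! ### Cyclic bases and the comparison of analytic germs -/

/-- The exponents `⌊(i + j) a_l / d⌋ - ⌊i a_l / d⌋ - ⌊j a_l / d⌋` in the multiplication table of the
elements `y^j / x^⌊j a / d⌋`. -/
def carry {n : ℕ} (a : Fin n → ℕ) (d i j : ℕ) (l : Fin n) : ℕ :=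
  (i + j) * a l / d - i * a l / d - j * a l / d

lemma carry_add {n : ℕ} (a : Fin n → ℕ) (d i j : ℕ) (l : Fin n) :
    carry a d i j l + i * a l / d + j * a l / d = (i + j) * a l / d := by
  have : i * a l / d + j * a l / d ≤ (i + j) * a l / d := by
    rw [add_mul]; exact Nat.div_add_div_le_add_div
  unfold carry
  omega

/-- A family `b_0, b_1, …` in an `A`-algebra with the multiplication table of the elements
`b_j = y^j / x^⌊j a / d⌋`, where `y^d = u x^a`. -/
structure IsCyclicFamily {A B : Type*} [CommRing A] [CommRing B] [Algebra A B] {n : ℕ} (x : Fin n → A)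
    (u : A) (a : Fin n → ℕ) (d : ℕ) (b : ℕ → B) : Prop where
  zero : b 0 = 1
  add_period (j : ℕ) : b (j + d) = u • b j
  mul (i j : ℕ) : b i * b j = (∏ l, x l ^ carry a d i j l) • b (i + j)

/-- A cyclic family whose members `b_0, …, b_{d-1}` form a basis. -/
structure IsCyclicBasis {A B : Type*} [CommRing A] [CommRing B] [Algebra A B] {n : ℕ} (x : Fin n → A)
    (u : A) (a : Fin n → ℕ) (d : ℕ) (b : ℕ → B) : Prop extends IsCyclicFamily x u a d b where
  linearIndependent : LinearIndependent A fun j : Fin d ↦ b j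
  top_le_span : ⊤ ≤ Submodule.span A (Set.range fun j : Fin d ↦ b j)

section

variable {A B : Type*} [CommRing A] [CommRing B] [Algebra A B] {n : ℕ} {x : Fin n → A}
  {u : A} {a : Fin n → ℕ} {d : ℕ} {b : ℕ → B}

lemma IsCyclicFamily.add_mul_period (hb : IsCyclicFamily x u a d b) (j k : ℕ) :
    b (j + d * k) = u ^ k • b j := by
  induction k with
  | zero => simp
  | succ k ih => rw [mul_add, mul_one, ← add_assoc, hb.add_period, ih, smul_smul, pow_succ']

lemma IsCyclicFamily.eq_smul_mod (hb : IsCyclicFamily x u a d b) (j : ℕ) :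
    b j = u ^ (j / d) • b (j % d) := by
  rw [← hb.add_mul_period, Nat.mod_add_div]

/-- The universal property of an algebra with a cyclic basis. -/
lemma IsCyclicBasis.exists_algHom (hb : IsCyclicBasis x u a d b) (hd : 0 < d) {C : Type*}
    [CommRing C] [Algebra A C] {c : ℕ → C} (hc : IsCyclicFamily x u a d c) :
    ∃ f : B →ₐ[A] C, ∀ j, f (b j) = c j := by
  let β : Module.Basis (Fin d) A B := .mk hb.linearIndependent hb.top_le_span
  let f : B →ₗ[A] C := β.constr A fun j : Fin d ↦ c j
  have hf (j : Fin d) : f (b j) = c j := by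
    have : β j = b j := Module.Basis.mk_apply _ _ j
    rw [← this, β.constr_basis]
  have hf' (j : ℕ) : f (b j) = c j := by
    rw [hb.eq_smul_mod, hc.eq_smul_mod, map_smul, hf ⟨j % d, Nat.mod_lt _ hd⟩]
  -- multiplicativity can be tested on the basis, where both multiplication tables agree
  have hmul : ((LinearMap.mul A C).compl₁₂ f f) = (LinearMap.mul A B).compr₂ f := by
    refine β.ext fun i ↦ β.ext fun j ↦ ?_
    simp only [LinearMap.compl₁₂_apply, LinearMap.mul_apply', LinearMap.compr₂_apply, β,
      Module.Basis.mk_apply, hf', hb.mul, hc.mul, map_smul]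
  refine ⟨AlgHom.ofLinearMap f ?_ fun v w ↦ ?_, hf'⟩
  · rw [← hb.zero, hf', hc.zero]
  · exact (congrArg (fun k ↦ k v w) hmul).symm

/-- The universal property of an algebra with a cyclic basis, for homomorphisms that are not linear over the
base. For a field as the target it describes the points of the spectrum by coordinates. -/
lemma IsCyclicBasis.exists_ringHom (hb : IsCyclicBasis x u a d b) (hd : 0 < d) {C : Type*}
    [CommRing C] (φ : A →+* C) {c : ℕ → C} (h0 : c 0 = 1) (hper : ∀ j, c (j + d) = φ u * c j)
    (hmul : ∀ i j, c i * c j = (∏ l, φ (x l) ^ carry a d i j l) * c (i + j)) :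
    ∃ f : B →+* C, (∀ r, f (algebraMap A B r) = φ r) ∧ ∀ j, f (b j) = c j := by
  let _ := φ.toAlgebra
  have hc : IsCyclicFamily x u a d c :=
    ⟨h0, fun j ↦ by rw [hper, Algebra.smul_def]; rfl, fun i j ↦ by
      rw [hmul, Algebra.smul_def, map_prod]
      simp only [map_pow]; rfl⟩
  obtain ⟨f, hf⟩ := hb.exists_algHom hd hc
  exact ⟨f, fun r ↦ f.commutes r, hf⟩

/-- Algebras with cyclic bases with the same parameters are isomorphic. -/
lemma IsCyclicBasis.exists_algEquiv (hb : IsCyclicBasis x u a d b) (hd : 0 < d) {C : Type*}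
    [CommRing C] [Algebra A C] {c : ℕ → C} (hc : IsCyclicBasis x u a d c) :
    ∃ f : B ≃ₐ[A] C, ∀ j, f (b j) = c j := by
  obtain ⟨f, hf⟩ := hb.exists_algHom hd hc.toIsCyclicFamily
  obtain ⟨g, hg⟩ := hc.exists_algHom hd hb.toIsCyclicFamily
  refine ⟨AlgEquiv.ofAlgHom f g ?_ ?_, hf⟩
  · apply AlgHom.toLinearMap_injective
    refine (Module.Basis.mk hc.linearIndependent hc.top_le_span).ext fun j ↦ ?_
    simp [hf, hg]
  · apply AlgHom.toLinearMap_injective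
    refine (Module.Basis.mk hb.linearIndependent hb.top_le_span).ext fun j ↦ ?_
    simp [hf, hg]

/-- Generators of the base and the basis elements generate the algebra. -/
lemma IsCyclicBasis.adjoin_eq_top (hb : IsCyclicBasis x u a d b) {R : Type*} [CommRing R] [Algebra R A]
    [Algebra R B] [IsScalarTower R A B] {κ : Type*} {α : κ → A}
    (hα : Algebra.adjoin R (Set.range α) = ⊤) :
    Algebra.adjoin R (Set.range (Sum.elim (fun i ↦ algebraMap A B (α i)) fun j : Fin d ↦ b j)) = ⊤ := by
  rw [Algebra.eq_top_iff]
  intro v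
  have hA (r : A) : algebraMap A B r ∈ Algebra.adjoin R
      (Set.range (Sum.elim (fun i ↦ algebraMap A B (α i)) fun j : Fin d ↦ b j)) := by
    have h1 : r ∈ Algebra.adjoin R (Set.range α) := hα ▸ Algebra.mem_top
    have h2 : IsScalarTower.toAlgHom R A B r ∈
        (Algebra.adjoin R (Set.range α)).map (IsScalarTower.toAlgHom R A B) := ⟨r, h1, rfl⟩
    rw [AlgHom.map_adjoin] at h2
    refine Algebra.adjoin_mono ?_ h2
    rintro _ ⟨_, ⟨i, rfl⟩, rfl⟩
    exact ⟨Sum.inl i, rfl⟩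
  have hv := hb.top_le_span (Submodule.mem_top (x := v))
  induction hv using Submodule.span_induction with
  | mem v hv =>
    obtain ⟨j, rfl⟩ := hv
    exact Algebra.subset_adjoin ⟨Sum.inr j, rfl⟩
  | zero => exact zero_mem _
  | add v w _ _ hv hw => exact add_mem hv hw
  | smul r v _ hv => rw [Algebra.smul_def]; exact mul_mem (hA r) hv

end

/-- Analytic `d`-th roots near a nonzero complex number. -/
lemma exists_analyticAt_root {d : ℕ} (hd : 0 < d) {u₀ : ℂ} (hu : u₀ ≠ 0) :
    ∃ w : ℂ → ℂ, AnalyticAt ℂ w u₀ ∧ ∀ᶠ z in 𝓝 u₀, w z ^ d = z ∧ w z ≠ 0 := by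
  obtain ⟨w₀, hw₀⟩ := IsAlgClosed.exists_pow_nat_eq u₀ hd
  have hd' : (d : ℂ) ≠ 0 := by exact_mod_cast hd.ne'
  refine ⟨fun z ↦ w₀ * Complex.exp (Complex.log (z / u₀) / d), ?_, ?_⟩
  · refine analyticAt_const.mul (AnalyticAt.cexp ?_)
    refine AnalyticAt.div_const ?_
    refine AnalyticAt.clog (analyticAt_id.div_const) ?_
    simp [hu]
  · filter_upwards [isOpen_ne.mem_nhds hu] with z hz
    have h1 : (w₀ * Complex.exp (Complex.log (z / u₀) / d)) ^ d = z := by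
      rw [mul_pow, hw₀, ← Complex.exp_nat_mul, mul_div_cancel₀ _ hd',
        Complex.exp_log (div_ne_zero hz hu), mul_div_cancel₀ _ hu]
    refine ⟨h1, fun h ↦ hz ?_⟩
    rw [← h1, h, zero_pow hd.ne']

set_option maxHeartbeats 400000 in
open MvPolynomial in
/-- Over étale coordinates `x_1, …, x_n`, the cyclic cover with equation `y^d = u x^a`, with a unit
`u`, is locally analytically isomorphic to the model cover with equation `y^d = x^a`: the coordinate
`y` has to be divided by an analytic `d`-th root of `u`. -/
lemma exists_locallyAnalyticallyIso_model {n d : ℕ} (hd : 0 < d) {a : Fin n → ℕ} {A B B' : Type} [CommRing A]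
    [Algebra ℂ A]
    [Algebra (MvPolynomial (Fin n) ℂ) A] [IsScalarTower ℂ (MvPolynomial (Fin n) ℂ) A]
    [Algebra.Etale (MvPolynomial (Fin n) ℂ) A] [CommRing B] [Algebra ℂ B] [Algebra A B]
    [IsScalarTower ℂ A B] [CommRing B'] [Algebra ℂ B'] [Algebra (MvPolynomial (Fin n) ℂ) B']
    [IsScalarTower ℂ (MvPolynomial (Fin n) ℂ) B'] {u : A} (hu : IsUnit u) {b : ℕ → B}
    (hb : IsCyclicBasis (fun i ↦ algebraMap (MvPolynomial (Fin n) ℂ) A (X i)) u a d b)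
    {b' : ℕ → B'} (hb' : IsCyclicBasis (fun i ↦ (X i : MvPolynomial (Fin n) ℂ)) 1 a d b')
    (p : CPoint (specC B)) :
    ∃ t : CPoint (specC B'), (∀ i, t.evalSpec (algebraMap (MvPolynomial (Fin n) ℂ) B' (X i)) =
      p.evalSpec (algebraMap A B (algebraMap (MvPolynomial (Fin n) ℂ) A (X i)))) ∧
      LocallyAnalyticallyIso p t := by
  classical
  let pr : CPoint (specC B) → CPoint (specC A) := CPoint.map (specCMap (IsScalarTower.toAlgHom ℂ A B))
  have hpr (q : CPoint (specC B)) (f : A) : (pr q).evalSpec f = q.evalSpec (algebraMap A B f) :=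
    CPoint.evalSpec_map _ _ _
  have cpr : Continuous pr := CPoint.continuous_map _
  let x : Fin n → A := fun i ↦ algebraMap (MvPolynomial (Fin n) ℂ) A (X i)
  obtain ⟨κ, _, α, G, hα, hG, hG₁, hG₂⟩ := exists_analytic_section (n := n) (pr p)
  change AnalyticAt ℂ G ((pr p).coords x) at hG
  change ∀ᶠ q in 𝓝 (pr p), G (q.coords x) = q.coords α at hG₁
  change ∀ᶠ ξ in 𝓝 ((pr p).coords x), ∃ q : CPoint (specC A), q.coords x = ξ ∧ q.coords α = G ξ at hG₂
  have hGp := hG₁.self_of_nhds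
  obtain ⟨F, hF⟩ := exists_evalSpec_eq_eval hα u
  choose ξ hξ using fun i ↦ exists_evalSpec_eq_eval hα (x i)
  have hu0 (q : CPoint (specC A)) : q.evalSpec u ≠ 0 := (hu.map q.evalSpec).ne_zero
  obtain ⟨w, hw, hw'⟩ := exists_analyticAt_root hd (hu0 (pr p))
  obtain ⟨hwp, hwp0⟩ := hw'.self_of_nhds
  -- the points of the model with given coordinates
  have hmodel (v : Fin n → ℂ) (c : ℕ → ℂ) (h0 : c 0 = 1) (hper : ∀ j, c (j + d) = c j)
      (hmul : ∀ i j, c i * c j = (∏ l, v l ^ carry a d i j l) * c (i + j)) :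
      ∃ q' : CPoint (specC B'), (∀ i, q'.evalSpec (algebraMap (MvPolynomial (Fin n) ℂ) B' (X i)) = v i) ∧
        ∀ j, q'.evalSpec (b' j) = c j := by
    obtain ⟨f, hf, hf'⟩ := hb'.exists_ringHom hd (eval v) (c := c) h0 (by simpa using hper)
      (by simpa using hmul)
    let q' : CPoint (specC B') := CPoint.ofAlgHom ⟨f, fun z ↦ by
      change f (algebraMap ℂ B' z) = z
      rw [IsScalarTower.algebraMap_apply ℂ (MvPolynomial (Fin n) ℂ) B' z, hf,
        MvPolynomial.algebraMap_eq, eval_C]⟩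
    have hq (g : B') : q'.evalSpec g = f g := CPoint.evalSpec_ofAlgHom _ g
    exact ⟨q', fun i ↦ by rw [hq, hf, eval_X], fun j ↦ by rw [hq, hf']⟩
  -- the points of the cover over a given point of `Spec A`
  have hcover (q₀ : CPoint (specC A)) (c : ℕ → ℂ) (h0 : c 0 = 1)
      (hper : ∀ j, c (j + d) = q₀.evalSpec u * c j)
      (hmul : ∀ i j, c i * c j = (∏ l, q₀.evalSpec (x l) ^ carry a d i j l) * c (i + j)) :
      ∃ q : CPoint (specC B), pr q = q₀ ∧ ∀ j, q.evalSpec (b j) = c j := by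
    obtain ⟨f, hf, hf'⟩ := hb.exists_ringHom hd q₀.evalSpec h0 hper hmul
    let q : CPoint (specC B) := CPoint.ofAlgHom ⟨f, fun z ↦ by
      change f (algebraMap ℂ B z) = z
      rw [IsScalarTower.algebraMap_apply ℂ A B z, hf, CPoint.evalSpec_algebraMap]⟩
    have hq (g : B) : q.evalSpec g = f g := CPoint.evalSpec_ofAlgHom _ g
    refine ⟨q, CPoint.evalSpec_injective ?_, fun j ↦ by rw [hq, hf']⟩
    ext g
    rw [hpr, hq, hf]
  have hb0 (q : CPoint (specC B)) : q.evalSpec (b 0) = 1 := by rw [hb.zero, map_one]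
  have hbper (q : CPoint (specC B)) (j) : q.evalSpec (b (j + d)) =
      (pr q).evalSpec u * q.evalSpec (b j) := by
    rw [hb.add_period, Algebra.smul_def, map_mul, hpr]
  have hbmul (q : CPoint (specC B)) (i j) : q.evalSpec (b i) * q.evalSpec (b j) =
      (∏ l, (pr q).evalSpec (x l) ^ carry a d i j l) * q.evalSpec (b (i + j)) := by
    rw [← map_mul, hb.mul, Algebra.smul_def, map_mul, ← hpr, map_prod]
    simp only [map_pow]; rfl
  have hb0' (q : CPoint (specC B')) : q.evalSpec (b' 0) = 1 := by rw [hb'.zero, map_one]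
  have hbper' (q : CPoint (specC B')) (j) : q.evalSpec (b' (j + d)) = q.evalSpec (b' j) := by
    rw [hb'.add_period, one_smul]
  have hbmul' (q : CPoint (specC B')) (i j) : q.evalSpec (b' i) * q.evalSpec (b' j) =
      (∏ l, q.evalSpec (algebraMap (MvPolynomial (Fin n) ℂ) B' (X l : MvPolynomial (Fin n) ℂ)) ^ carry a d i j l) *
        q.evalSpec (b' (i + j)) := by
    rw [← map_mul, hb'.mul, Algebra.smul_def, map_mul, map_prod, map_prod]
    simp only [map_pow]
  -- from the cover to the model
  have hdown (q : CPoint (specC B)) (W : ℂ) (hW : W ^ d = (pr q).evalSpec u) :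
      ∃ q' : CPoint (specC B'), (∀ i, q'.evalSpec (algebraMap (MvPolynomial (Fin n) ℂ) B' (X i)) = (pr q).evalSpec (x i)) ∧
        ∀ j, q'.evalSpec (b' j) = q.evalSpec (b j) / W ^ j := by
    have hW0 : W ≠ 0 := fun h ↦ hu0 (pr q) (by rw [← hW, h, zero_pow hd.ne'])
    refine hmodel _ _ (by rw [hb0, pow_zero, div_one]) (fun j ↦ ?_) (fun i j ↦ ?_)
    · rw [hbper, pow_add, hW]
      have := hu0 (pr q)
      field_simp
    · rw [div_mul_div_comm, hbmul, pow_add, mul_div_assoc]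
  -- from the model to the cover
  have hup (q₀ : CPoint (specC A)) (q' : CPoint (specC B'))
      (hq : ∀ i, q'.evalSpec (algebraMap (MvPolynomial (Fin n) ℂ) B' (X i)) = q₀.evalSpec (x i)) (W : ℂ)
      (hW : W ^ d = q₀.evalSpec u) :
      ∃ q : CPoint (specC B), pr q = q₀ ∧ ∀ j, q.evalSpec (b j) = q'.evalSpec (b' j) * W ^ j := by
    refine hcover _ _ (by rw [hb0', pow_zero, mul_one]) (fun j ↦ ?_) (fun i j ↦ ?_)
    · rw [hbper', pow_add, hW]; ring
    · rw [mul_mul_mul_comm, hbmul', pow_add]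
      simp only [hq]
      ring
  obtain ⟨t, ht, ht'⟩ := hdown p _ hwp
  refine ⟨t, fun i ↦ (ht i).trans (hpr _ _), ?_⟩
  let β : κ ⊕ Fin d → B := Sum.elim (fun i ↦ algebraMap A B (α i)) fun j : Fin d ↦ b j
  let γ : Fin n ⊕ Fin d → B' := Sum.elim (fun i ↦ algebraMap (MvPolynomial (Fin n) ℂ) B' (X i))
    fun j : Fin d ↦ b' j
  have hβ : Algebra.adjoin ℂ (Set.range β) = ⊤ := hb.adjoin_eq_top hα
  have hγ : Algebra.adjoin ℂ (Set.range γ) = ⊤ :=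
    hb'.adjoin_eq_top (α := fun i ↦ (X i : MvPolynomial (Fin n) ℂ)) MvPolynomial.adjoin_range_X
  have hβl (q : CPoint (specC B)) : (fun k ↦ q.coords β (Sum.inl k)) = (pr q).coords α :=
    funext fun k ↦ (hpr _ _).symm
  have hxt : (fun i ↦ t.coords γ (Sum.inl i)) = (pr p).coords x := funext ht
  -- the map to the model takes `x_i` as polynomials in the generators of `A` and divides `b_j` by `w(u)^j`;
  -- its inverse recovers the generators of `A` from the `x_i` and multiplies `b_j` by `w(u)^j`
  refine LocallyAnalyticallyIso.of_coords hβ hγ p t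
    (fun v ↦ Sum.elim (fun i ↦ eval (fun k ↦ v (Sum.inl k)) (ξ i))
      fun j : Fin d ↦ v (Sum.inr j) / w (eval (fun k ↦ v (Sum.inl k)) F) ^ (j : ℕ))
    (fun v ↦ Sum.elim (G fun i ↦ v (Sum.inl i))
      fun j : Fin d ↦ v (Sum.inr j) * w (eval (G fun i ↦ v (Sum.inl i)) F) ^ (j : ℕ)) ?_ ?_ ?_ ?_ ?_
  · have hl : AnalyticAt ℂ (fun (v : κ ⊕ Fin d → ℂ) k ↦ v (Sum.inl k)) (p.coords β) :=
      AnalyticAt.pi fun k ↦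
        (ContinuousLinearMap.proj (R := ℂ) (φ := fun _ : κ ⊕ Fin d ↦ ℂ) (Sum.inl k)).analyticAt _
    have hpoly (f : MvPolynomial κ ℂ) : AnalyticAt ℂ
        (fun v : κ ⊕ Fin d → ℂ ↦ eval (fun k ↦ v (Sum.inl k)) f) (p.coords β) :=
      AnalyticAt.fun_comp (g := fun v ↦ eval v f) (analyticAt_mvPolynomial_eval _ _) hl
    refine AnalyticAt.pi fun i ↦ ?_
    rcases i with i | j
    · exact hpoly _
    · refine AnalyticAt.fun_div
        ((ContinuousLinearMap.proj (R := ℂ) (φ := fun _ : κ ⊕ Fin d ↦ ℂ) (Sum.inr j)).analyticAt _)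
        (AnalyticAt.fun_pow (AnalyticAt.fun_comp (g := w) ?_ (hpoly F)) _) (pow_ne_zero _ ?_)
      · rwa [hβl, ← hF]
      · rwa [hβl, ← hF]
  · have hl : AnalyticAt ℂ (fun (v : Fin n ⊕ Fin d → ℂ) ↦ G fun i ↦ v (Sum.inl i)) (t.coords γ) := by
      refine AnalyticAt.fun_comp (g := G) ?_ (AnalyticAt.pi fun k ↦
        (ContinuousLinearMap.proj (R := ℂ) (φ := fun _ : Fin n ⊕ Fin d ↦ ℂ) (Sum.inl k)).analyticAt _)
      rwa [hxt]
    refine AnalyticAt.pi fun i ↦ ?_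
    rcases i with i | j
    · exact ((ContinuousLinearMap.proj (R := ℂ) (φ := fun _ : κ ↦ ℂ) i).analyticAt _).fun_comp hl
    · refine AnalyticAt.fun_mul
        ((ContinuousLinearMap.proj (R := ℂ) (φ := fun _ : Fin n ⊕ Fin d ↦ ℂ) (Sum.inr j)).analyticAt _)
        (AnalyticAt.fun_pow (AnalyticAt.fun_comp (g := w) ?_
          (AnalyticAt.fun_comp (g := fun v ↦ eval v F) (analyticAt_mvPolynomial_eval _ _) hl)) _)
      rwa [hxt, hGp, ← hF]
  · ext i
    rcases i with i | j
    · simp only [Sum.elim_inl, hβl, ← hξ]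
      exact (ht i).symm
    · simp only [Sum.elim_inr, hβl, ← hF]
      exact (ht' j).symm
  · have h1 : ∀ᶠ q in 𝓝 p, w ((pr q).evalSpec u) ^ d = (pr q).evalSpec u ∧ w ((pr q).evalSpec u) ≠ 0 :=
      ((CPoint.continuous_evalSpec u).comp cpr).continuousAt.eventually hw'
    filter_upwards [h1, cpr.continuousAt.eventually hG₁] with q hq hGq
    obtain ⟨q', h2, h3⟩ := hdown q _ hq.1
    have hx' : (fun i ↦ q'.coords γ (Sum.inl i)) = (pr q).coords x := funext h2
    refine ⟨q', ?_, ?_⟩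
    · ext i
      rcases i with i | j
      · simp only [Sum.elim_inl, hβl, ← hξ]
        exact h2 i
      · simp only [Sum.elim_inr, hβl, ← hF]
        exact h3 j
    · ext i
      rcases i with i | j
      · simp only [Sum.elim_inl, hx', hGq]
        exact hpr _ _
      · simp only [Sum.elim_inr, hx', hGq, ← hF]
        change q'.evalSpec (b' j) * _ = q.evalSpec (b j)
        rw [h3, div_mul_cancel₀ _ (pow_ne_zero _ hq.2)]
  · have hc : ContinuousAt (fun q' : CPoint (specC B') ↦ fun i ↦ q'.coords γ (Sum.inl i)) t :=
      (continuous_pi fun i ↦ CPoint.continuous_evalSpec _).continuousAt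
    have hcG : ContinuousAt (fun q' : CPoint (specC B') ↦
        eval (G fun i ↦ q'.coords γ (Sum.inl i)) F) t := by
      refine ContinuousAt.comp (g := fun v ↦ eval v F)
        (MvPolynomial.continuous_eval F).continuousAt (ContinuousAt.comp (g := G) ?_ hc)
      rw [hxt]
      exact hG.continuousAt
    have h1 := hcG.eventually (p := fun z ↦ w z ^ d = z ∧ w z ≠ 0) (by beta_reduce; rwa [hxt, hGp, ← hF])
    have h2 := hc.eventually (p := fun ξ ↦ ∃ q : CPoint (specC A), q.coords x = ξ ∧ q.coords α = G ξ)
      (by beta_reduce; rwa [hxt])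
    filter_upwards [h1, h2] with q' hq hq'
    obtain ⟨q₀, h3, h4⟩ := hq'
    rw [← h4, ← hF] at hq
    obtain ⟨q, hqq, h5⟩ := hup q₀ q' (fun i ↦ (congrFun h3 i).symm) _ hq.1
    refine ⟨q, ?_, ?_⟩
    · ext i
      rcases i with i | j
      · simp only [Sum.elim_inl, ← h4, ← hqq]
        exact (hpr _ _).symm
      · simp only [Sum.elim_inr, ← h4, ← hF]
        exact h5 j
    · ext i
      rcases i with i | j
      · simp only [Sum.elim_inl, hβl, ← hξ, hqq]
        exact congrFun h3 i
      · simp only [Sum.elim_inr, hβl, ← hF, hqq]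
        change q.evalSpec (b j) / _ = q'.evalSpec (b' j)
        rw [h5, mul_div_cancel_right₀ _ (pow_ne_zero _ hq.2)]

/-! ### Extraction of roots of the coordinates -/

/-- The polynomial ring `ℂ[t_1, …, t_n]`, considered as an extension of `ℂ[x_1, …, x_n]`. It is a
copy of the type of polynomials since its algebra structure, with `x_i = t_i^d`, is not the
standard one. -/
def RootExtension (n : ℕ) : Type := MvPolynomial (Fin n) ℂ

instance (n : ℕ) : CommRing (RootExtension n) := inferInstanceAs (CommRing (MvPolynomial (Fin n) ℂ))

open MvPolynomial in
/-- The extension of `ℂ[x_1, …, x_n]` by the `d`-th roots `t_i` of the variables: it is integrally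
closed, and it is the direct sum of the `t_1^{r_1} ⋯ t_n^{r_n} ℂ[x_1, …, x_n]` with `r_i < d`, so that
there is a coordinate functional for each of these monomials. -/
lemma exists_root_extension (n : ℕ) {d : ℕ} (hd : 0 < d) :
    ∃ (Q : Type) (_ : CommRing Q) (_ : Algebra (MvPolynomial (Fin n) ℂ) Q) (t : Fin n → Q),
      IsDomain Q ∧ IsIntegrallyClosed Q ∧
      Function.Injective (algebraMap (MvPolynomial (Fin n) ℂ) Q) ∧
      (∀ i, t i ^ d = algebraMap (MvPolynomial (Fin n) ℂ) Q (X i)) ∧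
      ∀ r : Fin n → ℕ, (∀ i, r i < d) →
        ∃ l : Q →ₗ[MvPolynomial (Fin n) ℂ] MvPolynomial (Fin n) ℂ, l (∏ i, t i ^ r i) = 1 := by
  classical
  let _ : Algebra (MvPolynomial (Fin n) ℂ) (RootExtension n) :=
    (expand d : MvPolynomial (Fin n) ℂ →ₐ[ℂ] MvPolynomial (Fin n) ℂ).toRingHom.toAlgebra
  refine ⟨RootExtension n, inferInstance, inferInstance,
    (X : Fin n → MvPolynomial (Fin n) ℂ), inferInstanceAs (IsDomain (MvPolynomial (Fin n) ℂ)),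
    inferInstanceAs (IsIntegrallyClosed (MvPolynomial (Fin n) ℂ)), ?_, ?_, fun r hr ↦ ?_⟩
  · intro f g h
    exact MvPolynomial.expand_injective hd h
  · intro i
    exact (expand_X d i).symm
  · -- the functional keeps the monomials whose exponents are congruent to `r` modulo `d`
    let c (m : Fin n →₀ ℕ) : MvPolynomial (Fin n) ℂ :=
      if ∀ i, m i % d = r i then monomial (m.mapRange (· / d) (Nat.zero_div _)) 1 else 0
    let l : MvPolynomial (Fin n) ℂ →ₗ[ℂ] MvPolynomial (Fin n) ℂ := (basisMonomials (Fin n) ℂ).constr ℂ c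
    have hl (m : Fin n →₀ ℕ) : l (monomial m 1) = c m := by
      have : basisMonomials (Fin n) ℂ m = monomial m 1 := by simp
      rw [← this, Module.Basis.constr_basis]
    have hmul (f g : MvPolynomial (Fin n) ℂ) : l (expand d f * g) = f * l g := by
      have : (LinearMap.mul ℂ (MvPolynomial (Fin n) ℂ)).compr₂ l ∘ₗ (expand d).toLinearMap =
          (LinearMap.mul ℂ (MvPolynomial (Fin n) ℂ)).compl₂ l := by
        refine (basisMonomials (Fin n) ℂ).ext fun k ↦ (basisMonomials (Fin n) ℂ).ext fun m ↦ ?_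
        simp only [coe_basisMonomials, LinearMap.comp_apply, LinearMap.compr₂_apply,
          LinearMap.mul_apply', LinearMap.compl₂_apply, AlgHom.toLinearMap_apply, expand_monomial,
          hl, monomial_mul, one_mul]
        simp only [c, Finsupp.add_apply, Finsupp.smul_apply, smul_eq_mul, Nat.mul_add_mod]
        split_ifs with h
        · rw [monomial_mul, one_mul]
          congr 1
          congr 1
          ext i
          simp [Nat.mul_add_div hd]
        · simp
      exact congrArg (fun k ↦ k f g) this
    refine ⟨{ toFun := l, map_add' := l.map_add, map_smul' := hmul }, ?_⟩
    change l (∏ i, (X i : MvPolynomial (Fin n) ℂ) ^ r i) = 1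
    have h1 : (∏ i, (X i : MvPolynomial (Fin n) ℂ) ^ r i) = monomial (Finsupp.equivFunOnFinite.symm r) 1 := by
      rw [monomial_eq]
      simp [Finsupp.prod_fintype]
    rw [h1, hl]
    simp only [c]
    rw [if_pos fun i ↦ by simp [Nat.mod_eq_of_lt (hr i)]]
    have : (Finsupp.mapRange (· / d) (Nat.zero_div _) (Finsupp.equivFunOnFinite.symm r) : Fin n →₀ ℕ) = 0 := by
      ext i
      simp [Nat.div_eq_of_lt (hr i)]
    rw [this]
    rfl

open MvPolynomial in
/-- The fraction field of an étale domain over `ℂ[x_1, …, x_n]` is finite over `ℂ(x_1, …, x_n)`. Hence every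
nonzero element divides a nonzero polynomial. -/
lemma exists_ne_zero_dvd_of_etale {n : ℕ} {A : Type} [CommRing A] [IsDomain A]
    [Algebra (MvPolynomial (Fin n) ℂ) A] [Algebra.Etale (MvPolynomial (Fin n) ℂ) A] {c : A}
    (hc : c ≠ 0) : ∃ q : MvPolynomial (Fin n) ℂ, q ≠ 0 ∧ c ∣ algebraMap (MvPolynomial (Fin n) ℂ) A q := by
  let P := MvPolynomial (Fin n) ℂ
  let K := FractionRing A
  have hinj : Function.Injective (algebraMap P A) := FaithfulSMul.algebraMap_injective P A
  have : FaithfulSMul P K := (faithfulSMul_iff_algebraMap_injective P K).2 (by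
    rw [IsScalarTower.algebraMap_eq P A K]
    exact (IsFractionRing.injective A K).comp hinj)
  let _ : Algebra (FractionRing P) K := FractionRing.liftAlgebra P K
  have : IsScalarTower P (FractionRing P) K := inferInstance
  have : Algebra.FormallyUnramified A K := Algebra.FormallyUnramified.of_isLocalization (nonZeroDivisors A)
  have : Algebra.FormallyUnramified P K := Algebra.FormallyUnramified.comp P A K
  have : Algebra.FormallyUnramified (FractionRing P) K :=
    Algebra.FormallyUnramified.of_restrictScalars P (FractionRing P) K
  have : Algebra.EssFiniteType A K := .of_isLocalization _ (nonZeroDivisors A)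
  have : Algebra.EssFiniteType P K := .comp P A K
  have : Algebra.EssFiniteType (FractionRing P) K := .of_comp P (FractionRing P) K
  have := Algebra.FormallyUnramified.finite_of_free (FractionRing P) K
  have h1 : IsAlgebraic P (algebraMap A K c) :=
    (IsFractionRing.isAlgebraic_iff P (FractionRing P) K).2 (Algebra.IsAlgebraic.isAlgebraic _)
  have h2 : IsAlgebraic P c := (isAlgebraic_algebraMap_iff (IsFractionRing.injective A K)).1 h1
  exact h2.exists_nonzero_dvd (mem_nonZeroDivisors_of_ne_zero hc)

open TensorProduct in
/-- The base change of a functional that takes the value `1` at `m`. -/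
lemma exists_linearMap_tmul_eq {R M : Type*} (N : Type*) [CommRing R] [AddCommGroup M] [Module R M]
    [AddCommGroup N] [Module R N] {l : M →ₗ[R] R} {m : M} (h : l m = 1) :
    ∃ l' : N ⊗[R] M →ₗ[R] N, ∀ c, l' (c ⊗ₜ m) = c :=
  ⟨(TensorProduct.rid R N).toLinearMap ∘ₗ l.lTensor N, fun c ↦ by simp [h]⟩

open MvPolynomial TensorProduct in
/-- Let `A` be étale over `ℂ[x_1, …, x_n]`. An element `g` of the fraction field of `A` lies in `A`
if `g^d x^r` is integral over `A`, where all the exponents satisfy `r_i < d`. Indeed, let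
`t_i^d = x_i`. Then `g t^r` is integral over `A`, and by étale base change the ring
`A ⊗ ℂ[t_1, …, t_n]` is integrally closed. Hence `g` is the coefficient at `t^r` of an element of
this ring. -/
lemma mem_range_of_isIntegral_pow_mul {n d : ℕ} (hd : 0 < d) {A K : Type} [CommRing A] [IsDomain A]
    [Algebra (MvPolynomial (Fin n) ℂ) A] [Algebra.Etale (MvPolynomial (Fin n) ℂ) A] [Field K]
    [Algebra A K] [IsFractionRing A K] (r : Fin n → ℕ) (hr : ∀ i, r i < d) (g : K)
    (hg : IsIntegral A (g ^ d * algebraMap A K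
      (∏ i, algebraMap (MvPolynomial (Fin n) ℂ) A (X i) ^ r i))) :
    g ∈ Set.range (algebraMap A K) := by
  obtain ⟨Q, _, _, t, _, _, hPQ, ht, hl⟩ := exists_root_extension n hd
  obtain ⟨l, hl⟩ := hl r hr
  let P := MvPolynomial (Fin n) ℂ
  let L := FractionRing Q
  have hinj : Function.Injective (algebraMap P A) := FaithfulSMul.algebraMap_injective P A
  let M : Submonoid A := Algebra.algebraMapSubmonoid A (nonZeroDivisors P)
  have hM : M ≤ nonZeroDivisors A := by
    rintro _ ⟨q, hq, rfl⟩
    exact mem_nonZeroDivisors_of_ne_zero ((map_ne_zero_iff _ hinj).2 (nonZeroDivisors.ne_zero hq))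
  -- the fraction field is obtained by inverting the nonzero elements of `ℂ[x_1, …, x_n]`
  have hloc (z : K) : ∃ (c : A) (q : P), q ≠ 0 ∧ z * algebraMap A K (algebraMap P A q) = algebraMap A K c := by
    obtain ⟨c, s, hs, rfl⟩ := IsFractionRing.div_surjective (A := A) z
    obtain ⟨q, hq, e, he⟩ := exists_ne_zero_dvd_of_etale (n := n) (nonZeroDivisors.ne_zero hs)
    refine ⟨c * e, q, hq, ?_⟩
    have : algebraMap A K s ≠ 0 := by
      simpa using nonZeroDivisors.ne_zero hs
    rw [he, map_mul, map_mul]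
    field_simp
  have : IsLocalization M K := by
    refine ⟨?_, ?_, ?_⟩
    · intro y
      have := hM y.2
      simpa using nonZeroDivisors.ne_zero this
    · intro z
      obtain ⟨c, q, hq, h⟩ := hloc z
      exact ⟨⟨c, ⟨_, q, mem_nonZeroDivisors_of_ne_zero hq, rfl⟩⟩, h⟩
    · intro x y h
      exact ⟨1, by simpa using h⟩
  have hunit (y : M) : IsUnit (algebraMap A (A ⊗[P] L) y) := by
    obtain ⟨_, q, hq, rfl⟩ := y
    have h1 : algebraMap P L q ≠ 0 := by
      rw [IsScalarTower.algebraMap_apply P Q L]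
      simpa [map_eq_zero_iff (algebraMap P Q) hPQ] using nonZeroDivisors.ne_zero hq
    have h2 : algebraMap A (A ⊗[P] L) (algebraMap P A q) =
        Algebra.TensorProduct.includeRight (algebraMap P L q) := by
      rw [← IsScalarTower.algebraMap_apply P A, AlgHom.commutes]
    rw [h2]
    exact h1.isUnit.map _
  let Θ : K →ₐ[A] A ⊗[P] L := IsLocalization.liftAlgHom (M := M) (f := Algebra.ofId A _) hunit
  -- `G = g t^r`
  let G : A ⊗[P] L := Θ g * Algebra.TensorProduct.includeRight (algebraMap Q L (∏ i, t i ^ r i))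
  have hG : IsIntegral A G := by
    refine IsIntegral.of_pow hd ?_
    have : G ^ d = Θ (g ^ d * algebraMap A K (∏ i, algebraMap P A (X i) ^ r i)) := by
      have h1 : (∏ i, algebraMap P A (X i) ^ r i) = algebraMap P A (∏ i, X i ^ r i) := by
        simp only [map_prod, map_pow]
      have h2 : (∏ i, t i ^ r i) ^ d = algebraMap P Q (∏ i, X i ^ r i) := by
        simp only [map_prod, map_pow, ← Finset.prod_pow]
        exact Finset.prod_congr rfl fun i _ ↦ by rw [← pow_mul, mul_comm, pow_mul, ht]
      simp only [G]
      rw [mul_pow, ← map_pow, ← map_pow, ← map_pow, map_mul, h1, h2, Θ.commutes,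
        ← IsScalarTower.algebraMap_apply P Q L, AlgHom.commutes, ← IsScalarTower.algebraMap_apply P A]
    rw [this]
    exact hg.map Θ
  obtain ⟨w, hw⟩ := (TensorProduct.toIntegralClosure_bijective_of_smooth (R := P) (S := A)
    (B := L)).2 ⟨G, hG⟩
  have hw : (Algebra.TensorProduct.map (AlgHom.id A A) (integralClosure P L).val) w = G :=
    congrArg Subtype.val hw
  -- the integral closure of `ℂ[x]` in the field `L` is contained in `Q`
  obtain ⟨j, hj⟩ : ∃ j : integralClosure P L →ₗ[P] Q, ∀ z, algebraMap Q L (j z) = z := by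
    have h1 (z : integralClosure P L) : ∃ v : Q, algebraMap Q L v = z :=
      IsIntegrallyClosed.isIntegral_iff.1 ((show IsIntegral P (z : L) from z.2).tower_top (A := Q))
    choose j hj using h1
    have h2 := IsFractionRing.injective Q L
    refine ⟨{ toFun := j, map_add' := fun z w ↦ h2 ?_, map_smul' := fun q z ↦ h2 ?_ }, hj⟩
    · rw [map_add, hj, hj, hj]; rfl
    · change algebraMap Q L (j (q • z)) = algebraMap Q L (q • j z)
      rw [Algebra.smul_def q (j z), map_mul, hj, hj, ← IsScalarTower.algebraMap_apply P Q L]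
      exact Algebra.smul_def q (z : L)
  -- the element of `A ⊗ ℂ[t]` that represents `g t^r`; after clearing the denominator `q` of `g = c / q`
  -- it is the pure tensor `c ⊗ t^r`, from which the functional recovers `c`
  let w' : A ⊗[P] Q := j.lTensor A w
  obtain ⟨c, q, hq, hc⟩ := hloc g
  have key : algebraMap P A q • w' = c ⊗ₜ (∏ i, t i ^ r i) := by
    have hi : Function.Injective ((IsScalarTower.toAlgHom P Q L).toLinearMap.lTensor A) :=
      Module.Flat.lTensor_preserves_injective_linearMap _ (IsFractionRing.injective Q L)
    have h1 : (IsScalarTower.toAlgHom P Q L).toLinearMap.lTensor A w' = G := by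
      rw [← hw, ← LinearMap.comp_apply, ← LinearMap.lTensor_comp]
      have : (IsScalarTower.toAlgHom P Q L).toLinearMap ∘ₗ j = (integralClosure P L).val.toLinearMap :=
        LinearMap.ext hj
      rw [this]
      rfl
    apply hi
    rw [algebraMap_smul, map_smul, h1, ← algebraMap_smul A q G, Algebra.smul_def (algebraMap P A q) G,
      LinearMap.lTensor_tmul, ← Θ.commutes]
    simp only [G]
    rw [← mul_assoc, ← map_mul, mul_comm _ g, hc, Θ.commutes, ← Algebra.smul_def,
      Algebra.TensorProduct.includeRight_apply, TensorProduct.smul_tmul', smul_eq_mul, mul_one]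
    rfl
  obtain ⟨l', hl'⟩ := exists_linearMap_tmul_eq A hl
  have h1 := congrArg l' key
  rw [algebraMap_smul, map_smul, hl'] at h1
  refine ⟨l' w', ?_⟩
  have h3 : algebraMap A K (algebraMap P A q) ≠ 0 := by
    simpa [map_eq_zero_iff _ hinj] using hq
  apply mul_right_cancel₀ h3
  rw [hc, ← h1, Algebra.smul_def, map_mul, mul_comm]

/-! ### The integral closure in a cyclic extension -/

/-- The powers of a root `y` of `y^d = s` that form a basis are a cyclic basis, with respect to the
empty family of coordinates. -/
lemma isCyclicBasis_pow {K F : Type*} [CommRing K] [CommRing F] [Algebra K F] {d : ℕ} {s : K} {y : F}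
    (hy : y ^ d = algebraMap K F s) (hli : LinearIndependent K fun j : Fin d ↦ y ^ (j : ℕ))
    (hsp : ⊤ ≤ Submodule.span K (Set.range fun j : Fin d ↦ y ^ (j : ℕ))) :
    IsCyclicBasis (Fin.elim0 : Fin 0 → K) s Fin.elim0 d (fun j ↦ y ^ j) where
  zero := pow_zero y
  add_period j := by rw [pow_add, hy, Algebra.smul_def, mul_comm]
  mul i j := by simp [pow_add]
  linearIndependent := hli
  top_le_span := hsp

/-- Orthogonality of the characters of the group of `d`-th roots of unity. -/
lemma sum_pow_mul_inv_pow {K : Type*} [Field K] {d : ℕ} {ζ : K} (hζ : IsPrimitiveRoot ζ d) (i j : Fin d) :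
    ∑ k ∈ Finset.range d, (ζ ^ k) ^ (i : ℕ) * ((ζ ^ k) ^ (j : ℕ))⁻¹ = if i = j then (d : K) else 0 := by
  have h0 : ζ ≠ 0 := hζ.ne_zero (by have := i.2; omega)
  have h1 (k : ℕ) : (ζ ^ k) ^ (i : ℕ) * ((ζ ^ k) ^ (j : ℕ))⁻¹ = (ζ ^ (i : ℕ) * (ζ ^ (j : ℕ))⁻¹) ^ k := by
    rw [mul_pow, inv_pow, ← pow_mul, ← pow_mul, ← pow_mul, ← pow_mul, mul_comm k, mul_comm k]
  simp only [h1]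
  split_ifs with h
  · subst h
    rw [mul_inv_cancel₀ (pow_ne_zero _ h0)]
    simp
  · have h2 : ζ ^ (i : ℕ) * (ζ ^ (j : ℕ))⁻¹ - 1 ≠ 0 := by
      intro h3
      rw [sub_eq_zero, mul_inv_eq_one₀ (pow_ne_zero _ h0)] at h3
      exact h (Fin.ext (hζ.pow_inj i.2 j.2 h3))
    apply mul_right_cancel₀ h2
    rw [geom_sum_mul, zero_mul, mul_pow, inv_pow, ← pow_mul, ← pow_mul, mul_comm _ d, mul_comm _ d,
      pow_mul, pow_mul, hζ.pow_eq_one]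
    simp

/-- If `f = ∑ f_j y^j` is integral over `A`, then so is every `f_j y^j`: it is an average of conjugates
of `f` under the group of `d`-th roots of unity. -/
lemma isIntegral_smul_pow {A K F : Type*} [CommRing A] [Field K] [Algebra A K] [CommRing F] [Algebra A F]
    [Algebra K F] [IsScalarTower A K F] {d : ℕ} {s : K} {y : F} {ζ : A}
    (hζ : IsPrimitiveRoot (algebraMap A K ζ) d) (hdA : IsUnit (d : A)) (hdK : (d : K) ≠ 0)
    (hy : y ^ d = algebraMap K F s) (hli : LinearIndependent K fun j : Fin d ↦ y ^ (j : ℕ))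
    (hsp : ⊤ ≤ Submodule.span K (Set.range fun j : Fin d ↦ y ^ (j : ℕ))) (f : Fin d → K)
    (hf : IsIntegral A (∑ j : Fin d, f j • y ^ (j : ℕ))) (j : Fin d) :
    IsIntegral A (f j • y ^ (j : ℕ)) := by
  have hb := isCyclicBasis_pow hy hli hsp
  have hd : 0 < d := by have := j.2; omega
  set ζ' := algebraMap A K ζ with hζ'
  have h0 : ζ' ≠ 0 := hζ.ne_zero hd.ne'
  -- the automorphism `y ↦ ζ^k y`
  have hσ (k : ℕ) : ∃ σ : F →ₐ[K] F, ∀ j : ℕ, σ (y ^ j) = (ζ' ^ k) ^ j • y ^ j := by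
    refine hb.exists_algHom hd (c := fun j ↦ (ζ' ^ k) ^ j • y ^ j) ⟨by simp, fun j ↦ ?_, fun i j ↦ ?_⟩
    · have : (ζ' ^ k) ^ d = 1 := by rw [← pow_mul, mul_comm, pow_mul, hζ.pow_eq_one, one_pow]
      simp only [pow_add, hy, this, mul_one]
      rw [smul_comm, Algebra.smul_def s, mul_comm]
    · simp [pow_add, Algebra.smul_def, mul_mul_mul_comm]
  choose σ hσ using hσ
  -- `ζ` and `d` are invertible in `A`, so that averaging stays within integral elements
  have hinv : ∃ ξ : A, algebraMap A K ξ = ζ'⁻¹ := by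
    refine ⟨ζ ^ (d - 1), ?_⟩
    rw [map_pow]
    refine eq_inv_of_mul_eq_one_left ?_
    rw [← pow_succ, Nat.sub_add_cancel hd, hζ.pow_eq_one]
  obtain ⟨ξ, hξ⟩ := hinv
  obtain ⟨v, hv⟩ := hdA
  have hvK : algebraMap A K ↑v⁻¹ = (d : K)⁻¹ := by
    refine eq_inv_of_mul_eq_one_left ?_
    rw [← map_natCast (algebraMap A K) d, ← map_mul, ← hv, Units.inv_mul, map_one]
  have key : f j • y ^ (j : ℕ) = algebraMap A F ↑v⁻¹ * ∑ k ∈ Finset.range d,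
      algebraMap A F ((ξ ^ k) ^ (j : ℕ)) * σ k (∑ j : Fin d, f j • y ^ (j : ℕ)) := by
    have h1 (k : ℕ) : algebraMap A F ((ξ ^ k) ^ (j : ℕ)) * σ k (∑ j : Fin d, f j • y ^ (j : ℕ)) =
        ∑ i : Fin d, ((ζ' ^ k) ^ (i : ℕ) * ((ζ' ^ k) ^ (j : ℕ))⁻¹) • f i • y ^ (i : ℕ) := by
      have h2 : algebraMap A K ((ξ ^ k) ^ (j : ℕ)) = (ζ'⁻¹ ^ k) ^ (j : ℕ) := by
        rw [map_pow, map_pow, hξ]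
      rw [IsScalarTower.algebraMap_apply A K F, h2, map_sum, ← Algebra.smul_def,
        Finset.smul_sum]
      refine Finset.sum_congr rfl fun i _ ↦ ?_
      rw [map_smul, hσ, smul_smul, smul_smul, smul_smul]
      congr 1
      rw [inv_pow, inv_pow]
      ring
    simp only [h1]
    rw [Finset.sum_comm]
    simp only [← Finset.sum_smul, sum_pow_mul_inv_pow hζ, ite_smul, zero_smul, Finset.sum_ite_eq',
      Finset.mem_univ, if_true]
    rw [IsScalarTower.algebraMap_apply A K F, hvK, ← Algebra.smul_def, smul_smul, inv_mul_cancel₀ hdK,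
      one_smul]
  rw [key]
  refine isIntegral_algebraMap.mul (IsIntegral.sum _ fun k _ ↦ isIntegral_algebraMap.mul ?_)
  exact hf.map ((σ k).restrictScalars A)

set_option maxHeartbeats 400000 in
open MvPolynomial in
/-- The normalization of a cyclic cover in étale coordinates: over an étale `ℂ[x_1, …, x_n]`-algebra
`A`, the normalization of `y^d = u x^a`, with a unit `u`, is free with basis the elements
`y^j / x^⌊j a / d⌋`. -/
lemma exists_isCyclicBasis {n d : ℕ} (hd : 0 < d) {A K F B : Type} [CommRing A] [IsDomain A]
    [Algebra (MvPolynomial (Fin n) ℂ) A] [Algebra.Etale (MvPolynomial (Fin n) ℂ) A] [Field K]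
    [Algebra A K] [IsFractionRing A K] [CommRing F] [Algebra A F] [Algebra K F] [IsScalarTower A K F]
    [CommRing B] [Algebra A B] [Algebra B F] [IsScalarTower A B F] [IsIntegralClosure B A F]
    (a : Fin n → ℕ) {u : A} (hu : IsUnit u) {y : F}
    (hy : y ^ d = algebraMap A F (u * ∏ i, algebraMap (MvPolynomial (Fin n) ℂ) A (X i) ^ a i))
    (hli : LinearIndependent K fun j : Fin d ↦ y ^ (j : ℕ))
    (hsp : ⊤ ≤ Submodule.span K (Set.range fun j : Fin d ↦ y ^ (j : ℕ))) :
    ∃ b : ℕ → B, IsCyclicBasis (fun i ↦ algebraMap (MvPolynomial (Fin n) ℂ) A (X i)) u a d b ∧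
      ∀ j, algebraMap B F (b j) *
        algebraMap A F (∏ i, algebraMap (MvPolynomial (Fin n) ℂ) A (X i) ^ (j * a i / d)) = y ^ j := by
  let P := MvPolynomial (Fin n) ℂ
  have hinj : Function.Injective (algebraMap P A) := FaithfulSMul.algebraMap_injective P A
  let x : Fin n → A := fun i ↦ algebraMap P A (X i)
  have hx (i) : x i ≠ 0 := (map_ne_zero_iff _ hinj).2 (X_ne_zero i)
  -- the denominators `m_j = x^⌊j a / d⌋` of the basis elements
  let m (j : ℕ) : A := ∏ i, x i ^ (j * a i / d)
  have hm (j) : m j ≠ 0 := Finset.prod_ne_zero_iff.2 fun i _ ↦ pow_ne_zero _ (hx i)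
  have hmK (j) : algebraMap A K (m j) ≠ 0 := by simpa using hm j
  have hmF (j) : IsUnit (algebraMap A F (m j)) := by
    rw [IsScalarTower.algebraMap_apply A K F]
    exact (hmK j).isUnit.map _
  have hmadd (i j) : m (i + j) = (∏ l, x l ^ carry a d i j l) * m i * m j := by
    simp only [m, ← Finset.prod_mul_distrib, ← pow_add, carry_add]
  have hmd (j) : m j ^ d * ∏ i, x i ^ (j * a i % d) = (∏ i, x i ^ a i) ^ j := by
    simp only [m, ← Finset.prod_pow, ← Finset.prod_mul_distrib, ← pow_mul, ← pow_add]
    refine Finset.prod_congr rfl fun i _ ↦ ?_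
    rw [mul_comm _ d, Nat.div_add_mod, mul_comm j]
  have : Nontrivial F := by
    refine ⟨1, 0, fun h ↦ hli.ne_zero ⟨0, hd⟩ ?_⟩
    simpa using h
  have hKF : Function.Injective (algebraMap K F) := (algebraMap K F).injective
  -- the elements `y^j / m_j` are integral since their `d`-th powers are `u^j x^(j a mod d)`
  let bF (j : ℕ) : F := (algebraMap A K (m j))⁻¹ • y ^ j
  have hbF (j) : bF j * algebraMap A F (m j) = y ^ j := by
    rw [IsScalarTower.algebraMap_apply A K F, mul_comm, ← Algebra.smul_def, smul_smul,
      mul_inv_cancel₀ (hmK j), one_smul]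
  have hbint (j) : IsIntegral A (bF j) := by
    refine IsIntegral.of_pow hd ?_
    have : bF j ^ d = algebraMap A F (u ^ j * ∏ i, x i ^ (j * a i % d)) := by
      apply ((hmF j).pow d).mul_right_cancel
      rw [← mul_pow, hbF, ← pow_mul, mul_comm j, pow_mul, hy, ← map_pow, ← map_pow, ← map_mul,
        mul_assoc, mul_comm _ (m j ^ d), hmd, mul_pow]
    rw [this]
    exact isIntegral_algebraMap
  choose b hb using fun j ↦ (IsIntegralClosure.isIntegral_iff (A := B)).1 (hbint j)
  have hBF : Function.Injective (algebraMap B F) := IsIntegralClosure.algebraMap_injective B A F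
  refine ⟨b, ⟨⟨?_, fun j ↦ ?_, fun i j ↦ ?_⟩, ?_, ?_⟩, fun j ↦ by rw [hb]; exact hbF j⟩
  · apply hBF
    rw [hb, map_one]
    simp [bF, m]
  · apply hBF
    rw [hb, Algebra.smul_def, map_mul, hb, ← IsScalarTower.algebraMap_apply A B F]
    apply (hmF (j + d)).mul_right_cancel
    have h1 : m (j + d) = m j * ∏ i, x i ^ a i := by
      simp only [m, ← Finset.prod_mul_distrib, ← pow_add]
      refine Finset.prod_congr rfl fun i _ ↦ ?_
      rw [add_mul, Nat.add_mul_div_left _ _ hd]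
    rw [hbF, pow_add, hy, h1, map_mul (algebraMap A F) (m j), mul_assoc, ← mul_assoc (bF j), hbF,
      map_mul (algebraMap A F) u]
    ring
  · apply hBF
    rw [map_mul, hb, hb, Algebra.smul_def, map_mul, hb, ← IsScalarTower.algebraMap_apply A B F]
    apply ((hmF i).mul (hmF j)).mul_right_cancel
    rw [mul_mul_mul_comm, hbF, hbF, ← pow_add, ← hbF, hmadd, map_mul, map_mul]
    ring
  · have h1 : LinearIndependent K fun j : Fin d ↦ bF j :=
      hli.units_smul fun j : Fin d ↦ (Units.mk0 _ (hmK j))⁻¹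
    have h2 : LinearIndependent A fun j : Fin d ↦ bF j := h1.restrict_scalars' A
    refine LinearIndependent.of_comp (IsScalarTower.toAlgHom A B F).toLinearMap ?_
    convert h2 using 2 with j
    exact hb j
  · rintro v -
    have hv : IsIntegral A (algebraMap B F v) := (IsIntegralClosure.isIntegral_iff (A := B)).2 ⟨v, rfl⟩
    obtain ⟨f, hf⟩ := (Submodule.mem_span_range_iff_exists_fun K).1
      (hsp (Submodule.mem_top (x := algebraMap B F v)))
    rw [← hf] at hv
    let ζ : ℂ := Complex.exp (2 * Real.pi * Complex.I / d)
    have hζ : IsPrimitiveRoot ζ d := Complex.isPrimitiveRoot_exp d hd.ne'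
    let τ : ℂ →+* K := (algebraMap A K).comp ((algebraMap P A).comp MvPolynomial.C)
    have hζ' : IsPrimitiveRoot (algebraMap A K (algebraMap P A (C ζ))) d :=
      hζ.map_of_injective (f := τ) τ.injective
    have hd0 : (d : ℂ) ≠ 0 := by exact_mod_cast hd.ne'
    have hdA : IsUnit (d : A) := by
      have := hd0.isUnit.map ((algebraMap P A).comp MvPolynomial.C)
      rwa [map_natCast] at this
    have hdK : (d : K) ≠ 0 := by
      rw [← map_natCast τ]
      exact (map_ne_zero τ).2 hd0
    -- in an integral `∑ f_j y^j` every `f_j y^j` is integral, and then the coefficient `f_j m_j` of `y^j / m_j`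
    -- lies in `A` since `(f_j m_j)^d x^(j a mod d)` is integral
    have hfj := isIntegral_smul_pow hζ' hdA hdK (by rw [hy, IsScalarTower.algebraMap_apply A K F]) hli hsp f hv
    have hc (j : Fin d) : ∃ c : A, algebraMap A K c = f j * algebraMap A K (m j) := by
      refine mem_range_of_isIntegral_pow_mul (n := n) hd (fun i ↦ j * a i % d) (fun i ↦ Nat.mod_lt _ hd) _ ?_
      obtain ⟨v, hv⟩ := hu
      have h1 : IsIntegral A (f j ^ d * algebraMap A K (u * ∏ i, x i ^ a i) ^ (j : ℕ)) := by
        rw [← isIntegral_algebraMap_iff hKF]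
        have h2 := (hfj j).pow d
        rw [smul_pow, ← pow_mul, mul_comm _ d, pow_mul, hy, Algebra.smul_def,
          IsScalarTower.algebraMap_apply A K F, ← map_pow, ← map_mul] at h2
        exact h2
      have h2 := (isIntegral_algebraMap (R := A) (A := K) (x := (↑v⁻¹ : A) ^ (j : ℕ))).mul h1
      have h3 : (↑v⁻¹ : A) ^ (j : ℕ) * u ^ (j : ℕ) = 1 := by
        rw [← hv, ← mul_pow, Units.inv_mul, one_pow]
      have h4 : (f j * algebraMap A K (m j)) ^ d * algebraMap A K (∏ i, x i ^ (j * a i % d)) =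
          algebraMap A K ((↑v⁻¹ : A) ^ (j : ℕ)) *
            (f j ^ d * algebraMap A K (u * ∏ i, x i ^ a i) ^ (j : ℕ)) := by
        rw [mul_pow, ← map_pow, mul_assoc, ← map_mul, mul_left_comm, ← map_pow, ← map_mul, hmd, mul_pow,
          ← mul_assoc (_ ^ _) (u ^ _), h3, one_mul]
      rw [← h4] at h2
      exact h2
    choose c hc using hc
    have : v = ∑ j : Fin d, c j • b j := by
      apply hBF
      rw [← hf, map_sum]
      refine Finset.sum_congr rfl fun j _ ↦ ?_
      rw [Algebra.smul_def (c j), map_mul, hb, ← IsScalarTower.algebraMap_apply A B F,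
        IsScalarTower.algebraMap_apply A K F, hc, ← Algebra.smul_def, smul_smul, mul_assoc,
        mul_inv_cancel₀ (hmK j), mul_one]
    rw [this]
    exact Submodule.sum_mem _ fun j _ ↦ Submodule.smul_mem _ _ (Submodule.subset_span ⟨j, rfl⟩)

/-! ### The semigroup of the local model -/

section Semigroup

variable {n : ℕ} (a : Fin n → ℕ) (d : ℕ)

lemma mem_latticeCone_of_nonneg {ι : Type} {n d : ℕ} (hd : 0 < d) (w : ι → Fin n → ℤ)
    (hw' : ∀ i, ∃ k, w k = Pi.single i (d : ℤ)) {s : Fin n → ℤ} (hs : 0 ≤ s) : s ∈ latticeCone w := by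
  classical
  choose k hk using hw'
  change toReal n s ∈ Submodule.span NNReal (Set.range fun k ↦ toReal n (w k))
  have h1 : toReal n s = ∑ i, (((s i).toNat : NNReal) / d) • toReal n (w (k i)) := by
    ext l
    simp only [hk, toReal, Finset.sum_apply, Pi.smul_apply, AddMonoidHom.compLeft_apply,
      Function.comp_apply, Int.coe_castAddHom, NNReal.smul_def, Pi.single_apply]
    have h2 : (((s l).toNat : ℤ) : ℝ) = s l := by rw [Int.toNat_of_nonneg (hs l)]
    have h3 : (d : ℝ) ≠ 0 := by exact_mod_cast hd.ne'
    simp only [Int.cast_ite, Int.cast_natCast, Int.cast_zero, smul_eq_mul, mul_ite, mul_zero,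
      Finset.sum_ite_eq, Finset.mem_univ, if_true, NNReal.coe_div, NNReal.coe_natCast]
    rw [div_mul_cancel₀ _ h3, ← h2]
    rfl
  rw [h1]
  exact Submodule.sum_mem _ fun i _ ↦ Submodule.smul_mem _ _ (Submodule.subset_span ⟨k i, rfl⟩)

lemma nonneg_of_mem_latticeCone {ι : Type} {n : ℕ} {w : ι → Fin n → ℤ} (hw : ∀ k, 0 ≤ w k) {s : Fin n → ℤ}
    (h : s ∈ latticeCone w) : 0 ≤ s := by
  change toReal n s ∈ Submodule.span NNReal (Set.range fun k ↦ toReal n (w k)) at h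
  have h1 : ∀ v ∈ Submodule.span NNReal (Set.range fun k ↦ toReal n (w k)), 0 ≤ v := by
    intro v hv
    induction hv using Submodule.span_induction with
    | mem v hv =>
      obtain ⟨k, rfl⟩ := hv
      intro l
      simpa [toReal] using hw k l
    | zero => exact le_rfl
    | add v w _ _ hv hw => exact add_nonneg hv hw
    | smul r v _ hv => exact smul_nonneg r.2 hv
  intro l
  have := h1 _ h l
  simpa [toReal] using this

/-- If the generators have nonnegative entries and include the `d e_i`, then the cone is the orthant. -/
lemma mem_latticeCone_iff {ι : Type} {n d : ℕ} (hd : 0 < d) (w : ι → Fin n → ℤ) (hw : ∀ k, 0 ≤ w k)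
    (hw' : ∀ i, ∃ k, w k = Pi.single i (d : ℤ)) (s : Fin n → ℤ) : s ∈ latticeCone w ↔ 0 ≤ s :=
  ⟨nonneg_of_mem_latticeCone hw, mem_latticeCone_of_nonneg hd w hw'⟩

lemma modelGen_nonneg (k : Option (Fin n)) : 0 ≤ modelGen a d k := by
  intro l
  rcases k with _ | i
  · exact Int.natCast_nonneg _
  · simp only [modelGen, Pi.zero_apply, Pi.single_apply]
    split_ifs <;> simp

lemma sum_smul_modelGen (m : Fin n → ℤ) (l : Fin n) :
    (∑ i, m i • modelGen a d (some i)) l = d * m l := by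
  classical
  simp [modelGen, Finset.sum_apply, Pi.single_apply, mul_comm]

variable {d} in
/-- The lattice consists of the vectors that are congruent modulo `d` to a multiple of `a`; a negative multiple
can be replaced by a nonnegative one modulo `d`. -/
lemma mem_modelLattice_iff (hd : 0 < d) (s : Fin n → ℤ) :
    s ∈ modelLattice a d ↔ ∃ j : ℕ, ∀ l, (d : ℤ) ∣ s l - j * a l := by
  classical
  constructor
  · intro h
    have h1 : ∃ j : ℤ, ∀ l, (d : ℤ) ∣ s l - j * a l := by
      induction h using AddSubgroup.closure_induction with
      | mem s hs =>
        obtain ⟨k, rfl⟩ := hs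
        rcases k with _ | i
        · exact ⟨1, fun l ↦ by simp [modelGen]⟩
        · refine ⟨0, fun l ↦ ?_⟩
          simp only [modelGen, Pi.single_apply]
          split_ifs <;> simp
      | zero => exact ⟨0, fun l ↦ by simp⟩
      | add s t _ _ hs ht =>
        obtain ⟨i, hi⟩ := hs
        obtain ⟨j, hj⟩ := ht
        refine ⟨i + j, fun l ↦ ?_⟩
        have e : (s + t) l - (i + j) * a l = (s l - i * a l) + (t l - j * a l) := by
          rw [Pi.add_apply]; ring
        rw [e]
        exact (hi l).add (hj l)
      | neg s _ hs =>
        obtain ⟨i, hi⟩ := hs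
        refine ⟨-i, fun l ↦ ?_⟩
        have e : (-s) l - -i * a l = -(s l - i * a l) := by
          rw [Pi.neg_apply]; ring
        rw [e]
        exact (hi l).neg_right
    obtain ⟨j, hj⟩ := h1
    have hd' : (d : ℤ) ≠ 0 := by exact_mod_cast hd.ne'
    refine ⟨(j % d).toNat, fun l ↦ ?_⟩
    rw [Int.toNat_of_nonneg (Int.emod_nonneg _ hd')]
    have h2 : s l - j % d * a l = (s l - j * a l) + d * (j / d * a l) := by
      have := Int.emod_add_mul_ediv j d
      linear_combination (-(a l : ℤ)) * this
    rw [h2]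
    exact (hj l).add (dvd_mul_right _ _)
  · rintro ⟨j, hj⟩
    choose m hm using hj
    have : s = (j : ℤ) • modelGen a d none + ∑ i, m i • modelGen a d (some i) := by
      ext l
      rw [Pi.add_apply, sum_smul_modelGen, ← hm]
      simp [modelGen]
    rw [this]
    have hg (k) : modelGen a d k ∈ modelLattice a d := AddSubgroup.subset_closure ⟨k, rfl⟩
    exact add_mem (zsmul_mem (hg none) _) (sum_mem fun i _ ↦ zsmul_mem (hg (some i)) _)

variable {a d} in
/-- The semigroup consists of the vectors with nonnegative entries that are congruent modulo `d`
to a multiple of `a`. -/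
lemma mem_modelSemigroup_iff (hd : 0 < d) (s : Fin n → ℤ) :
    s ∈ modelSemigroup a d ↔ 0 ≤ s ∧ ∃ j : ℕ, ∀ l, (d : ℤ) ∣ s l - j * a l := by
  rw [modelSemigroup, AddSubmonoid.mem_inf, AddSubgroup.mem_toAddSubmonoid, mem_modelLattice_iff a hd,
    mem_latticeCone_iff hd _ (modelGen_nonneg a d) (fun i ↦ ⟨some i, rfl⟩), and_comm]

variable {d} in
/-- The semigroup is simplicial: its cone is generated by the `d e_i`. -/
lemma isSimplicialIn_modelSemigroup (hd : 0 < d) : IsSimplicialIn (modelSemigroup a d) (modelLattice a d) := by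
  classical
  refine ⟨n, fun i ↦ modelGen a d (some i), fun i ↦ AddSubgroup.subset_closure ⟨some i, rfl⟩, ?_, ?_⟩
  · have h3 : (d : ℝ) ≠ 0 := by exact_mod_cast hd.ne'
    rw [Fintype.linearIndependent_iff]
    intro r hr l
    have h1 := congrFun hr l
    simpa [toReal, modelGen, Finset.sum_apply, Pi.single_apply, h3] using h1
  · ext s
    rw [mem_modelSemigroup_iff hd, AddSubmonoid.mem_inf, AddSubgroup.mem_toAddSubmonoid,
      mem_modelLattice_iff a hd, mem_latticeCone_iff hd _ (fun i ↦ modelGen_nonneg a d (some i))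
      (fun i ↦ ⟨i, rfl⟩), and_comm]

/-- The smallest vector with nonnegative entries that is congruent to `j a` modulo `d`. -/
def modelVec (j : ℕ) : Fin n → ℤ := fun l ↦ ((j * a l % d : ℕ) : ℤ)

variable {d} in
lemma modelVec_mem (hd : 0 < d) (j : ℕ) : modelVec a d j ∈ modelSemigroup a d := by
  rw [mem_modelSemigroup_iff hd]
  refine ⟨fun l ↦ Int.natCast_nonneg _, j, fun l ↦ ?_⟩
  have := (Int.mod_modEq (j * a l : ℕ) d).symm.dvd
  rw [modelVec]
  push_cast at this ⊢
  exact this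

/-- The algebra structure of the semigroup ring over `ℂ[x_1, …, x_n]`: the variable `x_i` acts as the
monomial of `d e_i`. -/
instance : Algebra (MvPolynomial (Fin n) ℂ) (ModelSemigroupRing a d) :=
  (MvPolynomial.aeval fun i ↦ (AddMonoidAlgebra.single (modelGenS a d (some i)) 1 :
    ModelSemigroupRing a d)).toAlgebra

instance : IsScalarTower ℂ (MvPolynomial (Fin n) ℂ) (ModelSemigroupRing a d) :=
  .of_algebraMap_eq' (MvPolynomial.aeval fun i ↦ (AddMonoidAlgebra.single (modelGenS a d (some i)) 1 :
    ModelSemigroupRing a d)).comp_algebraMap.symm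

lemma algebraMap_X (i : Fin n) : algebraMap (MvPolynomial (Fin n) ℂ) (ModelSemigroupRing a d)
    (MvPolynomial.X i) = AddMonoidAlgebra.single (modelGenS a d (some i)) 1 :=
  MvPolynomial.aeval_X _ _

lemma coe_sum_smul_modelGenS (m : Fin n → ℕ) (l : Fin n) :
    (∑ i, m i • modelGenS a d (some i) : modelSemigroup a d).1 l = d * m l := by
  rw [← sum_smul_modelGen a d (fun i ↦ (m i : ℤ)) l]
  simp only [AddSubmonoid.coe_finsetSum, natCast_zsmul]
  rfl

lemma algebraMap_prod_X_pow (m : Fin n → ℕ) : algebraMap (MvPolynomial (Fin n) ℂ) (ModelSemigroupRing a d)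
    (∏ i, MvPolynomial.X i ^ m i) = AddMonoidAlgebra.single (∑ i, m i • modelGenS a d (some i)) 1 := by
  classical
  simp only [map_prod, map_pow, algebraMap_X, AddMonoidAlgebra.single_pow, one_pow]
  induction (Finset.univ : Finset (Fin n)) using Finset.induction_on with
  | empty => rfl
  | insert i s hi ih => rw [Finset.prod_insert hi, Finset.sum_insert hi, ih, AddMonoidAlgebra.single_mul_single, one_mul]

end Semigroup

section Functional

open MvPolynomial

variable {n : ℕ} (a : Fin n → ℕ) {d : ℕ}

/-- The coordinate functionals of the semigroup ring over `ℂ[x_1, …, x_n]`: the coefficient at the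
monomial of the residue vector of `i a` modulo `d`. -/
lemma exists_modelFunctional (hd : 0 < d) (i : ℕ) :
    ∃ l : ModelSemigroupRing a d →ₗ[MvPolynomial (Fin n) ℂ] MvPolynomial (Fin n) ℂ, ∀ j,
      l (AddMonoidAlgebra.single ⟨modelVec a d j, modelVec_mem a hd j⟩ 1) =
        if modelVec a d j = modelVec a d i then 1 else 0 := by
  classical
  have hd' : (d : ℤ) ≠ 0 := by exact_mod_cast hd.ne'
  let B : Module.Basis (modelSemigroup a d) ℂ (ModelSemigroupRing a d) := AddMonoidAlgebra.basis _ _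
  have hB (s) : B s = AddMonoidAlgebra.single s 1 := by simp [B]
  let c (s : modelSemigroup a d) : MvPolynomial (Fin n) ℂ :=
    if ∀ l, s.1 l % d = modelVec a d i l then ∏ l, X l ^ (s.1 l / d).toNat else 0
  let f : ModelSemigroupRing a d →ₗ[ℂ] MvPolynomial (Fin n) ℂ := B.constr ℂ c
  have hf (s) : f (AddMonoidAlgebra.single s 1) = c s := by
    rw [← hB, B.constr_basis]
  have hmul (p : MvPolynomial (Fin n) ℂ) (v : ModelSemigroupRing a d) : f (p • v) = p * f v := by
    have : (LinearMap.mul ℂ (ModelSemigroupRing a d)).compr₂ f ∘ₗ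
        (IsScalarTower.toAlgHom ℂ (MvPolynomial (Fin n) ℂ) (ModelSemigroupRing a d)).toLinearMap =
        (LinearMap.mul ℂ (MvPolynomial (Fin n) ℂ)).compl₂ f := by
      refine (basisMonomials (Fin n) ℂ).ext fun k ↦ B.ext fun s ↦ ?_
      have hk : (monomial k 1 : MvPolynomial (Fin n) ℂ) = ∏ i, X i ^ k i := by
        rw [monomial_eq]; simp [Finsupp.prod_fintype]
      simp only [coe_basisMonomials, LinearMap.comp_apply, LinearMap.compr₂_apply,
          LinearMap.mul_apply', LinearMap.compl₂_apply, AlgHom.toLinearMap_apply, hB, hf,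
          IsScalarTower.coe_toAlgHom', hk]
      rw [algebraMap_prod_X_pow, AddMonoidAlgebra.single_mul_single, one_mul, hf]
      simp only [c, AddSubmonoid.coe_add, Pi.add_apply, coe_sum_smul_modelGenS, Int.mul_add_emod_self_left]
      split_ifs with h
      · rw [← Finset.prod_mul_distrib]
        refine Finset.prod_congr rfl fun l _ ↦ ?_
        rw [← pow_add]
        congr 1
        have h1 : 0 ≤ s.1 l := ((mem_modelSemigroup_iff hd _).1 s.2).1 l
        have h2 : 0 ≤ s.1 l / d := Int.ediv_nonneg h1 (Int.natCast_nonneg _)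
        rw [add_comm, Int.add_mul_ediv_left _ _ hd']
        omega
      · rw [mul_zero]
    rw [Algebra.smul_def]
    exact congrArg (fun k ↦ k p v) this
  refine ⟨{ toFun := f, map_add' := f.map_add, map_smul' := hmul }, fun j ↦ ?_⟩
  change f _ = _
  rw [hf]
  have h1 (l) : modelVec a d j l % d = modelVec a d j l := by
    rw [modelVec, ← Int.natCast_mod, Nat.mod_mod]
  have h2 (l) : modelVec a d j l / d = 0 := by
    rw [modelVec, ← Int.natCast_div, Nat.div_eq_of_lt (Nat.mod_lt _ hd)]; rfl
  simp only [c, h1, ← funext_iff, h2, Int.toNat_zero, pow_zero, Finset.prod_const_one]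

end Functional

/-! ### Fractions of the cyclic extension and the cyclic basis of the model -/

section Roots

open Polynomial

/-- Over a domain `A` with fraction field `K`, the total ring of fractions of `A[y]/(y^d - s)` is a
`K`-algebra with basis `1, y, …, y^{d-1}`. -/
lemma exists_algebra_fractions {A K F : Type} [CommRing A] [IsDomain A] [Field K] [Algebra A K]
    [IsFractionRing A K] {d : ℕ} (hd : 0 < d) (s : A) [CommRing F]
    [Algebra (AdjoinRoot (X ^ d - C s)) F] [IsFractionRing (AdjoinRoot (X ^ d - C s)) F] [Algebra A F]
    [IsScalarTower A (AdjoinRoot (X ^ d - C s)) F] :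
    ∃ (_ : Algebra K F), IsScalarTower A K F ∧
      LinearIndependent K (fun j : Fin d ↦
        (algebraMap _ F (AdjoinRoot.root (X ^ d - C s))) ^ (j : ℕ)) ∧
      ⊤ ≤ Submodule.span K (Set.range fun j : Fin d ↦
        (algebraMap _ F (AdjoinRoot.root (X ^ d - C s))) ^ (j : ℕ)) := by
  let R := AdjoinRoot (X ^ d - C s)
  have hmon : (X ^ d - C s).Monic := monic_X_pow_sub_C s hd.ne'
  let pb : PowerBasis A R := AdjoinRoot.powerBasis' hmon
  have hdim : pb.dim = d := by simp [pb]
  have : Module.Finite A R := pb.finite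
  have : Nontrivial R := AdjoinRoot.nontrivial _ (by
    rw [degree_X_pow_sub_C hd]; exact_mod_cast hd.ne')
  have hinj : Function.Injective (algebraMap A R) := by
    have : Module.Free A R := .of_basis pb.basis
    exact FaithfulSMul.algebraMap_injective A R
  have hle : Algebra.algebraMapSubmonoid R (nonZeroDivisors A) ≤ nonZeroDivisors R := by
    rintro _ ⟨q, hq, rfl⟩
    rw [mem_nonZeroDivisors_iff_right]
    intro z hz
    have : Module.Free A R := .of_basis pb.basis
    rw [mul_comm, ← Algebra.smul_def] at hz
    exact (smul_eq_zero.1 hz).resolve_left (nonZeroDivisors.ne_zero hq)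
  have : IsLocalization (Algebra.algebraMapSubmonoid R (nonZeroDivisors A)) F := by
    refine (IsLocalization.iff_of_le_of_exists_dvd _ (nonZeroDivisors R) hle fun r hr ↦ ?_).2 inferInstance
    obtain ⟨q, hq, h⟩ := (Algebra.IsIntegral.isIntegral (R := A) r).isAlgebraic.exists_nonzero_dvd hr
    exact ⟨_, ⟨q, mem_nonZeroDivisors_of_ne_zero hq, rfl⟩, h⟩
  have hu (q : nonZeroDivisors A) : IsUnit (algebraMap A F q) := by
    rw [IsScalarTower.algebraMap_apply A R F]
    exact IsLocalization.map_units F (⟨_, q, q.2, rfl⟩ : Algebra.algebraMapSubmonoid R (nonZeroDivisors A))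
  let alg : Algebra K F := (IsLocalization.lift hu).toAlgebra
  have : IsScalarTower A K F := .of_algebraMap_eq fun q ↦ (IsLocalization.lift_eq hu q).symm
  let β : Module.Basis (Fin pb.dim) K F := pb.basis.localizationLocalization K (nonZeroDivisors A) F
  let β' := β.reindex (finCongr hdim)
  have hβ' : ⇑β' = fun j : Fin d ↦ (algebraMap _ F (AdjoinRoot.root (X ^ d - C s))) ^ (j : ℕ) := by
    ext j
    simp only [β', β, Module.Basis.reindex_apply, Module.Basis.localizationLocalization_apply,
      PowerBasis.basis_eq_pow, map_pow, finCongr_symm, finCongr_apply_coe]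
    rfl
  refine ⟨alg, inferInstance, ?_, ?_⟩
  · rw [← hβ']
    exact β'.linearIndependent
  · rw [← hβ', β'.span_eq]

end Roots

/-- If `d` divides all the `m a_l`, then it divides `m g` for the greatest common divisor `g` of `d` and the
`a_l`. -/
lemma dvd_mul_gcd {n : ℕ} {a : Fin n → ℕ} {d m : ℕ} (h : ∀ l, d ∣ m * a l) :
    d ∣ m * Nat.gcd (Finset.univ.gcd a) d := by
  rw [← Nat.gcd_mul_left]
  refine Nat.dvd_gcd ?_ (dvd_mul_left _ _)
  have : Finset.univ.gcd (fun l ↦ m * a l) = m * Finset.univ.gcd a := by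
    rw [Finset.gcd_mul_left, normalize_eq]
  rw [← this]
  exact Finset.dvd_gcd fun l _ ↦ h l

lemma gcd_dvd_apply {n : ℕ} (a : Fin n → ℕ) (d : ℕ) (l : Fin n) : Nat.gcd (Finset.univ.gcd a) d ∣ a l :=
  (Nat.gcd_dvd_left _ _).trans (Finset.gcd_dvd (Finset.mem_univ l))

lemma sum_single {M ι : Type*} (m : M) (t : Finset ι) (f : ι → ℂ) :
    ∑ i ∈ t, (AddMonoidAlgebra.single m (f i) : AddMonoidAlgebra ℂ M) =
      AddMonoidAlgebra.single m (∑ i ∈ t, f i) :=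
  (map_sum (AddMonoidAlgebra.singleAddHom m) f t).symm

section Model

open MvPolynomial

variable {n : ℕ} (a : Fin n → ℕ) {d : ℕ}

/-- A vector of the semigroup congruent to `j a` is the smallest such vector plus a nonnegative combination
of the `d e_i`; in the semigroup ring it is a multiple by a polynomial. -/
lemma modelVec_add_smul_modelGenS (hd : 0 < d) (j : ℕ) (m : Fin n → ℕ) (s : modelSemigroup a d)
    (hs : ∀ l, s.1 l = (j * a l % d : ℕ) + d * m l) (z : ℂ) :
    (AddMonoidAlgebra.single s z : ModelSemigroupRing a d) = (∏ i, X i ^ m i : MvPolynomial (Fin n) ℂ) •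
      AddMonoidAlgebra.single ⟨modelVec a d j, modelVec_mem a hd j⟩ z := by
  rw [Algebra.smul_def, algebraMap_prod_X_pow, AddMonoidAlgebra.single_mul_single, one_mul]
  congr 1
  ext l
  rw [AddSubmonoid.coe_add, Pi.add_apply, coe_sum_smul_modelGenS, hs, add_comm]
  rfl

/-- The elements `(ζ^{k j} χ^{j a mod d})_k` of the product of `g` copies of the semigroup ring are a
cyclic basis over `ℂ[x_1, …, x_n]`, by Fourier inversion on the group of `g`-th roots of unity. -/
lemma isCyclicBasis_model (hd : 0 < d) {ζ : ℂ} (hζ : IsPrimitiveRoot ζ d) :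
    IsCyclicBasis (fun i ↦ (X i : MvPolynomial (Fin n) ℂ)) 1 a d
      (fun j (k : Fin (Nat.gcd (Finset.univ.gcd a) d)) ↦
        (AddMonoidAlgebra.single ⟨modelVec a d j, modelVec_mem a hd j⟩ (ζ ^ ((k : ℕ) * j)) :
          ModelSemigroupRing a d)) := by
  classical
  set g := Nat.gcd (Finset.univ.gcd a) d with hg
  let c : ℕ → Fin g → ModelSemigroupRing a d := fun j (k : Fin g) ↦
    AddMonoidAlgebra.single ⟨modelVec a d j, modelVec_mem a hd j⟩ (ζ ^ ((k : ℕ) * j))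
  have hg0 : 0 < g := Nat.gcd_pos_of_pos_right _ hd
  have hg1 : (g : ℂ) ≠ 0 := by exact_mod_cast hg0.ne'
  have hζ0 : ζ ≠ 0 := hζ.ne_zero hd.ne'
  have hfam : IsCyclicFamily (fun i ↦ (X i : MvPolynomial (Fin n) ℂ)) 1 a d c := by
    refine ⟨?_, fun j ↦ ?_, fun i j ↦ ?_⟩
    · ext1 k
      simp only [c, mul_zero, pow_zero, Pi.one_apply, AddMonoidAlgebra.one_def]
      congr 1
      ext l
      simp [modelVec]
    · ext1 k
      simp only [c, one_smul]
      congr 1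
      · ext l
        simp [modelVec, add_mul]
      · rw [mul_add, pow_add, mul_comm (k : ℕ) d, pow_mul ζ d, hζ.pow_eq_one, one_pow, mul_one]
    · ext1 k
      simp only [c, Pi.mul_apply, Pi.smul_apply, AddMonoidAlgebra.single_mul_single, ← pow_add, ← mul_add]
      refine modelVec_add_smul_modelGenS a hd (i + j) (carry a d i j) _ (fun l ↦ ?_) _
      rw [AddSubmonoid.coe_add, Pi.add_apply]
      simp only [modelVec]
      have h1 := carry_add a d i j l
      have h2 := Nat.mod_add_div (i * a l) d
      have h3 := Nat.mod_add_div (j * a l) d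
      have h4 := Nat.mod_add_div ((i + j) * a l) d
      rw [← h1] at h4
      have h5 : (i + j) * a l = i * a l + j * a l := add_mul _ _ _
      zify at h1 h2 h3 h4 h5 ⊢
      linear_combination h2 + h3 - h4 + h5
  refine ⟨hfam, ?_, ?_⟩
  · rw [Fintype.linearIndependent_iff]
    intro p hp i
    -- apply the functional of the residue vector of `i a` to all components, and then average against the
    -- character `k ↦ ζ^(-k i)`. An index `j` with the same residue vector satisfies `d ∣ (j - i) g`, so
    -- that only `j = i` survives the average
    obtain ⟨l, hl⟩ := exists_modelFunctional a hd i
    have hsum (j : Fin d) : ∑ k : Fin g, C (ζ ^ ((k : ℕ) * j) * (ζ ^ ((k : ℕ) * i))⁻¹) *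
        l (AddMonoidAlgebra.single ⟨modelVec a d j, modelVec_mem a hd j⟩ 1) =
        if j = i then C (g : ℂ) else 0 := by
      rw [← Finset.sum_mul, ← map_sum, hl]
      have h1 (k : ℕ) : ζ ^ (k * j) * (ζ ^ (k * i))⁻¹ = (ζ ^ (j : ℕ) * (ζ ^ (i : ℕ))⁻¹) ^ k := by
        rw [mul_pow, inv_pow, ← pow_mul, ← pow_mul, mul_comm k, mul_comm k]
      rw [Fin.sum_univ_eq_sum_range (fun k ↦ ζ ^ (k * j) * (ζ ^ (k * i))⁻¹)]
      simp only [h1]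
      split_ifs with h2 h3 h3
      · subst h3
        rw [mul_inv_cancel₀ (pow_ne_zero _ hζ0)]
        simp
      · have h4 : ζ ^ (j : ℕ) * (ζ ^ (i : ℕ))⁻¹ - 1 ≠ 0 := by
          intro h4
          rw [sub_eq_zero, mul_inv_eq_one₀ (pow_ne_zero _ hζ0)] at h4
          exact h3 (Fin.ext (hζ.pow_inj j.2 i.2 h4))
        have h5 : (j : ℕ) * g ≡ i * g [MOD d] := by
          have h6 (l) : (j : ℕ) * a l ≡ i * a l [MOD d] := by
            have := congrFun h2 l
            simp only [modelVec] at this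
            exact_mod_cast this
          rcases le_total (j : ℕ) i with hij | hij
          · rw [Nat.modEq_iff_dvd' (Nat.mul_le_mul_right _ hij), ← Nat.sub_mul]
            refine dvd_mul_gcd fun l ↦ ?_
            rw [Nat.sub_mul]
            exact (Nat.modEq_iff_dvd' (Nat.mul_le_mul_right _ hij)).1 (h6 l)
          · refine Nat.ModEq.symm ?_
            rw [Nat.modEq_iff_dvd' (Nat.mul_le_mul_right _ hij), ← Nat.sub_mul]
            refine dvd_mul_gcd fun l ↦ ?_
            rw [Nat.sub_mul]
            exact (Nat.modEq_iff_dvd' (Nat.mul_le_mul_right _ hij)).1 (h6 l).symm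
        have h7 : ∑ k ∈ Finset.range g, (ζ ^ (j : ℕ) * (ζ ^ (i : ℕ))⁻¹) ^ k = 0 := by
          apply mul_right_cancel₀ h4
          rw [geom_sum_mul, zero_mul, mul_pow, inv_pow, ← pow_mul, ← pow_mul, sub_eq_zero,
            mul_inv_eq_one₀ (pow_ne_zero _ hζ0)]
          rw [← pow_mod_orderOf, ← pow_mod_orderOf ζ (i * g), ← hζ.eq_orderOf, h5]
        rw [h7]
        simp
      · exact absurd (by rw [h3]) h2
      · rw [mul_zero]
    have h1 : ∑ k : Fin g, C ((ζ ^ ((k : ℕ) * i))⁻¹) * l ((∑ j : Fin d, p j • c j) k) = 0 := by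
      have : (∑ j : Fin d, p j • c j) = 0 := hp
      rw [this]
      simp
    have hc (j k) : c j k = ζ ^ ((k : ℕ) * j) •
        AddMonoidAlgebra.single ⟨modelVec a d j, modelVec_mem a hd j⟩ (1 : ℂ) := by
      simp [c]
    have h2 : ∑ k : Fin g, C ((ζ ^ ((k : ℕ) * i))⁻¹) * l ((∑ j : Fin d, p j • c j) k) =
        ∑ j : Fin d, p j * (if j = i then C (g : ℂ) else 0) := by
      simp only [← hsum, Finset.sum_apply, Pi.smul_apply, map_sum, map_smul, Finset.mul_sum]
      rw [Finset.sum_comm]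
      refine Finset.sum_congr rfl fun j _ ↦ Finset.sum_congr rfl fun k _ ↦ ?_
      rw [hc, LinearMap.map_smul_of_tower, C_mul, smul_eq_C_mul, smul_eq_mul]
      ring
    rw [h2] at h1
    simpa [hg0.ne'] using h1
  · have hmem (j : ℕ) : c j ∈ Submodule.span (MvPolynomial (Fin n) ℂ) (Set.range fun j : Fin d ↦ c j) := by
      rw [hfam.eq_smul_mod]
      exact Submodule.smul_mem _ _ (Submodule.subset_span ⟨⟨j % d, Nat.mod_lt _ hd⟩, rfl⟩)
    -- with `d = e g`, the residue vectors are periodic modulo `e`, and the `g` indices `j + e τ` give the same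
    -- monomial with the `g` characters of the group of `g`-th roots of unity; Fourier inversion isolates the
    -- component `k`
    obtain ⟨e, he⟩ : g ∣ d := Nat.gcd_dvd_right _ _
    have hω : IsPrimitiveRoot (ζ ^ e) g := hζ.pow hd (by rw [he, mul_comm])
    have hvec (j τ : ℕ) : modelVec a d (j + e * τ) = modelVec a d j := by
      ext l
      obtain ⟨b, hb⟩ := gcd_dvd_apply a d l
      rw [← hg] at hb
      have : (j + e * τ) * a l = j * a l + d * (τ * b) := by
        rw [hb, he]; ring
      rw [modelVec, modelVec, this, Nat.add_mul_mod_self_left]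
    have hsingle (k : Fin g) (j : ℕ) :
        Pi.single k (AddMonoidAlgebra.single ⟨modelVec a d j, modelVec_mem a hd j⟩ 1) =
        ∑ τ ∈ Finset.range g, ((g : ℂ)⁻¹ * (ζ ^ ((k : ℕ) * (j + e * τ)))⁻¹) • c (j + e * τ) := by
      ext1 k'
      have h0 (τ : ℕ) : (⟨modelVec a d (j + e * τ), modelVec_mem a hd _⟩ : modelSemigroup a d) =
          ⟨modelVec a d j, modelVec_mem a hd j⟩ := Subtype.ext (hvec j τ)
      simp only [Finset.sum_apply, Pi.smul_apply, c, h0]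
      simp only [AddMonoidAlgebra.smul_single, smul_eq_mul]
      rw [sum_single]
      have h1 (τ : ℕ) : (g : ℂ)⁻¹ * (ζ ^ ((k : ℕ) * (j + e * τ)))⁻¹ * ζ ^ ((k' : ℕ) * (j + e * τ)) =
          (g : ℂ)⁻¹ * (ζ ^ ((k' : ℕ) * j) * (ζ ^ ((k : ℕ) * j))⁻¹) *
            (((ζ ^ e) ^ τ) ^ (k' : ℕ) * (((ζ ^ e) ^ τ) ^ (k : ℕ))⁻¹) := by
        simp only [mul_add, pow_add, mul_inv, ← pow_mul]
        have e1 : (k : ℕ) * (e * τ) = e * τ * k := by ring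
        have e2 : (k' : ℕ) * (e * τ) = e * τ * k' := by ring
        rw [e1, e2]
        ring
      simp only [h1, ← Finset.mul_sum, sum_pow_mul_inv_pow hω]
      by_cases hk : k' = k
      · subst hk
        rw [Pi.single_eq_same, if_pos rfl, mul_inv_cancel₀ (pow_ne_zero _ hζ0), mul_one,
          inv_mul_cancel₀ hg1]
      · rw [Pi.single_eq_of_ne hk, if_neg hk, mul_zero, AddMonoidAlgebra.single_zero]
    have hsingle' (k : Fin g) (s : modelSemigroup a d) (z : ℂ) :
        Pi.single k (AddMonoidAlgebra.single s z : ModelSemigroupRing a d) ∈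
          Submodule.span (MvPolynomial (Fin n) ℂ) (Set.range fun j : Fin d ↦ c j) := by
      obtain ⟨hs, j, hj⟩ := (mem_modelSemigroup_iff hd _).1 s.2
      have hd' : (d : ℤ) ≠ 0 := by exact_mod_cast hd.ne'
      have h1 := modelVec_add_smul_modelGenS a hd j (fun l ↦ (s.1 l / d).toNat) s (fun l ↦ by
        rw [Int.toNat_of_nonneg (Int.ediv_nonneg (hs l) (Int.natCast_nonneg _))]
        have h2 : s.1 l % d = (j * a l : ℕ) % d := by
          push_cast
          exact (Int.modEq_iff_dvd.2 (hj l)).symm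
        rw [Int.natCast_mod, ← h2, Int.emod_add_mul_ediv]) z
      have h3 : (AddMonoidAlgebra.single ⟨modelVec a d j, modelVec_mem a hd j⟩ z : ModelSemigroupRing a d) =
          z • AddMonoidAlgebra.single ⟨modelVec a d j, modelVec_mem a hd j⟩ 1 := by simp
      rw [h1, h3, Pi.single_smul, Pi.single_smul, hsingle]
      refine Submodule.smul_mem _ _ (Submodule.smul_of_tower_mem _ _ (Submodule.sum_mem _ fun τ _ ↦
        Submodule.smul_of_tower_mem _ _ (hmem _)))
    rintro v -
    rw [← Finset.univ_sum_single v]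
    refine Submodule.sum_mem _ fun k _ ↦ ?_
    induction v k using AddMonoidAlgebra.induction_linear with
    | zero => rw [Pi.single_zero]; exact zero_mem _
    | add f g hf hg => rw [Pi.single_add]; exact add_mem hf hg
    | single s z => exact hsingle' k s z

end Model

/-! ### The normalized model ring -/

open MvPolynomial in
/-- The normalization of the model `y^d = x^a` has a cyclic basis over `ℂ[x_1, …, x_n]`, where
`y = b_1 x^⌊a / d⌋`. -/
lemma exists_isCyclicBasis_normalizedModelRing {n d : ℕ} (hd : 0 < d) (a : Fin n → ℕ) :
    ∃ b : ℕ → NormalizedModelRing a d,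
      IsCyclicBasis (fun i ↦ (X i : MvPolynomial (Fin n) ℂ)) 1 a d b ∧
      b 1 * algebraMap (MvPolynomial (Fin n) ℂ) (NormalizedModelRing a d) (∏ i, X i ^ (a i / d)) =
        algebraMap (ModelRing a d) _ (ModelRing.y a d) := by
  let P := MvPolynomial (Fin n) ℂ
  let R := ModelRing a d
  let F := FractionRing R
  let B := NormalizedModelRing a d
  obtain ⟨_, _, hli, hsp⟩ := exists_algebra_fractions (A := P) (K := FractionRing P) (F := F) hd
    (∏ i, MvPolynomial.X i ^ a i)
  have : Module.Finite P R :=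
    (AdjoinRoot.powerBasis' (Polynomial.monic_X_pow_sub_C (∏ i, MvPolynomial.X i ^ a i : P) hd.ne')).finite
  have : IsScalarTower P R B := inferInstance
  have : IsScalarTower P B F := inferInstance
  have : IsIntegralClosure B P F := by
    refine ⟨IsIntegralClosure.algebraMap_injective B R F, fun {z} ↦ ?_⟩
    rw [← IsIntegralClosure.isIntegral_iff (R := R) (A := B)]
    exact ⟨fun h ↦ h.tower_top, fun h ↦ isIntegral_trans z h⟩
  have hy : algebraMap R F (ModelRing.y a d) ^ d = algebraMap P F (1 * ∏ i, algebraMap P P (X i) ^ a i) := by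
    rw [← map_pow, one_mul]
    have h1 : (ModelRing.y a d) ^ d = algebraMap P R (∏ i, X i ^ a i) := by
      have := AdjoinRoot.eval₂_root (Polynomial.X ^ d - Polynomial.C (∏ i, X i ^ a i : P))
      simp only [Polynomial.eval₂_sub, Polynomial.eval₂_pow, Polynomial.eval₂_X, Polynomial.eval₂_C,
        sub_eq_zero] at this
      exact this
    rw [h1, ← IsScalarTower.algebraMap_apply P R F]
    rfl
  obtain ⟨b, hb, hb'⟩ := exists_isCyclicBasis (A := P) (K := FractionRing P) (F := F) (B := B) hd a
    (u := 1) isUnit_one hy hli hsp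
  refine ⟨b, hb, IsIntegralClosure.algebraMap_injective B R F ?_⟩
  have h1 := hb' 1
  rw [pow_one] at h1
  rw [map_mul, ← IsScalarTower.algebraMap_apply P B F, ← IsScalarTower.algebraMap_apply R B F, ← h1]
  simp only [one_mul]
  rfl

open MvPolynomial in
/-- The normalization of the local model is a product of copies of the semigroup ring. -/
lemma exists_normalizedModelRing_algEquiv {n d : ℕ} (hd : 0 < d) (a : Fin n → ℕ) :
    ∃ Φ : NormalizedModelRing a d ≃ₐ[ℂ] (Fin (Nat.gcd (Finset.univ.gcd a) d) → ModelSemigroupRing a d),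
      (∀ i k, Φ (algebraMap (ModelRing a d) _ (ModelRing.x a d i)) k =
        AddMonoidAlgebra.single (modelGenS a d (some i)) 1) ∧
      (∀ k, Φ (algebraMap (ModelRing a d) _ (ModelRing.y a d)) k =
        AddMonoidAlgebra.single (modelGenS a d none)
          (Complex.exp (2 * Real.pi * Complex.I * (k : ℕ) / d))) := by
  let P := MvPolynomial (Fin n) ℂ
  obtain ⟨b, hb, hb1⟩ := exists_isCyclicBasis_normalizedModelRing hd a
  have hζ := Complex.isPrimitiveRoot_exp d hd.ne'
  -- both sides have a cyclic basis with the same parameters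
  obtain ⟨Φ, hΦ⟩ := hb.exists_algEquiv hd (isCyclicBasis_model a hd hζ)
  refine ⟨Φ.restrictScalars ℂ, fun i k ↦ ?_, fun k ↦ ?_⟩
  · have : algebraMap (ModelRing a d) (NormalizedModelRing a d) (ModelRing.x a d i) =
        algebraMap P (NormalizedModelRing a d) (X i) :=
      (IsScalarTower.algebraMap_apply P (ModelRing a d) (NormalizedModelRing a d) _).symm
    rw [this, AlgEquiv.restrictScalars_apply, Φ.commutes]
    exact algebraMap_X a d i
  · rw [← hb1, AlgEquiv.restrictScalars_apply, map_mul, Φ.commutes, hΦ, Pi.mul_apply,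
      Pi.algebraMap_apply, mul_comm, ← Algebra.smul_def, mul_one, ← Complex.exp_nat_mul]
    rw [← modelVec_add_smul_modelGenS a hd 1 (fun i ↦ a i / d) (modelGenS a d none)]
    · congr 2
      ring
    · intro l
      simp only [modelGenS, modelGen, one_mul]
      exact_mod_cast (Nat.mod_add_div (a l) d).symm

/-! ### The model as a quotient by a finite group -/

section Invariants

open MvPolynomial

variable {n : ℕ} (a : Fin n → ℕ) (d : ℕ)

lemma modelSemigroup_nonneg (s : modelSemigroup a d) : 0 ≤ s.1 :=
  nonneg_of_mem_latticeCone (modelGen_nonneg a d) s.2.2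

/-- The inclusion of the semigroup into `ℕ^n`. -/
def modelExponent : modelSemigroup a d →+ (Fin n →₀ ℕ) where
  toFun s := Finsupp.equivFunOnFinite.symm fun l ↦ (s.1 l).toNat
  map_zero' := by ext l; simp
  map_add' s t := by
    ext l
    simp [Int.toNat_add (modelSemigroup_nonneg a d s l) (modelSemigroup_nonneg a d t l)]

lemma coe_modelExponent (s : modelSemigroup a d) (l : Fin n) : (modelExponent a d s l : ℤ) = s.1 l :=
  Int.toNat_of_nonneg (modelSemigroup_nonneg a d s l)

lemma modelExponent_injective : Function.Injective (modelExponent a d) := by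
  intro s t h
  ext l
  rw [← coe_modelExponent, ← coe_modelExponent, h]

/-- The inclusion of the semigroup ring into the polynomial ring. -/
def modelToPolynomial : ModelSemigroupRing a d →ₐ[ℂ] MvPolynomial (Fin n) ℂ :=
  AddMonoidAlgebra.mapDomainAlgHom ℂ ℂ (modelExponent a d)

lemma modelToPolynomial_injective : Function.Injective (modelToPolynomial a d) :=
  AddMonoidAlgebra.mapDomain_injective (modelExponent_injective a d)

lemma modelToPolynomial_single (s : modelSemigroup a d) (z : ℂ) :
    modelToPolynomial a d (AddMonoidAlgebra.single s z) = monomial (modelExponent a d s) z :=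
  AddMonoidAlgebra.mapDomain_single

/-- The group of the `t ∈ (ℂ^*)^n` with `t_i^d = 1` and `t_1^{a_1} ⋯ t_n^{a_n} = 1`. -/
def rootGroup : Subgroup (Fin n → ℂˣ) where
  carrier := {t | (∀ i, t i ^ d = 1) ∧ ∏ i, t i ^ a i = 1}
  mul_mem' {s t} hs ht := ⟨fun i ↦ by simp [mul_pow, hs.1, ht.1], by
    simp [mul_pow, Finset.prod_mul_distrib, hs.2, ht.2]⟩
  one_mem' := by simp
  inv_mem' {s} hs := ⟨fun i ↦ by simp [hs.1], by simp [hs.2]⟩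

/-- The diagonal embedding of `(ℂ^*)^n` into the general linear group. -/
def diagonalHom (n : ℕ) : (Fin n → ℂˣ) →* GL (Fin n) ℂ :=
  (Units.map (Matrix.diagonalRingHom (Fin n) ℂ : (Fin n → ℂ) →* Matrix (Fin n) (Fin n) ℂ)).comp
    (MulEquiv.piUnits (M := fun _ : Fin n ↦ ℂ)).symm.toMonoidHom

lemma diagonalHom_apply (t : Fin n → ℂˣ) (i j : Fin n) :
    (diagonalHom n t).val i j = if i = j then (t i : ℂ) else 0 := by
  change Matrix.diagonal (fun i ↦ (t i : ℂ)) i j = _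
  rw [Matrix.diagonal_apply]

/-- The finite group of diagonal matrices whose quotient is the spectrum of the semigroup ring. -/
def quotientGroup : Subgroup (GL (Fin n) ℂ) := (rootGroup a d).map (diagonalHom n)

variable {d} in
lemma finite_quotientGroup (hd : 0 < d) : Finite (quotientGroup a d) := by
  have : NeZero d := ⟨hd.ne'⟩
  have h1 : Finite (rootGroup a d) := by
    refine Finite.of_injective (fun (t : rootGroup a d) (i : Fin n) ↦
      (⟨t.1 i, (mem_rootsOfUnity d _).2 (t.2.1 i)⟩ : rootsOfUnity d ℂ)) fun s t h ↦ ?_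
    ext i
    exact congrArg (fun k ↦ ((k i).1 : ℂ)) h
  exact Set.Finite.image _ (Set.toFinite (rootGroup a d : Set (Fin n → ℂˣ)))

/-- Monomials are eigenvectors of diagonal matrices. -/
lemma aeval_diagonal_monomial (t : Fin n → ℂˣ) (m : Fin n →₀ ℕ) (z : ℂ) :
    aeval (fun i ↦ ∑ j, C ((diagonalHom n t).val i j) * (X j : MvPolynomial (Fin n) ℂ)) (monomial m z) =
      monomial m ((∏ i, (t i : ℂ) ^ m i) * z) := by
  have h1 (i : Fin n) : ∑ j, C ((diagonalHom n t).val i j) * (X j : MvPolynomial (Fin n) ℂ) =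
      C (t i : ℂ) * X i := by
    rw [Finset.sum_eq_single i]
    · rw [diagonalHom_apply, if_pos rfl]
    · intro j _ hj
      rw [diagonalHom_apply, if_neg hj.symm, C_0, zero_mul]
    · simp
  simp only [h1]
  rw [aeval_monomial, Finsupp.prod_fintype _ _ (fun i ↦ pow_zero _)]
  simp only [mul_pow, Finset.prod_mul_distrib]
  rw [monomial_eq, Finsupp.prod_fintype _ _ (fun i ↦ pow_zero _)]
  simp only [← map_pow, ← map_prod, C_mul, MvPolynomial.algebraMap_eq]
  ring

lemma coeff_aeval_diagonal (t : Fin n → ℂˣ) (m : Fin n →₀ ℕ) (f : MvPolynomial (Fin n) ℂ) :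
    coeff m (aeval (fun i ↦ ∑ j, C ((diagonalHom n t).val i j) * (X j : MvPolynomial (Fin n) ℂ)) f) =
      (∏ i, (t i : ℂ) ^ m i) * coeff m f := by
  classical
  induction f using MvPolynomial.induction_on' with
  | monomial k z =>
    rw [aeval_diagonal_monomial, coeff_monomial, coeff_monomial]
    split_ifs with h
    · rw [h]
    · rw [mul_zero]
  | add f g hf hg => rw [map_add, coeff_add, hf, hg, coeff_add, mul_add]

/-- A polynomial is invariant if all its monomials are. -/
lemma mem_invariants_iff (f : MvPolynomial (Fin n) ℂ) : f ∈ invariants (quotientGroup a d) ↔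
    ∀ t ∈ rootGroup a d, ∀ m, coeff m f ≠ 0 → ∏ i, (t i : ℂ) ^ m i = 1 := by
  simp only [invariants, Algebra.mem_iInf, AlgHom.mem_equalizer, quotientGroup, Subgroup.mem_map,
    forall_exists_index, and_imp, forall_apply_eq_imp_iff₂, AlgHom.id_apply]
  refine forall₂_congr fun t ht ↦ ?_
  rw [MvPolynomial.ext_iff]
  refine forall_congr' fun m ↦ ?_
  rw [coeff_aeval_diagonal]
  constructor
  · intro h h0
    exact mul_right_cancel₀ h0 (h.trans (one_mul _).symm)
  · intro h
    by_cases h0 : coeff m f = 0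
    · rw [h0, mul_zero]
    · rw [h h0, one_mul]

variable {d} in
/-- The characters of `ℤ^n` that are trivial on the lattice separate the lattice from its
complement. -/
lemma mem_modelLattice_of_forall_rootGroup (hd : 0 < d) (m : Fin n → ℤ)
    (h : ∀ t ∈ rootGroup a d, ∏ i, t i ^ m i = 1) : m ∈ modelLattice a d := by
  classical
  let Q := (Fin n → ℤ) ⧸ modelLattice a d
  have hfin : Finite Q := by
    let f : (Fin n → Fin d) → Q := fun r ↦ QuotientAddGroup.mk fun i ↦ ((r i : ℕ) : ℤ)
    refine Finite.of_surjective f fun q ↦ ?_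
    obtain ⟨v, rfl⟩ := QuotientAddGroup.mk_surjective q
    have hd' : (0 : ℤ) < d := by exact_mod_cast hd
    refine ⟨fun i ↦ ⟨(v i % d).toNat, ?_⟩, ?_⟩
    · have := Int.emod_lt_of_pos (v i) hd'
      have := Int.emod_nonneg (v i) hd'.ne'
      omega
    · rw [QuotientAddGroup.eq, mem_modelLattice_iff a hd]
      refine ⟨0, fun l ↦ ?_⟩
      have h0 := Int.emod_nonneg (v l) hd'.ne'
      simp only [Pi.add_apply, Pi.neg_apply, Int.toNat_of_nonneg h0]
      refine ⟨v l / d, ?_⟩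
      have := Int.emod_add_mul_ediv (v l) d
      push_cast
      linarith
  by_contra hm
  have hne : (Multiplicative.ofAdd (QuotientAddGroup.mk m : Q)) ≠ 1 := by
    rw [Ne, ofAdd_eq_one, QuotientAddGroup.eq_zero_iff]
    exact hm
  have : NeZero (Monoid.exponent (Multiplicative Q)) := ⟨Monoid.exponent_ne_zero_of_finite⟩
  -- `ℤ^n / Λ` is finite, so a character separates `m` from `Λ`; its values at the unit vectors form an
  -- element of the root group
  obtain ⟨φ, hφ⟩ := CommGroup.exists_apply_ne_one_of_hasEnoughRootsOfUnity (Multiplicative Q) ℂ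
    hne
  let π : (Fin n → ℤ) → ℂˣ := fun v ↦ φ (Multiplicative.ofAdd (QuotientAddGroup.mk v : Q))
  have hadd (v w) : π (v + w) = π v * π w := by
    simp only [π, QuotientAddGroup.mk_add, ofAdd_add, map_mul]
  have hzero : π 0 = 1 := by simp [π]
  have hker (v) (hv : v ∈ modelLattice a d) : π v = 1 := by
    have : (QuotientAddGroup.mk v : Q) = 0 := (QuotientAddGroup.eq_zero_iff v).2 hv
    simp [π, this]
  let πh : Multiplicative (Fin n → ℤ) →* ℂˣ :=
    { toFun := fun v ↦ π v.toAdd, map_one' := hzero, map_mul' := fun v w ↦ hadd _ _ }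
  have hprod (v : Fin n → ℤ) : π v = ∏ i, π (Pi.single i 1) ^ v i := by
    have h1 : Multiplicative.ofAdd v = ∏ i, (Multiplicative.ofAdd (Pi.single i 1 : Fin n → ℤ)) ^ v i := by
      apply Multiplicative.toAdd.injective
      ext l
      simp [toAdd_prod, Finset.sum_apply, Pi.single_apply]
    have := congrArg πh h1
    rw [map_prod] at this
    simp only [map_zpow] at this
    exact this
  apply hφ
  change π m = 1
  rw [hprod]
  refine h _ ⟨fun i ↦ ?_, ?_⟩
  · have h1 := hker _ (AddSubgroup.subset_closure ⟨some i, rfl⟩ : modelGen a d (some i) ∈ modelLattice a d)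
    rw [hprod, Finset.prod_eq_single i] at h1
    · simpa [modelGen] using h1
    · intro j _ hj
      simp [modelGen, Pi.single_eq_of_ne hj]
    · simp
  · have h1 := hker _ (AddSubgroup.subset_closure ⟨none, rfl⟩ : modelGen a d none ∈ modelLattice a d)
    rw [hprod] at h1
    simpa [modelGen] using h1

variable {d} in
/-- The semigroup ring is the ring of invariants of a finite group of diagonal matrices. -/
lemma range_modelToPolynomial (hd : 0 < d) :
    (modelToPolynomial a d).range = invariants (quotientGroup a d) := by
  classical
  ext f
  rw [mem_invariants_iff]
  constructor
  · rintro ⟨f, rfl⟩ t ht m hm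
    have hs (s : modelSemigroup a d) : ∏ i, (t i : ℂ) ^ modelExponent a d s i = 1 := by
      have h1 : ∀ v ∈ modelLattice a d, ∏ i, t i ^ v i = 1 := by
        intro v hv
        induction hv using AddSubgroup.closure_induction with
        | mem v hv =>
          obtain ⟨k, rfl⟩ := hv
          rcases k with _ | i
          · simpa [modelGen] using ht.2
          · rw [Finset.prod_eq_single i]
            · simpa [modelGen] using ht.1 i
            · intro j _ hj
              simp [modelGen, Pi.single_eq_of_ne hj]
            · simp
        | zero => simp
        | add v w _ _ hv hw => simp [zpow_add, Finset.prod_mul_distrib, hv, hw]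
        | neg v _ hv => simp [hv]
      have h2 := congrArg Units.val (h1 s.1 s.2.1)
      simp only [← coe_modelExponent, zpow_natCast, Units.coe_prod, Units.val_pow_eq_pow_val,
        Units.val_one] at h2
      exact h2
    have h2 : ∀ f : ModelSemigroupRing a d, coeff m (modelToPolynomial a d f) ≠ 0 →
        ∃ s, modelExponent a d s = m := by
      intro f
      induction f using AddMonoidAlgebra.induction_linear with
      | zero => simp
      | add f g hf hg =>
        intro h
        rw [map_add, coeff_add] at h
        by_contra h'
        exact h (by rw [not_not.1 fun h ↦ h' (hf h), not_not.1 fun h ↦ h' (hg h), add_zero])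
      | single s z =>
        intro h
        rw [modelToPolynomial_single, coeff_monomial] at h
        exact ⟨s, by by_contra h'; exact h (if_neg h')⟩
    obtain ⟨s, rfl⟩ := h2 f hm
    exact hs s
  · intro h
    rw [f.as_sum]
    refine sum_mem fun m hm ↦ ?_
    have h1 : (fun i ↦ (m i : ℤ)) ∈ modelLattice a d := by
      refine mem_modelLattice_of_forall_rootGroup a hd _ fun t ht ↦ Units.ext ?_
      simpa using h t ht m (mem_support_iff.1 hm)
    let s : modelSemigroup a d := ⟨fun i ↦ (m i : ℤ), (mem_modelSemigroup_iff hd _).2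
      ⟨fun i ↦ Int.natCast_nonneg _, (mem_modelLattice_iff a hd _).1 h1⟩⟩
    refine ⟨AddMonoidAlgebra.single s (coeff m f), ?_⟩
    change modelToPolynomial a d _ = _
    rw [modelToPolynomial_single]
    congr 1
    ext i
    simp [modelExponent, s]

/-- The semigroup ring is isomorphic to a ring of invariants. -/
def modelSemigroupRingEquiv (hd : 0 < d) : ModelSemigroupRing a d ≃ₐ[ℂ] invariants (quotientGroup a d) :=
  (AlgEquiv.ofInjective _ (modelToPolynomial_injective a d)).trans
    (Subalgebra.equivOfEq _ _ (range_modelToPolynomial a hd))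

variable {d} in
/-- The spectrum of the semigroup ring is globally a quotient of affine space by a finite group. -/
lemma hasFiniteQuotientSingularities_model (hd : 0 < d) :
    HasFiniteQuotientSingularities (specC (ModelSemigroupRing a d)) := by
  intro x
  refine ⟨n, quotientGroup a d, finite_quotientGroup a hd, ?_⟩
  let e := modelSemigroupRingEquiv a d hd
  have h1 : IsIso (specCMap e.symm.toAlgHom).left := by
    have h2 := e.symm.toRingEquiv.toCommRingCatIso.isIso_hom
    change IsIso (Spec.map e.symm.toRingEquiv.toCommRingCatIso.hom)
    infer_instance
  exact ⟨_, LocallyAnalyticallyIso.of_isOpenImmersion (specCMap e.symm.toAlgHom) x⟩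

end Invariants

/-! ### Actions from coactions -/

section Action

open MonoidalCategory MonObj Functor.LaxMonoidal

universe v₁ u₁ v₂ u₂
variable {C : Type u₁} [Category.{v₁} C] [MonoidalCategory C] {D : Type u₂} [Category.{v₂} D]
  [MonoidalCategory D] (F : C ⥤ D) [F.LaxMonoidal] (M X : C) [MonObj M] (act : M ⊗ X ⟶ X)

open scoped Obj in
/-- A lax monoidal functor preserves the unit axiom of an action. -/
lemma map_act_one (h : η[M] ▷ X ≫ act = (λ_ X).hom) :
    η[F.obj M] ▷ F.obj X ≫ Functor.LaxMonoidal.μ F M X ≫ F.map act = (λ_ (F.obj X)).hom := by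
  rw [Functor.obj.η_def, comp_whiskerRight, Category.assoc, μ_natural_left_assoc, ← F.map_comp, h,
    Functor.LaxMonoidal.left_unitality]

open scoped Obj in
/-- A lax monoidal functor preserves the associativity axiom of an action. -/
lemma map_act_mul (h : μ[M] ▷ X ≫ act = (α_ M M X).hom ≫ M ◁ act ≫ act) :
    μ[F.obj M] ▷ F.obj X ≫ Functor.LaxMonoidal.μ F M X ≫ F.map act =
      (α_ _ _ _).hom ≫ F.obj M ◁ (Functor.LaxMonoidal.μ F M X ≫ F.map act) ≫ Functor.LaxMonoidal.μ F M X ≫ F.map act := by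
  rw [Functor.obj.μ_def, comp_whiskerRight, Category.assoc, μ_natural_left_assoc, ← F.map_comp, h,
    MonoidalCategory.whiskerLeft_comp, Category.assoc, μ_natural_right_assoc]
  simp only [Functor.map_comp]
  rw [Functor.LaxMonoidal.associativity_assoc]

open scoped Obj in
/-- A lax monoidal functor preserves the equivariance of a map from a monoid to an object it acts on. -/
lemma map_act_comp (j : M ⟶ X) (h : M ◁ j ≫ act = μ[M] ≫ j) :
    F.obj M ◁ F.map j ≫ Functor.LaxMonoidal.μ F M X ≫ F.map act = μ[F.obj M] ≫ F.map j := by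
  rw [Functor.obj.μ_def, Category.assoc, μ_natural_right_assoc, ← F.map_comp, h, F.map_comp]

end Action

open scoped MonoidalCategory MonObj TensorProduct in
/-- A coaction `ρ` of a Hopf algebra `M` on an algebra `A`, with an equivariant homomorphism `j : A → M`,
gives an action of the group scheme `Spec M` on `Spec A`, with an equivariant morphism
`Spec M → Spec A`: the spectrum is a monoidal functor on the opposite category of algebras. -/
lemma exists_action_of_coaction {R M A : CommRingCat.{0}} [HopfAlgebra R M] [Algebra R A]
    (ρ : A →ₐ[R] M ⊗[R] A) (j : A →ₐ[R] M)
    (h₁ : (Algebra.TensorProduct.map (Bialgebra.counitAlgHom R M) (.id R A)).comp ρ =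
      Algebra.TensorProduct.includeRight)
    (h₂ : (Algebra.TensorProduct.map (Bialgebra.comulAlgHom R M) (.id R A)).comp ρ =
      ((Algebra.TensorProduct.assoc R R R _ _ _).symm.toAlgHom.comp
        (Algebra.TensorProduct.map (.id R _) ρ)).comp ρ)
    (h₃ : (Algebra.TensorProduct.map (.id R _) j).comp ρ = (Bialgebra.comulAlgHom R M).comp j) :
    ∃ (j' : (Spec M).asOver (Spec R) ⟶ (Spec A).asOver (Spec R))
      (act : (Spec M).asOver (Spec R) ⊗ (Spec A).asOver (Spec R) ⟶ (Spec A).asOver (Spec R)),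
    j'.left = Spec.map (CommRingCat.ofHom j.toRingHom) ∧
    η[(Spec M).asOver (Spec R)] ▷ (Spec A).asOver (Spec R) ≫ act =
      (λ_ ((Spec A).asOver (Spec R))).hom ∧
    μ[(Spec M).asOver (Spec R)] ▷ (Spec A).asOver (Spec R) ≫ act =
      (α_ _ _ _).hom ≫ (Spec M).asOver (Spec R) ◁ act ≫ act ∧
    (Spec M).asOver (Spec R) ◁ j' ≫ act = μ[(Spec M).asOver (Spec R)] ≫ j' := by
  let N : (CommBialgCat R)ᵒᵖ := .op (.of R M)
  let N' : Mon (CommAlgCat R)ᵒᵖ := (commBialgCatEquivComonCommAlgCat R).functor.leftOp.obj N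
  let X : (CommAlgCat R)ᵒᵖ := .op (.of R A)
  let act : N'.X ⊗ X ⟶ X := (CommAlgCat.ofHom ρ).op
  let k : N'.X ⟶ X := (CommAlgCat.ofHom j).op
  have e₁ : η[N'.X] ▷ X ≫ act = (λ_ X).hom := by
    apply Quiver.Hom.unop_inj
    ext x
    exact congrArg (fun k ↦ k x) h₁
  have e₂ : μ[N'.X] ▷ X ≫ act = (α_ N'.X N'.X X).hom ≫ N'.X ◁ act ≫ act := by
    apply Quiver.Hom.unop_inj
    ext x
    exact congrArg (fun k ↦ k x) h₂
  have e₃ : N'.X ◁ k ≫ act = μ[N'.X] ≫ k := by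
    apply Quiver.Hom.unop_inj
    ext x
    exact congrArg (fun k ↦ k x) h₃
  exact ⟨(algSpec R).map k, Functor.LaxMonoidal.μ (algSpec R) N'.X X ≫ (algSpec R).map act, rfl,
    map_act_one (algSpec R) N'.X X act e₁, map_act_mul (algSpec R) N'.X X act e₂,
    map_act_comp (algSpec R) N'.X X act k e₃⟩

/-! ### The model as a toric variety -/

/-- A subring of an integrally closed domain that contains every quotient of two of its elements that
lies in the larger ring is integrally closed. -/
lemma isIntegrallyClosed_of_injective {A B : Type*} [CommRing A] [CommRing B] [IsDomain A] [IsDomain B]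
    [IsIntegrallyClosed B] (f : A →+* B) (hf : Function.Injective f)
    (h : ∀ (b : B) (q : A), q ≠ 0 → b * f q ∈ f.range → b ∈ f.range) : IsIntegrallyClosed A := by
  rw [isIntegrallyClosed_iff (FractionRing A)]
  intro x hx
  obtain ⟨p, q, hq, rfl⟩ := IsFractionRing.div_surjective (A := A) x
  have hq0 : q ≠ 0 := nonZeroDivisors.ne_zero hq
  let F : FractionRing A →+* FractionRing B := IsFractionRing.map hf
  have hF (r : A) : F (algebraMap A _ r) = algebraMap B _ (f r) := IsLocalization.map_eq _ r
  have h1 : IsIntegral B (F (algebraMap A _ p / algebraMap A _ q)) :=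
    hx.map_of_comp_eq f F (by ext r; exact (hF r).symm)
  obtain ⟨b, hb⟩ := IsIntegrallyClosed.isIntegral_iff.1 h1
  have h2 : b * f q = f p := by
    apply IsFractionRing.injective B (FractionRing B)
    have h3 : algebraMap B (FractionRing B) (f q) ≠ 0 := by
      rw [Ne, IsFractionRing.to_map_eq_zero_iff, map_eq_zero_iff f hf]
      exact hq0
    rw [map_mul, hb, map_div₀, hF, hF, div_mul_cancel₀ _ h3]
  obtain ⟨y, rfl⟩ := h b q hq0 ⟨p, h2.symm⟩
  refine ⟨y, ?_⟩
  have h3 : algebraMap A (FractionRing A) q ≠ 0 := by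
    rw [Ne, IsFractionRing.to_map_eq_zero_iff]
    exact hq0
  rw [eq_div_iff h3, ← map_mul]
  congr 1
  exact hf (by rw [map_mul, h2])

/-- If every element of the group `G` is moved into the semigroup `S` by a multiple of `δ`, then the group
ring of `G` is the localization of the semigroup ring of `S` at the monomial of `δ`. -/
lemma isLocalization_away_mapDomain {S G : Type*} [AddCommMonoid S] [AddCommGroup G] (f : S →+ G)
    (hf : Function.Injective f) (δ : S) (hδ : ∀ t : G, ∃ (N : ℕ) (s : S), f s = t + N • f δ) :
    letI := (AddMonoidAlgebra.mapDomainAlgHom ℂ ℂ f).toRingHom.toAlgebra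
    IsLocalization.Away (AddMonoidAlgebra.single δ 1 : AddMonoidAlgebra ℂ S) (AddMonoidAlgebra ℂ G) := by
  let _ := (AddMonoidAlgebra.mapDomainAlgHom ℂ ℂ f).toRingHom.toAlgebra
  have hs (s : S) (z : ℂ) : algebraMap (AddMonoidAlgebra ℂ S) (AddMonoidAlgebra ℂ G) (.single s z) =
      .single (f s) z := AddMonoidAlgebra.mapDomain_single
  have hpow (N : ℕ) : (AddMonoidAlgebra.single δ 1 : AddMonoidAlgebra ℂ S) ^ N =
      .single (N • δ) 1 := by
    rw [AddMonoidAlgebra.single_pow, one_pow]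
  have hadd (N : ℕ) (x : AddMonoidAlgebra ℂ G) (y : AddMonoidAlgebra ℂ S)
      (h : x * algebraMap _ _ ((.single δ 1 : AddMonoidAlgebra ℂ S) ^ N) = algebraMap _ _ y) (M : ℕ) :
      x * algebraMap _ _ ((.single δ 1 : AddMonoidAlgebra ℂ S) ^ (N + M)) =
        algebraMap _ _ (y * AddMonoidAlgebra.single δ 1 ^ M) := by
    rw [pow_add, map_mul, ← mul_assoc, h, map_mul]
  refine ⟨?_, ?_, ?_⟩
  · rintro ⟨_, N, rfl⟩
    refine .of_mul_eq_one (AddMonoidAlgebra.single (-f (N • δ)) 1) ?_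
    dsimp only
    rw [hpow, hs, AddMonoidAlgebra.single_mul_single, add_neg_cancel, one_mul]
    rfl
  · intro x
    suffices h : ∃ (N : ℕ) (y : AddMonoidAlgebra ℂ S),
        x * algebraMap _ _ ((.single δ 1 : AddMonoidAlgebra ℂ S) ^ N) = algebraMap _ _ y by
      obtain ⟨N, y, h⟩ := h
      exact ⟨(y, ⟨_, N, rfl⟩), h⟩
    induction x using AddMonoidAlgebra.induction_linear with
    | zero => exact ⟨0, 0, by simp⟩
    | add x x' h h' =>
      obtain ⟨N, y, h⟩ := h
      obtain ⟨M, y', h'⟩ := h'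
      refine ⟨N + M, y * AddMonoidAlgebra.single δ 1 ^ M + y' * AddMonoidAlgebra.single δ 1 ^ N, ?_⟩
      rw [add_mul, map_add, ← hadd N x y h M, ← hadd M x' y' h' N, add_comm M N]
    | single t z =>
      obtain ⟨N, s, h⟩ := hδ t
      refine ⟨N, AddMonoidAlgebra.single s z, ?_⟩
      rw [hpow, hs, hs, AddMonoidAlgebra.single_mul_single, mul_one, h, map_nsmul]
  · intro x y h
    exact ⟨1, by rw [AddMonoidAlgebra.mapDomain_injective hf h]⟩

lemma isOpenImmersion_of_isLocalization_away {A B : Type} [CommRing A] [CommRing B] (f : A →+* B) (r : A)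
    (h : letI := f.toAlgebra; IsLocalization.Away r B) :
    IsOpenImmersion (Spec.map (CommRingCat.ofHom f)) := by
  let _ := f.toAlgebra
  have := h
  let e : Localization.Away r ≃ₐ[A] B := IsLocalization.algEquiv (Submonoid.powers r) _ _
  have h1 : CommRingCat.ofHom f = CommRingCat.ofHom (algebraMap A (Localization.Away r)) ≫
      e.toRingEquiv.toCommRingCatIso.hom := by
    ext x
    exact (e.commutes x).symm
  have := e.toRingEquiv.toCommRingCatIso.isIso_hom
  rw [h1, Spec.map_comp]
  infer_instance

lemma isIntegrallyClosed_stalk_Spec (A : Type) [CommRing A] [IsDomain A] [IsIntegrallyClosed A]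
    (x : Spec (CommRingCat.of A)) : IsIntegrallyClosed ((Spec (CommRingCat.of A)).presheaf.stalk x) := by
  have hx : x.asIdeal.IsPrime := PrimeSpectrum.isPrime x
  let k : Algebra A ((Spec (CommRingCat.of A)).presheaf.stalk x) := StructureSheaf.stalkAlgebra A x
  have : IsLocalization.AtPrime ((Spec (CommRingCat.of A)).presheaf.stalk x) x.asIdeal :=
    StructureSheaf.IsLocalization.to_stalk A x
  exact isIntegrallyClosed_of_isLocalization _ x.asIdeal.primeCompl
    (Ideal.primeCompl_le_nonZeroDivisors _)

section Toric

open MvPolynomial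

variable {n : ℕ} (a : Fin n → ℕ) (d : ℕ)

instance : IsDomain (ModelSemigroupRing a d) := (modelToPolynomial_injective a d).isDomain

variable {d}

/-- The semigroup ring is normal: it is a ring of invariants in a polynomial ring, and a quotient of
invariants is invariant. -/
lemma isIntegrallyClosed_modelSemigroupRing (hd : 0 < d) :
    IsIntegrallyClosed (ModelSemigroupRing a d) := by
  refine isIntegrallyClosed_of_injective (modelToPolynomial a d).toRingHom
    (modelToPolynomial_injective a d) fun b q hq ⟨p, hp⟩ ↦ ?_
  have hr (f : MvPolynomial (Fin n) ℂ) : f ∈ (modelToPolynomial a d).toRingHom.range ↔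
      f ∈ invariants (quotientGroup a d) := by
    rw [← range_modelToPolynomial a hd]; rfl
  rw [hr]
  have h1 := (hr _).1 ⟨p, hp⟩
  have h2 := (hr _).1 ⟨q, rfl⟩
  simp only [invariants, Algebra.mem_iInf, AlgHom.mem_equalizer, AlgHom.id_apply] at h1 h2 ⊢
  intro g hg
  have h3 := h1 g hg
  rw [map_mul, h2 g hg] at h3
  exact mul_right_cancel₀ (fun h ↦ hq (modelToPolynomial_injective a d (h.trans (map_zero _).symm))) h3

/-- The semigroup ring is finite over `ℂ[x_1, …, x_n]`, as a factor of an algebra with a cyclic basis. -/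
lemma finiteType_modelSemigroupRing (hd : 0 < d) : Algebra.FiniteType ℂ (ModelSemigroupRing a d) := by
  have hζ := Complex.isPrimitiveRoot_exp d hd.ne'
  have hg0 : 0 < Nat.gcd (Finset.univ.gcd a) d := Nat.gcd_pos_of_pos_right _ hd
  have h1 : Module.Finite (MvPolynomial (Fin n) ℂ)
      (Fin (Nat.gcd (Finset.univ.gcd a) d) → ModelSemigroupRing a d) :=
    ⟨Submodule.fg_def.2 ⟨_, Set.finite_range _, top_le_iff.1 (isCyclicBasis_model a hd hζ).top_le_span⟩⟩
  have h2 : Module.Finite (MvPolynomial (Fin n) ℂ) (ModelSemigroupRing a d) :=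
    Module.Finite.of_surjective (LinearMap.proj ⟨0, hg0⟩ :
      (Fin (Nat.gcd (Finset.univ.gcd a) d) → ModelSemigroupRing a d) →ₗ[MvPolynomial (Fin n) ℂ] _)
      fun x ↦ ⟨fun _ ↦ x, rfl⟩
  exact Algebra.FiniteType.trans (S := MvPolynomial (Fin n) ℂ) inferInstance inferInstance

/-- The lattice has full rank. -/
lemma exists_addEquiv_modelLattice (hd : 0 < d) : Nonempty ((Fin n → ℤ) ≃+ modelLattice a d) := by
  classical
  let Λ : Submodule ℤ (Fin n → ℤ) := AddSubgroup.toIntSubmodule (modelLattice a d)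
  have hd' : (d : ℤ) ≠ 0 := by exact_mod_cast hd.ne'
  let v : Fin n → Λ := fun i ↦ ⟨modelGen a d (some i), AddSubgroup.subset_closure ⟨some i, rfl⟩⟩
  have hv : LinearIndependent ℤ v := by
    rw [Fintype.linearIndependent_iff]
    intro r hr l
    have h1 := congrFun (congrArg Subtype.val hr) l
    simpa [v, modelGen, Finset.sum_apply, Pi.single_apply, hd.ne'] using h1
  have hr : Module.finrank ℤ Λ = n := by
    apply le_antisymm
    · simpa using Submodule.finrank_le Λ
    · simpa using hv.fintype_card_le_finrank
  let b := Module.finBasisOfFinrankEq ℤ Λ hr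
  exact ⟨b.equivFun.symm.toAddEquiv⟩

open scoped TensorProduct in
/-- The torus with character group the lattice acts on the spectrum of the semigroup ring: the
coaction maps the monomial of `s` to the tensor product of the character `s` with this monomial. -/
lemma isToricVariety_model (hd : 0 < d) : IsToricVariety (specC (ModelSemigroupRing a d)) := by
  have hft := finiteType_modelSemigroupRing a hd
  have hic := isIntegrallyClosed_modelSemigroupRing a hd
  refine ⟨?_, ?_, ?_, ?_, ?_, ?_⟩
  · exact inferInstanceAs (AlgebraicGeometry.IsIntegral (Spec (CommRingCat.of (ModelSemigroupRing a d))))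
  · change IsSeparated (Spec.map _)
    infer_instance
  · exact locallyOfFiniteType_specOverSpec (R := CommRingCat.of ℂ) (A := CommRingCat.of (ModelSemigroupRing a d))
  · change QuasiCompact (Spec.map _)
    infer_instance
  · intro x
    exact isIntegrallyClosed_stalk_Spec _ x
  · obtain ⟨e⟩ := exists_addEquiv_modelLattice a hd
    -- in a basis of the lattice the torus is the standard one; `j` is the inclusion of its dense orbit
    let σ : modelSemigroup a d →+ (Fin n → ℤ) := e.symm.toAddMonoidHom.comp
      (AddSubmonoid.inclusion (inf_le_left : modelSemigroup a d ≤ (modelLattice a d).toAddSubmonoid))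
    have hσ : Function.Injective σ := e.symm.injective.comp (AddSubmonoid.inclusion_injective _)
    let j : ModelSemigroupRing a d →ₐ[ℂ] AddMonoidAlgebra ℂ (Fin n → ℤ) :=
      AddMonoidAlgebra.mapDomainAlgHom ℂ ℂ σ
    -- the coaction
    let ρ : ModelSemigroupRing a d →ₐ[ℂ] AddMonoidAlgebra ℂ (Fin n → ℤ) ⊗[ℂ] ModelSemigroupRing a d :=
      AddMonoidAlgebra.lift ℂ _ _
        { toFun s := AddMonoidAlgebra.single (σ s.toAdd) 1 ⊗ₜ AddMonoidAlgebra.single s.toAdd 1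
          map_one' := by
            rw [toAdd_one, map_zero]; rfl
          map_mul' s t := by
            rw [toAdd_mul, map_add, Algebra.TensorProduct.tmul_mul_tmul,
              AddMonoidAlgebra.single_mul_single, AddMonoidAlgebra.single_mul_single, one_mul] }
    have hj (s) : j (.single s 1) = .single (σ s) 1 := AddMonoidAlgebra.mapDomain_single
    have hρ (s) : ρ (.single s 1) = .single (σ s) 1 ⊗ₜ .single s 1 := by
      simp [ρ]
    have hcomul (s : Fin n → ℤ) : Bialgebra.comulAlgHom ℂ (AddMonoidAlgebra ℂ (Fin n → ℤ)) (.single s 1) =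
        .single s 1 ⊗ₜ .single s 1 := by
      simp
    have hcounit (s : Fin n → ℤ) :
        Bialgebra.counitAlgHom ℂ (AddMonoidAlgebra ℂ (Fin n → ℤ)) (.single s 1) = 1 := by
      simp
    have h₁ : (Algebra.TensorProduct.map (Bialgebra.counitAlgHom ℂ (AddMonoidAlgebra ℂ (Fin n → ℤ)))
        (.id ℂ (ModelSemigroupRing a d))).comp ρ = Algebra.TensorProduct.includeRight := by
      refine AddMonoidAlgebra.algHom_ext (fun s ↦ ?_) (Subsingleton.elim _ _)
      rw [AlgHom.comp_apply, hρ, Algebra.TensorProduct.map_tmul, hcounit]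
      rfl
    have h₂ : (Algebra.TensorProduct.map (Bialgebra.comulAlgHom ℂ (AddMonoidAlgebra ℂ (Fin n → ℤ)))
        (.id ℂ (ModelSemigroupRing a d))).comp ρ =
        ((Algebra.TensorProduct.assoc ℂ ℂ ℂ _ _ _).symm.toAlgHom.comp
          (Algebra.TensorProduct.map (.id ℂ _) ρ)).comp ρ := by
      refine AddMonoidAlgebra.algHom_ext (fun s ↦ ?_) (Subsingleton.elim _ _)
      rw [AlgHom.comp_apply, AlgHom.comp_apply, AlgHom.comp_apply, hρ, Algebra.TensorProduct.map_tmul,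
        hcomul, Algebra.TensorProduct.map_tmul, hρ]
      rfl
    have h₃ : (Algebra.TensorProduct.map (.id ℂ _) j).comp ρ =
        (Bialgebra.comulAlgHom ℂ (AddMonoidAlgebra ℂ (Fin n → ℤ))).comp j := by
      refine AddMonoidAlgebra.algHom_ext (fun s ↦ ?_) (Subsingleton.elim _ _)
      rw [AlgHom.comp_apply, AlgHom.comp_apply, hρ, Algebra.TensorProduct.map_tmul, hj, hcomul]
      rfl
    obtain ⟨j', act, hj', e₁, e₂, e₃⟩ := exists_action_of_coaction (R := CommRingCat.of ℂ)
      (M := CommRingCat.of (AddMonoidAlgebra ℂ (Fin n → ℤ)))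
      (A := CommRingCat.of (ModelSemigroupRing a d)) ρ j h₁ h₂ h₃
    refine ⟨n, j', act, ?_, e₁, e₂, e₃⟩
    rw [hj']
    -- the multiples of `(d, …, d)` move every lattice vector into the semigroup
    let δ : modelSemigroup a d := ∑ i, modelGenS a d (some i)
    refine isOpenImmersion_of_isLocalization_away j.toRingHom (AddMonoidAlgebra.single δ 1)
      (isLocalization_away_mapDomain σ hσ δ fun t ↦ ?_)
    have hδ (l) : δ.1 l = d := by
      have := coe_sum_smul_modelGenS (a := a) (d := d) (fun _ ↦ 1) l
      simpa [δ] using this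
    obtain ⟨N, h2⟩ : ∃ N : ℕ, ∀ l, ((e t).1 l).natAbs ≤ N :=
      ⟨∑ l, ((e t).1 l).natAbs, fun l ↦ Finset.single_le_sum (f := fun l ↦ ((e t).1 l).natAbs)
        (fun _ _ ↦ Nat.zero_le _) (Finset.mem_univ l)⟩
    have hN : (e t).1 + N • δ.1 ∈ modelSemigroup a d := by
      have h1 : (e t).1 + N • δ.1 ∈ modelLattice a d :=
        add_mem (e t).2 (nsmul_mem (show δ.1 ∈ modelLattice a d from δ.2.1) N)
      refine (mem_modelSemigroup_iff hd _).2 ⟨fun l ↦ ?_, (mem_modelLattice_iff a hd _).1 h1⟩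
      have h2 := h2 l
      have h3 : (N : ℤ) ≤ N * d := by
        exact_mod_cast Nat.le_mul_of_pos_right N hd
      change (0 : ℤ) ≤ (e t).1 l + N • δ.1 l
      rw [hδ, nsmul_eq_mul]
      omega
    refine ⟨N, ⟨_, hN⟩, ?_⟩
    apply e.injective
    rw [map_add, map_nsmul]
    change e (e.symm _) = _ + _ • e (e.symm _)
    rw [AddEquiv.apply_symm_apply, AddEquiv.apply_symm_apply]
    rfl

end Toric

/-! ### Regular parameters and differentials -/

section Differentials

open TensorProduct IsLocalRing

/-- If `T` is formally smooth over `R`, then an `R`-algebra homomorphism `S → T` that induces an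
isomorphism on differentials is formally étale, by the Jacobi–Zariski sequence. -/
lemma formallyEtale_of_bijective_mapBaseChange (R S T : Type*) [CommRing R] [CommRing S] [CommRing T]
    [Algebra R S] [Algebra R T] [Algebra S T] [IsScalarTower R S T] [Algebra.FormallySmooth R T]
    (h : Function.Bijective (KaehlerDifferential.mapBaseChange R S T)) : Algebra.FormallyEtale S T := by
  rw [Algebra.formallyEtale_iff]
  constructor
  · refine subsingleton_of_forall_eq 0 fun x ↦ ?_
    obtain ⟨y, rfl⟩ := KaehlerDifferential.map_surjective R S T x
    exact (KaehlerDifferential.exact_mapBaseChange_map R S T y).2 (h.2 y)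
  · refine subsingleton_of_forall_eq 0 fun x ↦ ?_
    have h1 : Algebra.H1Cotangent.δ R S T x = 0 :=
      h.1 (((Algebra.H1Cotangent.exact_δ_mapBaseChange R S T _).2 ⟨x, rfl⟩).trans (map_zero _).symm)
    obtain ⟨y, rfl⟩ := (Algebra.H1Cotangent.exact_map_δ R S T x).1 h1
    rw [Subsingleton.elim y 0, map_zero]

variable {S : Type} [CommRing S] [Algebra ℂ S] [IsLocalRing S]

lemma sub_algebraMap_mem_maximalIdeal (ε : S →ₐ[ℂ] ℂ) (f : S) :
    f - algebraMap ℂ S (ε f) ∈ maximalIdeal S := by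
  rw [mem_maximalIdeal, mem_nonunits_iff]
  intro h
  have := h.map ε
  simp at this

/-- The differentials of generators of the maximal ideal at a rational point generate the module of
differentials, by Nakayama's lemma. -/
lemma span_D_eq_top [Module.Finite S Ω[S⁄ℂ]] (ε : S →ₐ[ℂ] ℂ) {ι : Type*} (x : ι → S)
    (hx : Ideal.span (Set.range x) = maximalIdeal S) :
    Submodule.span S (Set.range fun i ↦ KaehlerDifferential.D ℂ S (x i)) = ⊤ := by
  set N := Submodule.span S (Set.range fun i ↦ KaehlerDifferential.D ℂ S (x i))
  refine top_le_iff.1 (Submodule.le_of_le_smul_of_le_jacobson_bot Module.Finite.fg_top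
    (maximalIdeal_le_jacobson _) ?_)
  rw [← KaehlerDifferential.span_range_derivation ℂ S, Submodule.span_le]
  rintro _ ⟨f, rfl⟩
  have h2 : ∀ g ∈ maximalIdeal S, KaehlerDifferential.D ℂ S g ∈
      N ⊔ maximalIdeal S • (⊤ : Submodule S Ω[S⁄ℂ]) := by
    intro g hg
    rw [← hx] at hg
    induction hg using Submodule.span_induction with
    | zero => rw [map_zero]; exact zero_mem _
    | mem g h =>
      obtain ⟨i, rfl⟩ := h
      exact Submodule.mem_sup_left (Submodule.subset_span ⟨i, rfl⟩)
    | add g h hg hh h1 h2 =>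
      rw [map_add]
      exact add_mem h1 h2
    | smul c g hg h1 =>
      rw [smul_eq_mul, Derivation.leibniz]
      exact add_mem (Submodule.smul_mem _ _ h1)
        (Submodule.mem_sup_right (Submodule.smul_mem_smul (hx ▸ hg : g ∈ maximalIdeal S) trivial))
  have h3 := h2 _ (sub_algebraMap_mem_maximalIdeal ε f)
  rw [map_sub, Derivation.map_algebraMap, sub_zero] at h3
  rw [KaehlerDifferential.span_range_derivation]
  exact h3

/-- Regular parameters at a rational point of a smooth variety are étale coordinates. -/
lemma formallyEtale_of_span_eq_maximalIdeal [Algebra.FormallySmooth ℂ S] {n : ℕ}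
    (b : Module.Basis (Fin n) S Ω[S⁄ℂ]) (ε : S →ₐ[ℂ] ℂ)
    [Algebra (MvPolynomial (Fin n) ℂ) S] [IsScalarTower ℂ (MvPolynomial (Fin n) ℂ) S]
    (hx : Ideal.span (Set.range fun i : Fin n ↦ algebraMap (MvPolynomial (Fin n) ℂ) S (.X i)) =
      maximalIdeal S) :
    Algebra.FormallyEtale (MvPolynomial (Fin n) ℂ) S := by
  have : Module.Finite S Ω[S⁄ℂ] := .of_basis b
  apply formallyEtale_of_bijective_mapBaseChange ℂ
  let φ := KaehlerDifferential.mapBaseChange ℂ (MvPolynomial (Fin n) ℂ) S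
  have hsurj : Function.Surjective φ := by
    rw [← LinearMap.range_eq_top, ← top_le_iff, ← span_D_eq_top ε _ hx, Submodule.span_le]
    rintro _ ⟨i, rfl⟩
    exact ⟨1 ⊗ₜ KaehlerDifferential.D ℂ _ (.X i), by
      rw [KaehlerDifferential.mapBaseChange_tmul, one_smul, KaehlerDifferential.map_D]⟩
  let c : Module.Basis (Fin n) S (S ⊗[MvPolynomial (Fin n) ℂ] Ω[MvPolynomial (Fin n) ℂ⁄ℂ]) :=
    (KaehlerDifferential.mvPolynomialBasis ℂ (Fin n)).baseChange S
  have : Module.Finite S (S ⊗[MvPolynomial (Fin n) ℂ] Ω[MvPolynomial (Fin n) ℂ⁄ℂ]) := .of_basis c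
  let e := b.equiv c (Equiv.refl _)
  refine ⟨?_, hsurj⟩
  have h1 := OrzechProperty.injective_of_surjective_endomorphism (e.toLinearMap ∘ₗ φ)
    (e.surjective.comp hsurj)
  exact Function.Injective.of_comp (f := e) (g := φ) h1

/-- The maximal ideal cannot be generated by fewer elements than the rank of the module of differentials. -/
lemma card_le_of_span_eq_maximalIdeal {n k : ℕ} (b : Module.Basis (Fin n) S Ω[S⁄ℂ]) (ε : S →ₐ[ℂ] ℂ)
    (x : Fin k → S) (hx : Ideal.span (Set.range x) = maximalIdeal S) : n ≤ k := by
  have : Module.Finite S Ω[S⁄ℂ] := .of_basis b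
  have h := finrank_range_le_card (R := S) (fun i ↦ KaehlerDifferential.D ℂ S (x i))
  rw [Set.finrank, span_D_eq_top ε x hx, finrank_top, Module.finrank_eq_card_basis b] at h
  simpa using h

lemma finrank_cotangentSpace_le_of_injective {S : Type} [CommRing S] [IsLocalRing S]
    {M : Type*} [AddCommGroup M] [Module S M]
    [Module (ResidueField S) M] [IsScalarTower S (ResidueField S) M] [Module.Finite (ResidueField S) M]
    {I : Ideal S} (hI : I = maximalIdeal S) (f : I.Cotangent →ₗ[S] M) (hf : Function.Injective f) :
    Module.finrank (ResidueField S) (CotangentSpace S) ≤ Module.finrank (ResidueField S) M := by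
  subst hI
  let g : CotangentSpace S →ₗ[ResidueField S] M :=
    LinearMap.extendScalarsOfSurjective (residue_surjective (R := S)) f
  exact LinearMap.finrank_le_finrank_of_injective (f := g) hf

/-- The dimension at a rational point is at most the rank of the module of differentials. -/
lemma ringKrullDim_le_of_basis [IsNoetherianRing S] [Algebra.FormallySmooth ℂ S] {n : ℕ}
    (b : Module.Basis (Fin n) S Ω[S⁄ℂ]) (ε : S →ₐ[ℂ] ℂ) : ringKrullDim S ≤ n := by
  have : Module.Finite S Ω[S⁄ℂ] := .of_basis b
  have : Module.Free S Ω[S⁄ℂ] := .of_basis b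
  have : Algebra.FiniteType ℂ (ResidueField S) := by
    refine .of_surjective (Algebra.ofId ℂ (ResidueField S)) fun r ↦ ?_
    obtain ⟨f, rfl⟩ := residue_surjective r
    refine ⟨ε f, ?_⟩
    have h1 := (residue_eq_zero_iff _).2 (sub_algebraMap_mem_maximalIdeal ε f)
    rw [map_sub, sub_eq_zero] at h1
    exact h1.symm
  have : Algebra.FormallySmooth ℂ (ResidueField S) := Algebra.FormallySmooth.of_perfectField
  -- the dimension is at most that of the cotangent space, which by smoothness embeds into the fibre of the
  -- module of differentials
  refine (ringKrullDim_le_spanFinrank_maximalIdeal S).trans ?_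
  rw [spanFinrank_maximalIdeal_eq_finrank_cotangentSpace]
  have h := finrank_cotangentSpace_le_of_injective ker_residue
    (KaehlerDifferential.kerCotangentToTensor ℂ S (ResidueField S))
    ((Algebra.FormallySmooth.kerCotangentToTensor_injective_iff (residue_surjective (R := S))).2 inferInstance)
  rw [Module.finrank_baseChange, Module.finrank_eq_card_basis b, Fintype.card_fin] at h
  exact_mod_cast h

end Differentials

/-! ### Étale coordinates on a smooth variety -/

lemma le_preimage_top {X Y : Scheme.{0}} (f : X ⟶ Y) (U : X.Opens) : U ≤ f ⁻¹ᵁ ⊤ := fun _ _ ↦ trivial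

/-- The inclusion of the constants into the regular functions on an open subset. -/
def scalarHom (Z : CScheme) (U : Z.left.Opens) : ℂ →+* Γ(Z.left, U) :=
  (Scheme.Hom.appLE Z.hom ⊤ U (le_preimage_top Z.hom U)).hom.comp (Scheme.ΓSpecIso (CommRingCat.of ℂ)).inv.hom

lemma map_comp_scalarHom (Z : CScheme) {U V : Z.left.Opens} (i : V ⟶ U) :
    (Z.left.presheaf.map i.op).hom.comp (scalarHom Z U) = scalarHom Z V := by
  rw [scalarHom, ← RingHom.comp_assoc, ← CommRingCat.hom_comp, Scheme.Hom.appLE_map]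
  rfl

lemma germ_comp_scalarHom {Z : CScheme} {U V : Z.left.Opens} (h : V ≤ U) {z : Z.left} (hz : z ∈ V) :
    (Z.left.presheaf.germ V z hz).hom.comp (scalarHom Z V) =
      (Z.left.presheaf.germ U z (h hz)).hom.comp (scalarHom Z U) := by
  rw [← map_comp_scalarHom Z (homOfLE h), ← RingHom.comp_assoc, ← CommRingCat.hom_comp,
    TopCat.Presheaf.germ_res]

lemma app_comp_scalarHom {Y Z : CScheme} (f : Y ⟶ Z) (U : Z.left.Opens) :
    (f.left.app U).hom.comp (scalarHom Z U) = scalarHom Y (f.left ⁻¹ᵁ U) := by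
  have h := Over.w f
  rw [scalarHom, ← RingHom.comp_assoc, ← CommRingCat.hom_comp, scalarHom, Scheme.Hom.app_eq_appLE,
    Scheme.Hom.appLE_comp_appLE]
  simp only [h]

/-- The value of a constant at a complex point is this constant. -/
lemma stalkEval_germ_scalarHom {Z : CScheme} (p : CPoint Z) {U : Z.left.Opens} (hU : p.pt ∈ U) (c : ℂ) :
    p.stalkEval (Z.left.presheaf.germ U p.pt hU (scalarHom Z U c)) = c := by
  have h1 := congrArg (fun k ↦ k.hom (scalarHom Z U c)) (Scheme.germ_stalkClosedPointTo p.1 U hU)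
  refine h1.trans ?_
  have h2 (W : (Spec (CommRingCat.of ℂ)).Opens) (hW : ⊤ ≤ W) (i : Opposite.op W ⟶ Opposite.op ⊤) (e : W ≤ p.1 ⁻¹ᵁ U) :
      Scheme.Hom.appLE Z.hom ⊤ U (le_preimage_top Z.hom U) ≫ Scheme.Hom.appLE p.1 U W e ≫
        (Spec (CommRingCat.of ℂ)).presheaf.map i = 𝟙 _ := by
    have h3 : p.1 ≫ Z.hom = 𝟙 _ := p.2
    rw [Scheme.Hom.appLE_map, Scheme.Hom.appLE_comp_appLE]
    simp only [h3]
    rw [Scheme.Hom.appLE, Scheme.Hom.id_app]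
    exact (Category.id_comp _).trans ((Spec (CommRingCat.of ℂ)).presheaf.map_id _)
  have h3 := h2 (p.1 ⁻¹ᵁ U) (Scheme.preimage_eq_top_of_closedPoint_mem p.1 hU).ge
    (eqToIso (Scheme.preimage_eq_top_of_closedPoint_mem p.1 hU).symm).op.hom le_rfl
  have h4 := congrArg (fun k ↦ (Scheme.ΓSpecIso (CommRingCat.of ℂ)).hom.hom
    (k.hom ((Scheme.ΓSpecIso (CommRingCat.of ℂ)).inv.hom c))) h3
  have h5 := congrArg (fun k ↦ k.hom c) (Scheme.ΓSpecIso (CommRingCat.of ℂ)).inv_hom_id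
  rw [← Scheme.Hom.app_eq_appLE] at h4
  exact h4.trans h5

/-- The structure morphism of an affine open subset is given by the constants. -/
lemma spec_scalarHom_eq {Z : CScheme} {U : Z.left.Opens} (hU : IsAffineOpen U) :
    hU.fromSpec ≫ Z.hom = Spec.map (CommRingCat.ofHom (scalarHom Z U)) := by
  rw [← IsAffineOpen.SpecMap_appLE_fromSpec Z.hom (isAffineOpen_top _) hU (le_preimage_top Z.hom U),
    IsAffineOpen.fromSpec_top, Scheme.isoSpec_Spec_inv, ← Spec.map_comp]
  rfl

lemma isStandardSmooth_scalarHom {n : ℕ} {Z : CScheme} {U : (Spec (CommRingCat.of ℂ)).Opens} {V : Z.left.Opens}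
    (e : V ≤ Z.hom ⁻¹ᵁ U) {z : Z.left} (hz : z ∈ V)
    (h : RingHom.IsStandardSmoothOfRelativeDimension n (Scheme.Hom.appLE Z.hom U V e).hom) :
    RingHom.IsStandardSmoothOfRelativeDimension n (scalarHom Z V) := by
  have hU : U = ⊤ := by
    have : Subsingleton (Spec (CommRingCat.of ℂ)) := inferInstanceAs (Subsingleton (PrimeSpectrum ℂ))
    refine top_le_iff.1 fun x _ ↦ ?_
    rw [Subsingleton.elim x (Z.hom z)]
    exact e hz
  subst hU
  exact h.comp (.equiv (Scheme.ΓSpecIso (CommRingCat.of ℂ)).symm.commRingCatIsoToRingEquiv)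

/-- Finitely many germs are represented on a common affine neighbourhood. -/
lemma exists_affine_germ_eq {Z : Scheme.{0}} {z : Z} {n : ℕ} (x : Fin n → Z.presheaf.stalk z)
    {W : Z.Opens} (hW : z ∈ W) : ∃ (V : Z.Opens) (_ : IsAffineOpen V) (_ : V ≤ W) (hV : z ∈ V)
      (f : Fin n → Γ(Z, V)), ∀ i, Z.presheaf.germ V z hV (f i) = x i := by
  choose U hU g hg using fun i ↦ TopCat.Presheaf.exists_germ_eq Z.presheaf (x i)
  let W' : Z.Opens := W ⊓ Finset.univ.inf U
  have hz : z ∈ W' := ⟨hW, by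
    have : ∀ s : Finset (Fin n), z ∈ s.inf U := by
      intro s
      induction s using Finset.induction_on with
      | empty => trivial
      | insert i s _ ih => rw [Finset.inf_insert]; exact ⟨hU i, ih⟩
    exact this _⟩
  obtain ⟨_, ⟨V, hV, rfl⟩, hzV, hVW⟩ := Z.isBasis_affineOpens.exists_subset_of_mem_open hz W'.isOpen
  have hi (i) : V ≤ U i := fun v hv ↦
    (Finset.inf_le (Finset.mem_univ i) : Finset.univ.inf U ≤ U i) (hVW hv).2
  refine ⟨V, hV, fun v hv ↦ (hVW hv).1, hzV, fun i ↦ Z.presheaf.map (homOfLE (hi i)).op (g i), fun i ↦ ?_⟩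
  rw [← hg]
  exact TopCat.Presheaf.germ_res_apply _ _ _ _ _

/-- At a complex point of a smooth variety the local ring is formally smooth, and its module of
differentials is free of the expected rank. -/
lemma exists_basis_kaehlerDifferential_stalk {n : ℕ} (Z : CScheme) [SmoothOfRelativeDimension n Z.hom]
    (z : Z.left) [Algebra ℂ (Z.left.presheaf.stalk z)]
    (h : ∀ (U : Z.left.Opens) (hz : z ∈ U), (Z.left.presheaf.germ U z hz).hom.comp (scalarHom Z U) =
      algebraMap ℂ (Z.left.presheaf.stalk z)) :
    Algebra.FormallySmooth ℂ (Z.left.presheaf.stalk z) ∧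
      Nonempty (Module.Basis (Fin n) (Z.left.presheaf.stalk z) Ω[Z.left.presheaf.stalk z⁄ℂ]) := by
  obtain ⟨U, hU, V, hV, hz, e, hstd⟩ :=
    SmoothOfRelativeDimension.exists_isStandardSmoothOfRelativeDimension (n := n) (f := Z.hom) z
  replace hstd := isStandardSmooth_scalarHom e hz hstd
  let S := Z.left.presheaf.stalk z
  let A := Γ(Z.left, V)
  let _ : Algebra ℂ A := (scalarHom Z V).toAlgebra
  let _ : Algebra A S := (Z.left.presheaf.germ V z hz).hom.toAlgebra
  have : IsScalarTower ℂ A S := .of_algebraMap_eq' (h V hz).symm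
  have : Algebra.IsStandardSmoothOfRelativeDimension n ℂ A := hstd
  have : Algebra.IsStandardSmooth ℂ A :=
    Algebra.IsStandardSmoothOfRelativeDimension.isStandardSmooth n (R := ℂ) (S := A)
  have : IsLocalization.AtPrime S (hV.primeIdealOf ⟨z, hz⟩).asIdeal := hV.isLocalization_stalk ⟨z, hz⟩
  have : Algebra.FormallyEtale A S :=
    Algebra.FormallyEtale.of_isLocalization (hV.primeIdealOf ⟨z, hz⟩).asIdeal.primeCompl
  have : Nontrivial A := (algebraMap A S).domain_nontrivial
  have hr : Module.finrank A Ω[A⁄ℂ] = n := by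
    rw [Module.finrank, Algebra.IsStandardSmoothOfRelativeDimension.rank_kaehlerDifferential (R := ℂ) (S := A) n]
    simp
  let b := Module.finBasisOfFinrankEq A Ω[A⁄ℂ] hr
  exact ⟨.comp ℂ A S, ⟨(b.baseChange S).map (KaehlerDifferential.tensorKaehlerEquivOfFormallyEtale ℂ A S)⟩⟩

open MvPolynomial in
/-- Regular parameters at a complex point of a smooth variety extend to étale coordinates on a
neighbourhood. -/
lemma exists_etale_coordinates {n : ℕ} (Z : CScheme) [SmoothOfRelativeDimension n Z.hom]
    (p : CPoint Z) (x : Fin n → Z.left.presheaf.stalk p.pt)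
    (hx : Ideal.span (Set.range x) = IsLocalRing.maximalIdeal _) {W : Z.left.Opens} (hW : p.pt ∈ W) :
    ∃ (V : Z.left.Opens) (_ : IsAffineOpen V) (_ : V ≤ W) (hV : p.pt ∈ V) (f : Fin n → Γ(Z.left, V)),
      (∀ i, Z.left.presheaf.germ V p.pt hV (f i) = x i) ∧
      (eval₂Hom (scalarHom Z V) f).Etale := by
  obtain ⟨U, hU, hUW, hz, g, hg⟩ := exists_affine_germ_eq x hW
  let P := MvPolynomial (Fin n) ℂ
  let S := Z.left.presheaf.stalk p.pt
  let A := Γ(Z.left, U)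
  let _ : Algebra ℂ S := ((Z.left.presheaf.germ U p.pt hz).hom.comp (scalarHom Z U)).toAlgebra
  have hS (V : Z.left.Opens) (hV : p.pt ∈ V) :
      (Z.left.presheaf.germ V p.pt hV).hom.comp (scalarHom Z V) = algebraMap ℂ S := by
    have hUV : p.pt ∈ U ⊓ V := ⟨hz, hV⟩
    exact (germ_comp_scalarHom inf_le_right hUV).symm.trans (germ_comp_scalarHom inf_le_left hUV)
  obtain ⟨hsm, ⟨b⟩⟩ := exists_basis_kaehlerDifferential_stalk (n := n) Z p.pt hS
  let ε : S →ₐ[ℂ] ℂ := ⟨p.stalkEval, fun c ↦ stalkEval_germ_scalarHom p hz c⟩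
  let _ : Algebra ℂ A := (scalarHom Z U).toAlgebra
  let _ : Algebra P A := (eval₂Hom (scalarHom Z U) g).toAlgebra
  have hXA (i) : algebraMap P A (X i) = g i := eval₂Hom_X' _ _ _
  have : IsScalarTower ℂ P A := .of_algebraMap_eq fun c ↦ (eval₂Hom_C (scalarHom Z U) g c).symm
  let _ : Algebra A S := (Z.left.presheaf.germ U p.pt hz).hom.toAlgebra
  let _ : Algebra P S := ((algebraMap A S).comp (algebraMap P A)).toAlgebra
  have : IsScalarTower P A S := .of_algebraMap_eq' rfl
  have : IsScalarTower ℂ A S := .of_algebraMap_eq' rfl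
  have : IsScalarTower ℂ P S := .of_algebraMap_eq fun c ↦ by
    rw [IsScalarTower.algebraMap_apply ℂ A S, IsScalarTower.algebraMap_apply ℂ P A]; rfl
  have hXS (i) : algebraMap P S (X i) = x i := by
    rw [IsScalarTower.algebraMap_apply P A S, hXA]; exact hg i
  have : Algebra.FormallyEtale P S := formallyEtale_of_span_eq_maximalIdeal b ε (by
    rw [show (fun i ↦ algebraMap P S (X i)) = x from funext hXS]
    exact hx)
  have : Smooth Z.hom := SmoothOfRelativeDimension.smooth n Z.hom
  have hft : Algebra.FiniteType ℂ A :=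
    (Scheme.Hom.finiteType_appLE Z.hom (isAffineOpen_top _) hU (le_preimage_top Z.hom U)).comp
      (.of_surjective _ (Scheme.ΓSpecIso (CommRingCat.of ℂ)).symm.commRingCatIsoToRingEquiv.surjective)
  have : Algebra.FiniteType P A := .of_restrictScalars_finiteType ℂ P A
  have : Algebra.FinitePresentation P A := Algebra.FinitePresentation.of_finiteType.1 this
  let q := (hU.primeIdealOf ⟨p.pt, hz⟩).asIdeal
  have : IsLocalization.AtPrime S q := hU.isLocalization_stalk ⟨p.pt, hz⟩
  have : Algebra.IsEtaleAt P q := Algebra.FormallyEtale.of_equiv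
    ((IsLocalization.algEquiv q.primeCompl S (Localization.AtPrime q)).restrictScalars P)
  -- étaleness at the point spreads out to a basic open neighbourhood
  obtain ⟨f, hf, het⟩ := Algebra.exists_etale_of_isEtaleAt (R := P) q
  have hfV : p.pt ∈ Z.left.basicOpen f :=
    (Z.left.mem_basicOpen f p.pt hz).2 (IsLocalization.map_units S (⟨f, hf⟩ : q.primeCompl))
  refine ⟨Z.left.basicOpen f, hU.basicOpen f, (Z.left.basicOpen_le f).trans hUW, hfV,
    fun i ↦ Z.left.presheaf.map (homOfLE (Z.left.basicOpen_le f)).op (g i), fun i ↦ ?_, ?_⟩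
  · rw [← hg]
    exact TopCat.Presheaf.germ_res_apply _ _ _ _ _
  · let A' := Γ(Z.left, Z.left.basicOpen f)
    let ρ : A →+* A' := (Z.left.presheaf.map (homOfLE (Z.left.basicOpen_le f)).op).hom
    let _ : Algebra A A' := ρ.toAlgebra
    let _ : Algebra P A' := (ρ.comp (algebraMap P A)).toAlgebra
    have : IsScalarTower P A A' := .of_algebraMap_eq' rfl
    have : IsLocalization.Away f A' := hU.isLocalization_basicOpen f
    have h1 : Algebra.Etale P A' := Algebra.Etale.of_equiv
      ((IsLocalization.algEquiv (Submonoid.powers f) (Localization.Away f) A').restrictScalars P)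
    have h2 : eval₂Hom (scalarHom Z (Z.left.basicOpen f)) (fun i ↦ ρ (g i)) = algebraMap P A' := by
      refine MvPolynomial.ringHom_ext (fun c ↦ ?_) fun i ↦ ?_
      · rw [eval₂Hom_C, ← map_comp_scalarHom Z (homOfLE (Z.left.basicOpen_le f))]
        exact congrArg ρ (eval₂Hom_C (scalarHom Z U) g c).symm
      · rw [eval₂Hom_X']
        exact congrArg ρ (hXA i).symm
    change (eval₂Hom (scalarHom Z (Z.left.basicOpen f)) (fun i ↦ ρ (g i))).Etale
    rw [h2]
    exact RingHom.etale_algebraMap.2 h1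

/-! ### Total rings of fractions of reduced rings -/

open Polynomial in
/-- A cyclic cover of an integral affine scheme of characteristic zero is reduced if its branch
divisor is not everything. -/
lemma isReduced_adjoinRoot {A : Type*} [CommRing A] [IsDomain A] [CharZero A] {d : ℕ} (hd : 0 < d) {s : A}
    (hs : s ≠ 0) : IsReduced (AdjoinRoot (X ^ d - C s)) := by
  refine ⟨fun z hz ↦ ?_⟩
  obtain ⟨f, rfl⟩ := AdjoinRoot.mk_surjective z
  obtain ⟨k, hk⟩ := hz
  rw [← map_pow, AdjoinRoot.mk_eq_zero] at hk
  rw [AdjoinRoot.mk_eq_zero]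
  let K := FractionRing A
  have hinj : Function.Injective (algebraMap A K) := IsFractionRing.injective A K
  have : CharZero K := charZero_of_injective_algebraMap hinj
  have hmon : (X ^ d - C s).Monic := monic_X_pow_sub_C s hd.ne'
  rw [← map_dvd_map _ hinj hmon]
  have h1 := map_dvd (mapRingHom (algebraMap A K)) hk
  rw [map_pow] at h1
  have h2 : (X ^ d - C (algebraMap A K s)).Separable :=
    separable_X_pow_sub_C _ (by exact_mod_cast hd.ne') ((map_ne_zero_iff _ hinj).2 hs)
  have h3 : Polynomial.map (algebraMap A K) (X ^ d - C s) = X ^ d - C (algebraMap A K s) := by simp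
  rw [h3]
  rw [coe_mapRingHom, h3] at h1
  exact h2.squarefree.isRadical _ _ h1

/-- A criterion for being the total ring of fractions of a reduced Noetherian ring: the ring is
embedded in the product of the residue fields of the minimal primes, and is large enough. -/
lemma isFractionRing_of_minimalPrimes {R T : Type*} [CommRing R] [IsReduced R] [CommRing T] [Algebra R T]
    {ι : Type*} [Finite ι] {κ : ι → Type*} [∀ i, Field (κ i)] (ev : ∀ i, T →+* κ i)
    (hinj : ∀ t, (∀ i, ev i t = 0) → t = 0) (hunit : ∀ t, (∀ i, ev i t ≠ 0) → IsUnit t)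
    (hmin : ∀ i, RingHom.ker ((ev i).comp (algebraMap R T)) ∈ minimalPrimes R)
    (hsurj : ∀ p ∈ minimalPrimes R, ∃ i, RingHom.ker ((ev i).comp (algebraMap R T)) = p)
    (hne : ∀ i j, RingHom.ker ((ev i).comp (algebraMap R T)) =
      RingHom.ker ((ev j).comp (algebraMap R T)) → i = j)
    (hquot : ∀ i (z : κ i), ∃ a b : R, ev i (algebraMap R T b) ≠ 0 ∧
      z * ev i (algebraMap R T b) = ev i (algebraMap R T a)) : IsFractionRing R T := by
  classical
  cases nonempty_fintype ι
  have hprime (i) : (RingHom.ker ((ev i).comp (algebraMap R T))).IsPrime := (hmin i).1.1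
  have hzero (c : R) (hc : ∀ i, ev i (algebraMap R T c) = 0) : c = 0 := by
    have h1 : c ∈ sInf (minimalPrimes R) := by
      rw [Submodule.mem_sInf]
      intro p hp
      obtain ⟨i, rfl⟩ := hsurj p hp
      exact hc i
    rw [show sInf (minimalPrimes R) = nilradical R from Ideal.sInf_minimalPrimes,
      nilradical_eq_zero] at h1
    exact h1
  -- an element that vanishes at all points but `i`
  have hex (i : ι) : ∃ r : R, ev i (algebraMap R T r) ≠ 0 ∧ ∀ j ≠ i, ev j (algebraMap R T r) = 0 := by
    have h1 (j : ι) : ∃ r : R, ev i (algebraMap R T r) ≠ 0 ∧ (j ≠ i → ev j (algebraMap R T r) = 0) := by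
      by_cases hj : j = i
      · exact ⟨1, by simp, fun h ↦ absurd hj h⟩
      · have h2 : ¬ RingHom.ker ((ev j).comp (algebraMap R T)) ≤
            RingHom.ker ((ev i).comp (algebraMap R T)) := fun h ↦
          hj (hne j i (le_antisymm h ((hmin i).2 (hmin j).1 h)))
        obtain ⟨r, hr, hr'⟩ := SetLike.not_le_iff_exists.1 h2
        exact ⟨r, hr', fun _ ↦ hr⟩
    choose r hr hr' using h1
    refine ⟨∏ j, r j, ?_, fun j hj ↦ ?_⟩
    · rw [map_prod, map_prod, Finset.prod_ne_zero_iff]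
      exact fun j _ ↦ hr j
    · rw [map_prod, map_prod]
      exact Finset.prod_eq_zero (Finset.mem_univ j) (hr' j hj)
  choose e he he' using hex
  have hsum (c : ι → R) (i : ι) : ev i (algebraMap R T (∑ j, e j * c j)) =
      ev i (algebraMap R T (e i)) * ev i (algebraMap R T (c i)) := by
    rw [map_sum, map_sum, Finset.sum_eq_single i, map_mul, map_mul]
    · intro j _ hj
      rw [map_mul, map_mul, he' j i hj.symm, zero_mul]
    · exact fun h ↦ absurd (Finset.mem_univ i) h
  refine ⟨?_, ?_, ?_⟩
  · rintro ⟨r, hr⟩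
    refine hunit _ fun i hi ↦ ?_
    exact Set.disjoint_left.1 (Ideal.disjoint_nonZeroDivisors_of_mem_minimalPrimes (hmin i)) hi hr
  · intro t
    choose a b hb hab using fun i ↦ hquot i (ev i t)
    have hB : ∑ j, e j * b j ∈ nonZeroDivisors R := by
      rw [mem_nonZeroDivisors_iff_right]
      intro c hc
      refine hzero c fun i ↦ ?_
      have h1 := congrArg (fun r ↦ ev i (algebraMap R T r)) hc
      simp only [map_mul, hsum, map_zero] at h1
      exact (mul_eq_zero.1 h1).resolve_right (mul_ne_zero (he i) (hb i))
    refine ⟨(∑ j, e j * a j, ⟨_, hB⟩), sub_eq_zero.1 (hinj _ fun i ↦ ?_)⟩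
    rw [map_sub, map_mul, hsum, hsum, ← hab, sub_eq_zero]
    ring
  · intro x y h
    refine ⟨1, ?_⟩
    rw [sub_eq_zero.1 (hzero (x - y) fun i ↦ by rw [map_sub, h, sub_self, map_zero])]

/-! ### Values at the maximal points -/

/-- The pullback of a function to the spectrum of a residue field is its value at the point. -/
lemma fromSpecResidueField_appLE {X : Scheme.{0}} {U : X.Opens} {x : X} (hx : x ∈ U)
    (e : ⊤ ≤ X.fromSpecResidueField x ⁻¹ᵁ U) :
    (X.fromSpecResidueField x).appLE U ⊤ e ≫ (Scheme.ΓSpecIso _).hom = X.evaluation U x hx := by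
  have e' : ⊤ ≤ X.fromSpecStalk x ⁻¹ᵁ U := by
    intro y _
    have h1 : X.fromSpecStalk x y ∈ Set.range (X.fromSpecStalk x) := ⟨y, rfl⟩
    rw [Scheme.range_fromSpecStalk] at h1
    exact h1.mem_open U.2 hx
  have h1 : (X.fromSpecStalk x).appLE U ⊤ e' = X.presheaf.germ U x hx ≫ (Scheme.ΓSpecIso _).inv := by
    rw [Scheme.Hom.appLE, Scheme.fromSpecStalk_app hx, Category.assoc, Category.assoc, ← Functor.map_comp,
      ← op_comp]
    exact congrArg (fun k ↦ X.presheaf.germ U x hx ≫ k) ((congrArg (fun k ↦ (Scheme.ΓSpecIso _).inv ≫ k)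
      (CategoryTheory.Functor.map_id _ _)).trans (Category.comp_id _))
  have h2 : (X.fromSpecResidueField x).appLE U ⊤ e =
      (X.fromSpecStalk x).appLE U ⊤ e' ≫ (Spec.map (X.residue x)).appTop := by
    refine (Scheme.Hom.appLE_comp_appLE (Spec.map (X.residue x)) (X.fromSpecStalk x) U ⊤ ⊤ e' le_top).symm.trans
      (congrArg (fun k ↦ (X.fromSpecStalk x).appLE U ⊤ e' ≫ k) ?_)
    exact (Scheme.Hom.app_eq_appLE (Spec.map (X.residue x)) (U := ⊤)).symm
  rw [h2, h1, Category.assoc, Category.assoc, Scheme.ΓSpecIso_naturality, Iso.inv_hom_id_assoc]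
  rfl

section MaximalPoints

variable {X : Scheme.{0}} {U : X.Opens}

lemma top_le_preimage (x : MaximalPoint X) (hx : x.1 ∈ U) :
    ⊤ ≤ Sigma.ι (fun x : MaximalPoint X ↦ Spec (X.residueField x.1)) x ⁻¹ᵁ (fromMaximalPoints X ⁻¹ᵁ U) := by
  intro s _
  have h1 : fromMaximalPoints X (Sigma.ι (fun x : MaximalPoint X ↦ Spec (X.residueField x.1)) x s) = x.1 := by
    rw [← Scheme.Hom.comp_apply, fromMaximalPoints, Sigma.ι_desc, Scheme.fromSpecResidueField_apply]
  change fromMaximalPoints X _ ∈ U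
  rw [h1]
  exact hx

/-- The value at a maximal point of a section of the disjoint union of the spectra of the residue
fields. -/
def maximalValue (U : X.Opens) (x : {x : MaximalPoint X // x.1 ∈ U}) :
    Γ(∐ fun x : MaximalPoint X ↦ Spec (X.residueField x.1), fromMaximalPoints X ⁻¹ᵁ U) →+*
      X.residueField x.1.1 :=
  ((Sigma.ι (fun x : MaximalPoint X ↦ Spec (X.residueField x.1)) x.1).appLE (fromMaximalPoints X ⁻¹ᵁ U) ⊤
    (top_le_preimage x.1 x.2) ≫ (Scheme.ΓSpecIso _).hom).hom

lemma maximalValue_app (x : {x : MaximalPoint X // x.1 ∈ U}) (r : Γ(X, U)) :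
    maximalValue U x ((fromMaximalPoints X).app U r) = X.evaluation U x.1.1 x.2 r := by
  have h1 : (fromMaximalPoints X).app U ≫ (Sigma.ι (fun x : MaximalPoint X ↦ Spec (X.residueField x.1)) x.1).appLE
      (fromMaximalPoints X ⁻¹ᵁ U) ⊤ (top_le_preimage x.1 x.2) ≫ (Scheme.ΓSpecIso _).hom =
      X.evaluation U x.1.1 x.2 := by
    rw [Scheme.Hom.app_eq_appLE, Scheme.Hom.appLE_comp_appLE_assoc,
      ← fromSpecResidueField_appLE x.2 (fun s _ ↦ by
        change X.fromSpecResidueField x.1.1 s ∈ U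
        rw [Scheme.fromSpecResidueField_apply]
        exact x.2)]
    simp only [fromMaximalPoints, Sigma.ι_desc]
  exact congrArg (fun k ↦ k.hom r) h1

lemma exists_sigma_eq (e : (∐ fun x : MaximalPoint X ↦ Spec (X.residueField x.1) : Scheme.{0})) :
    ∃ x s, Sigma.ι (fun x : MaximalPoint X ↦ Spec (X.residueField x.1)) x s = e :=
  (sigmaOpenCover fun x : MaximalPoint X ↦ Spec (X.residueField x.1)).exists_eq e

/-- Every point of the disjoint union lies on the spectrum of the residue field of a maximal point, and the
germs at it only depend on the value at this maximal point. -/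
lemma exists_appLE_eq_germ {e : (∐ fun x : MaximalPoint X ↦ Spec (X.residueField x.1) : Scheme.{0})}
    (he : e ∈ fromMaximalPoints X ⁻¹ᵁ U) : ∃ (x : {x : MaximalPoint X // x.1 ∈ U})
      (φ : X.residueField x.1.1 →+*
        (∐ fun x : MaximalPoint X ↦ Spec (X.residueField x.1) : Scheme.{0}).presheaf.stalk e),
      ∀ t, (∐ fun x : MaximalPoint X ↦ Spec (X.residueField x.1) : Scheme.{0}).presheaf.germ _ e he t =
        φ (maximalValue U x t) := by
  obtain ⟨x, s, rfl⟩ := exists_sigma_eq e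
  have hx : x.1 ∈ U := by
    have h1 : fromMaximalPoints X (Sigma.ι (fun x : MaximalPoint X ↦ Spec (X.residueField x.1)) x s) = x.1 := by
      rw [← Scheme.Hom.comp_apply, fromMaximalPoints, Sigma.ι_desc, Scheme.fromSpecResidueField_apply]
    rw [← h1]
    exact he
  let j := Sigma.ι (fun x : MaximalPoint X ↦ Spec (X.residueField x.1)) x
  refine ⟨⟨x, hx⟩, ((Scheme.ΓSpecIso _).inv ≫ (Spec (X.residueField x.1)).presheaf.germ ⊤ s trivial ≫
    inv (j.stalkMap s)).hom, fun t ↦ ?_⟩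
  have hs : s ∈ (⊤ : (Spec (X.residueField x.1)).Opens) := trivial
  have hs' : s ∈ j ⁻¹ᵁ (fromMaximalPoints X ⁻¹ᵁ U) := he
  have h3 : j.appLE (fromMaximalPoints X ⁻¹ᵁ U) ⊤ (top_le_preimage x hx) ≫
      (Spec (X.residueField x.1)).presheaf.germ ⊤ s hs =
      j.app (fromMaximalPoints X ⁻¹ᵁ U) ≫ (Spec (X.residueField x.1)).presheaf.germ _ s hs' := by
    rw [Scheme.Hom.appLE, Category.assoc, TopCat.Presheaf.germ_res]
  have h2 : j.appLE (fromMaximalPoints X ⁻¹ᵁ U) ⊤ (top_le_preimage x hx) ≫ (Scheme.ΓSpecIso _).hom ≫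
      (Scheme.ΓSpecIso _).inv ≫ (Spec (X.residueField x.1)).presheaf.germ ⊤ s trivial ≫
        inv (j.stalkMap s) =
      (∐ fun x : MaximalPoint X ↦ Spec (X.residueField x.1) : Scheme.{0}).presheaf.germ _ (j s) he := by
    rw [Iso.hom_inv_id_assoc, ← Category.assoc, IsIso.comp_inv_eq, Scheme.Hom.germ_stalkMap]
    exact h3
  exact (congrArg (fun k ↦ k.hom t) h2).symm

lemma eq_zero_of_maximalValue_eq_zero (t : Γ(∐ fun x : MaximalPoint X ↦ Spec (X.residueField x.1),
    fromMaximalPoints X ⁻¹ᵁ U)) (ht : ∀ x, maximalValue U x t = 0) : t = 0 := by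
  refine TopCat.Presheaf.section_ext
    (∐ fun x : MaximalPoint X ↦ Spec (X.residueField x.1) : Scheme.{0}).sheaf _ t 0 fun e he ↦ ?_
  obtain ⟨x, φ, h⟩ := exists_appLE_eq_germ he
  refine (h t).trans ?_
  rw [ht, map_zero]
  exact (map_zero _).symm

lemma isUnit_of_maximalValue_ne_zero (t : Γ(∐ fun x : MaximalPoint X ↦ Spec (X.residueField x.1),
    fromMaximalPoints X ⁻¹ᵁ U)) (ht : ∀ x, maximalValue U x t ≠ 0) : IsUnit t := by
  refine RingedSpace.isUnit_of_isUnit_germ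
    (∐ fun x : MaximalPoint X ↦ Spec (X.residueField x.1) : Scheme.{0}).toRingedSpace _ t fun e he ↦ ?_
  obtain ⟨x, φ, h⟩ := exists_appLE_eq_germ he
  have h1 : IsUnit (φ (maximalValue U x t)) := (ht x).isUnit.map φ
  rw [← h t] at h1
  exact h1

end MaximalPoints

/-! ### Maximal points of an affine open subset -/

section MaximalPoints

variable {X : Scheme.{0}} {U : X.Opens}

/-- The functions that vanish at a point form the corresponding prime ideal. -/
lemma ker_evaluation (hU : IsAffineOpen U) (x : X) (hx : x ∈ U) :
    RingHom.ker (X.evaluation U x hx).hom = (hU.primeIdealOf ⟨x, hx⟩).asIdeal := by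
  ext r
  rw [RingHom.mem_ker]
  refine (X.evaluation_eq_zero_iff_notMem_basicOpen x hx r).trans ?_
  have h1 : hU.primeIdealOf ⟨x, hx⟩ ∈ hU.fromSpec ⁻¹ᵁ X.basicOpen r ↔ x ∈ X.basicOpen r := by
    change hU.fromSpec (hU.primeIdealOf ⟨x, hx⟩) ∈ X.basicOpen r ↔ _
    rw [hU.fromSpec_primeIdealOf]
  rw [← h1, hU.fromSpec_preimage_basicOpen]
  exact not_not

/-- Maximal points of a scheme correspond to minimal primes on affine open subsets. -/
lemma primeIdealOf_mem_minimalPrimes (hU : IsAffineOpen U) (x : MaximalPoint X) (hx : x.1 ∈ U) :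
    (hU.primeIdealOf ⟨x.1, hx⟩).asIdeal ∈ minimalPrimes Γ(X, U) := by
  refine ⟨⟨(hU.primeIdealOf ⟨x.1, hx⟩).2, bot_le⟩, fun q hq h ↦ ?_⟩
  have h1 : (⟨q, hq.1⟩ : PrimeSpectrum Γ(X, U)) ⤳ hU.primeIdealOf ⟨x.1, hx⟩ :=
    (PrimeSpectrum.le_iff_specializes _ _).1 h
  have h2 := h1.map hU.fromSpec.continuous
  rw [hU.fromSpec_primeIdealOf] at h2
  have h3 : (⟨q, hq.1⟩ : PrimeSpectrum Γ(X, U)) = hU.primeIdealOf ⟨x.1, hx⟩ := by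
    refine hU.fromSpec.isOpenEmbedding.injective ?_
    rw [hU.fromSpec_primeIdealOf]
    exact x.2 _ h2
  exact (congrArg PrimeSpectrum.asIdeal h3).ge

lemma exists_maximalPoint_of_mem_minimalPrimes (hU : IsAffineOpen U) (p : Ideal Γ(X, U))
    (hp : p ∈ minimalPrimes Γ(X, U)) :
    ∃ (x : MaximalPoint X) (hx : x.1 ∈ U), (hU.primeIdealOf ⟨x.1, hx⟩).asIdeal = p := by
  let p' : PrimeSpectrum Γ(X, U) := ⟨p, hp.1.1⟩
  have hx : hU.fromSpec p' ∈ U := by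
    have h1 : hU.fromSpec p' ∈ Set.range hU.fromSpec := ⟨p', rfl⟩
    rwa [hU.range_fromSpec] at h1
  refine ⟨⟨hU.fromSpec p', fun y hy ↦ ?_⟩, hx, ?_⟩
  · have h1 : y ∈ U := hy.mem_open U.2 hx
    obtain ⟨q, rfl⟩ : y ∈ Set.range hU.fromSpec := by rw [hU.range_fromSpec]; exact h1
    have h2 : q ⤳ p' := hU.fromSpec.isOpenEmbedding.isInducing.specializes_iff.1 hy
    have h3 : q.asIdeal ≤ p := (PrimeSpectrum.le_iff_specializes _ _).2 h2
    have h4 : p ≤ q.asIdeal := hp.2 ⟨q.2, bot_le⟩ h3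
    exact congrArg hU.fromSpec (PrimeSpectrum.ext (le_antisymm h3 h4))
  · have h1 : hU.primeIdealOf ⟨hU.fromSpec p', hx⟩ = p' := by
      refine hU.fromSpec.isOpenEmbedding.injective ?_
      rw [hU.fromSpec_primeIdealOf]
    exact congrArg PrimeSpectrum.asIdeal h1

/-- The residue field at a point of an affine open subset consists of the quotients of values of functions. -/
lemma exists_evaluation_mul_eq (hU : IsAffineOpen U) (x : X) (hx : x ∈ U) (z : X.residueField x) :
    ∃ a b : Γ(X, U), X.evaluation U x hx b ≠ 0 ∧ z * X.evaluation U x hx b = X.evaluation U x hx a := by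
  obtain ⟨t, rfl⟩ := X.residue_surjective x z
  let _ : Algebra Γ(X, U) (X.presheaf.stalk x) := TopCat.Presheaf.algebra_section_stalk X.presheaf ⟨x, hx⟩
  have : IsLocalization.AtPrime (X.presheaf.stalk x) (hU.primeIdealOf ⟨x, hx⟩).asIdeal :=
    hU.isLocalization_stalk ⟨x, hx⟩
  obtain ⟨⟨a, b⟩, h⟩ := IsLocalization.surj (hU.primeIdealOf ⟨x, hx⟩).asIdeal.primeCompl t
  refine ⟨a, b, fun hb ↦ b.2 ?_, ?_⟩
  · exact (ker_evaluation hU x hx).le hb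
  · exact (map_mul (X.residue x).hom t _).symm.trans (congrArg (X.residue x).hom h)

/-- Over a reduced affine open subset, the sections of the disjoint union of the spectra of the
residue fields at the maximal points form the total ring of fractions. -/
lemma isFractionRing_fromMaximalPoints [Finite (MaximalPoint X)] (hU : IsAffineOpen U)
    [IsReduced Γ(X, U)] :
    letI := ((fromMaximalPoints X).app U).hom.toAlgebra
    IsFractionRing Γ(X, U) Γ(∐ fun x : MaximalPoint X ↦ Spec (X.residueField x.1),
      fromMaximalPoints X ⁻¹ᵁ U) := by
  let _ := ((fromMaximalPoints X).app U).hom.toAlgebra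
  have hker (x : {x : MaximalPoint X // x.1 ∈ U}) : RingHom.ker ((maximalValue U x).comp (algebraMap Γ(X, U) _)) =
      (hU.primeIdealOf ⟨x.1.1, x.2⟩).asIdeal := by
    rw [← ker_evaluation hU x.1.1 x.2]
    congr 1
    ext r
    exact maximalValue_app x r
  have hval (x : {x : MaximalPoint X // x.1 ∈ U}) (r : Γ(X, U)) :
      maximalValue U x (algebraMap Γ(X, U) _ r) = X.evaluation U x.1.1 x.2 r := maximalValue_app x r
  refine isFractionRing_of_minimalPrimes (fun x : {x : MaximalPoint X // x.1 ∈ U} ↦ maximalValue U x)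
    eq_zero_of_maximalValue_eq_zero isUnit_of_maximalValue_ne_zero (fun x ↦ ?_) (fun p hp ↦ ?_)
    (fun x y h ↦ ?_) fun x z ↦ ?_
  · rw [hker]
    exact primeIdealOf_mem_minimalPrimes hU x.1 x.2
  · obtain ⟨x, hx, h⟩ := exists_maximalPoint_of_mem_minimalPrimes hU p hp
    exact ⟨⟨x, hx⟩, (hker _).trans h⟩
  · rw [hker, hker] at h
    have h1 := congrArg hU.fromSpec (PrimeSpectrum.ext h)
    rw [hU.fromSpec_primeIdealOf, hU.fromSpec_primeIdealOf] at h1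
    exact Subtype.ext (Subtype.ext h1)
  · obtain ⟨a, b, h1, h2⟩ := exists_evaluation_mul_eq hU x.1.1 x.2 z
    refine ⟨a, b, ?_, ?_⟩
    · rw [hval]; exact h1
    · rw [hval, hval]; exact h2

/-- A Noetherian scheme has finitely many maximal points, since these are the generic points of the irreducible
components. -/
lemma finite_maximalPoint [TopologicalSpace.NoetherianSpace X] : Finite (MaximalPoint X) := by
  have h := TopologicalSpace.NoetherianSpace.finite_irreducibleComponents (α := X)
  have : Finite (irreducibleComponents X) := h
  refine Finite.of_injective (β := irreducibleComponents X)
    (fun x ↦ ⟨closure {x.1}, ⟨isIrreducible_singleton.closure, fun s hs hle ↦ ?_⟩⟩) fun x y hxy ↦ ?_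
  · obtain ⟨y, hy⟩ := QuasiSober.sober hs.closure isClosed_closure
    have h1 : y ⤳ x.1 := by
      rw [specializes_iff_mem_closure, hy.def]
      exact subset_closure (hle (subset_closure rfl))
    rw [x.2 y h1] at hy
    rw [hy.def]
    exact subset_closure
  · have h1 : closure {x.1} = closure {y.1} := congrArg Subtype.val hxy
    refine Subtype.ext (y.2 x.1 ?_)
    rw [specializes_iff_mem_closure, h1]
    exact subset_closure rfl

end MaximalPoints

/-! ### Sections of the normalization -/

/-- For a Noetherian scheme the conditions in the definition of the normalization hold, so that it is the
relative normalization in the maximal points. -/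
lemma normalization_eq (X : Scheme.{0}) [IsNoetherian X] :
    ∃ (_ : QuasiCompact (fromMaximalPoints X)) (_ : QuasiSeparated (fromMaximalPoints X)),
      normalization X = Over.mk (fromMaximalPoints X).fromNormalization := by
  have := finite_maximalPoint (X := X)
  have h1 : QuasiCompact (fromMaximalPoints X) := inferInstance
  have h2 : QuasiSeparated (fromMaximalPoints X) := inferInstance
  exact ⟨h1, h2, dif_pos ⟨h1, h2⟩⟩

/-- Over a reduced affine open subset `V`, the normalization is the spectrum of the integral closure of `O(V)`
in its total ring of fractions. -/
lemma exists_isIntegralClosure_normalization (X : Scheme.{0}) [IsNoetherian X] {V : X.Opens}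
    (hV : IsAffineOpen V) [IsReduced Γ(X, V)] : IsAffineOpen ((normalization X).hom ⁻¹ᵁ V) ∧
      ∃ (F : Type) (_ : CommRing F) (_ : Algebra Γ(X, V) F)
        (ψ : Γ((normalization X).left, (normalization X).hom ⁻¹ᵁ V) →+* F),
        IsFractionRing Γ(X, V) F ∧ Function.Injective ψ ∧ (∀ z, IsIntegral Γ(X, V) z ↔ ∃ t, ψ t = z) ∧
        ψ.comp ((normalization X).hom.app V).hom = algebraMap Γ(X, V) F := by
  have := finite_maximalPoint (X := X)
  obtain ⟨_, _, h⟩ := normalization_eq X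
  generalize normalization X = N at h ⊢
  subst h
  refine ⟨hV.preimage (fromMaximalPoints X).fromNormalization, _, _,
    ((fromMaximalPoints X).app V).hom.toAlgebra,
    letI := ((fromMaximalPoints X).app V).hom.toAlgebra
    (Subalgebra.val (integralClosure Γ(X, V) _)).toRingHom.comp
      ((fromMaximalPoints X).normalizationObjIso hV).hom.hom,
      isFractionRing_fromMaximalPoints hV, ?_, ?_, ?_⟩
  · exact Subtype.val_injective.comp
      ((fromMaximalPoints X).normalizationObjIso hV).commRingCatIsoToRingEquiv.injective
  · let _ := ((fromMaximalPoints X).app V).hom.toAlgebra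
    intro z
    refine ⟨fun hz ↦ ?_, ?_⟩
    · obtain ⟨t, ht⟩ := ((fromMaximalPoints X).normalizationObjIso
        hV).commRingCatIsoToRingEquiv.surjective ⟨z, hz⟩
      exact ⟨t, congrArg Subtype.val ht⟩
    · rintro ⟨t, rfl⟩
      exact (((fromMaximalPoints X).normalizationObjIso hV).hom.hom t).2
  · ext r
    have h1 := congrArg (fun k ↦ k.hom r) ((fromMaximalPoints X).fromNormalization_app hV)
    have h2 := congrArg ((fromMaximalPoints X).normalizationObjIso hV).hom.hom h1
    refine (congrArg Subtype.val h2).trans ?_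
    refine (congrArg Subtype.val (RingEquiv.apply_symm_apply
      ((fromMaximalPoints X).normalizationObjIso hV).commRingCatIsoToRingEquiv _)).trans rfl

/-! ### Sections of the cyclic cover -/

lemma fromSpec_appLE_top {Z : Scheme.{0}} {V : Z.Opens} (hV : IsAffineOpen V)
    (e : ⊤ ≤ hV.fromSpec ⁻¹ᵁ V) : hV.fromSpec.appLE V ⊤ e = (Scheme.ΓSpecIso Γ(Z, V)).inv := by
  rw [Scheme.Hom.appLE, hV.fromSpec_app_self, Category.assoc, ← Functor.map_comp]
  exact (congrArg (fun k ↦ (Scheme.ΓSpecIso _).inv ≫ k) (CategoryTheory.Functor.map_id _ _)).trans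
    (Category.comp_id _)

/-- If the preimage of an affine open `V` under `q` is the image of an open immersion of `Spec R`, then its
ring of functions is `R`, compatibly with the map from the functions on `V`. -/
lemma exists_iso_of_preimage_eq_opensRange {X Z : Scheme.{0}} (q : X ⟶ Z) {V : Z.Opens}
    (hV : IsAffineOpen V) {R : CommRingCat.{0}} (φ : Γ(Z, V) ⟶ R) (j : Spec R ⟶ X) [IsOpenImmersion j]
    (h : j ≫ q = Spec.map φ ≫ hV.fromSpec) (hr : q ⁻¹ᵁ V = j.opensRange) :
    IsAffineOpen (q ⁻¹ᵁ V) ∧ ∃ e : R ≅ Γ(X, q ⁻¹ᵁ V), q.app V = φ ≫ e.hom := by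
  refine ⟨hr ▸ isAffineOpen_opensRange j, ?_⟩
  have e1 : ⊤ ≤ j ⁻¹ᵁ (q ⁻¹ᵁ V) := by
    rw [hr]
    intro y _
    exact ⟨y, rfl⟩
  have e2 : ⊤ ≤ hV.fromSpec ⁻¹ᵁ V := hV.fromSpec_preimage_self.ge
  have h1 : q.app V ≫ j.appLE (q ⁻¹ᵁ V) ⊤ e1 ≫ (Scheme.ΓSpecIso R).hom = φ := by
    rw [Scheme.Hom.app_eq_appLE, Scheme.Hom.appLE_comp_appLE_assoc]
    have h3 : (j ≫ q).appLE V ⊤ e1 = hV.fromSpec.appLE V ⊤ e2 ≫ (Spec.map φ).appTop := by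
      have h4 : (j ≫ q).appLE V ⊤ e1 = (Spec.map φ ≫ hV.fromSpec).appLE V ⊤
          (by rw [← h]; exact e1) := by simp only [h]
      refine h4.trans ((Scheme.Hom.appLE_comp_appLE (Spec.map φ) hV.fromSpec V ⊤ ⊤ e2 le_top).symm.trans
        (congrArg (fun k ↦ hV.fromSpec.appLE V ⊤ e2 ≫ k) ?_))
      exact (Scheme.Hom.app_eq_appLE (Spec.map φ) (U := ⊤)).symm
    rw [h3, fromSpec_appLE_top, Category.assoc, Scheme.ΓSpecIso_naturality, Iso.inv_hom_id_assoc]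
  have : IsIso (j.app (q ⁻¹ᵁ V)) := Scheme.Hom.isIso_app _ _ hr.le
  have h5 : IsIso (j.appLE (q ⁻¹ᵁ V) ⊤ e1) := by
    have : homOfLE e1 = (eqToHom (le_antisymm e1 le_top)) := rfl
    rw [Scheme.Hom.appLE, this]
    infer_instance
  refine ⟨(asIso (j.appLE (q ⁻¹ᵁ V) ⊤ e1 ≫ (Scheme.ΓSpecIso R).hom)).symm, ?_⟩
  rw [Iso.symm_hom, Iso.eq_comp_inv]
  exact h1

variable {Z : Scheme.{0}} {L : Z.Modules} {d : ℕ} (s : PowerSection L d)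

/-- Over a framed affine open `U`, the cyclic cover is the spectrum of `O(U)[y]/(y^d - s_U)`. -/
lemma PowerSection.exists_iso_coverSpec (hL : IsLineBundle L) (U : FramedSite L) :
    IsAffineOpen ((s.coverSpec hL).hom ⁻¹ᵁ U.1.toOpens) ∧
      ∃ e : CommRingCat.of (s.Alg U) ≅ Γ((s.coverSpec hL).left, (s.coverSpec hL).hom ⁻¹ᵁ U.1.toOpens),
        (s.coverSpec hL).hom.app U.1.toOpens = CommRingCat.ofHom (AdjoinRoot.of _) ≫ e.hom := by
  have h := Scheme.Cover.RelativeGluingData.ι_toBase (s.gluingData hL) U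
  let j : Spec (CommRingCat.of (s.Alg U)) ⟶ (s.coverSpec hL).left := (s.gluingData hL).cover.f U
  have hj : IsOpenImmersion j := (s.gluingData hL).cover.map_prop U
  refine exists_iso_of_preimage_eq_opensRange (s.coverSpec hL).hom U.1.2
    (CommRingCat.ofHom (AdjoinRoot.of _)) j ?_ ?_
  · refine h.trans ?_
    exact Category.assoc (Spec.map (CommRingCat.ofHom (AdjoinRoot.of _))) U.1.2.isoSpec.inv U.1.toOpens.ι
  · have h1 := (s.gluingData hL).toBase_preimage_eq_opensRange_ι U
    refine Eq.trans ?_ h1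
    congr 1
    exact (Scheme.Opens.opensRange_ι _).symm

/-! ### Sections of the normal cyclic cover -/

/-- Isomorphic rings have the same total ring of fractions. -/
lemma isFractionRing_of_ringEquiv {R R' F : Type*} [CommRing R] [CommRing R'] [CommRing F] [Algebra R F]
    [Algebra R' F] [IsFractionRing R F] (e : R' ≃+* R)
    (h : ∀ r, algebraMap R' F r = algebraMap R F (e r)) : IsFractionRing R' F := by
  have h1 (r : nonZeroDivisors R') : e r ∈ nonZeroDivisors R :=
    (MulEquivClass.map_nonZeroDivisors e).le ⟨r, r.2, rfl⟩
  have h2 (r : nonZeroDivisors R) : e.symm r ∈ nonZeroDivisors R' :=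
    (MulEquivClass.map_nonZeroDivisors e.symm).le ⟨r, r.2, rfl⟩
  refine ⟨⟨fun r ↦ ?_, fun z ↦ ?_, fun {x y} hxy ↦ ?_⟩⟩
  · rw [h]
    exact IsLocalization.map_units F (⟨e r, h1 r⟩ : nonZeroDivisors R)
  · obtain ⟨⟨a, b⟩, hab⟩ := IsLocalization.surj (nonZeroDivisors R) z
    refine ⟨⟨e.symm a, ⟨e.symm b, h2 b⟩⟩, ?_⟩
    rw [h, h]
    simpa using hab
  · rw [h, h] at hxy
    exact ⟨1, by rw [e.injective (IsFractionRing.injective R F hxy)]⟩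

variable {Z : Scheme.{0}} {L : Z.Modules} {d : ℕ} (s : PowerSection L d)

lemma finite_adjoinRoot {A : Type*} [CommRing A] (hd : 0 < d) (s : A) :
    Module.Finite A (AdjoinRoot (Polynomial.X ^ d - Polynomial.C s)) :=
  (AdjoinRoot.powerBasis' (Polynomial.monic_X_pow_sub_C s hd.ne')).finite

lemma iSup_framedSite (hL : IsLineBundle L) : ⨆ U : FramedSite L, U.1.toOpens = ⊤ := by
  refine top_le_iff.1 fun z _ ↦ ?_
  obtain ⟨U, hU⟩ := FramedSite.exists_mem hL z
  exact TopologicalSpace.Opens.mem_iSup.2 ⟨U, hU⟩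

/-- The cyclic cover is finite over the Noetherian base, hence Noetherian. -/
lemma PowerSection.isNoetherian_coverSpec [IsNoetherian Z] (hd : 0 < d) (hL : IsLineBundle L) :
    IsNoetherian (s.coverSpec hL).left := by
  have hX : IsLocallyNoetherian (s.coverSpec hL).left := by
    refine isLocallyNoetherian_of_affine_cover
      (S := fun U : FramedSite L ↦ ⟨(s.coverSpec hL).hom ⁻¹ᵁ U.1.toOpens, (s.exists_iso_coverSpec hL U).1⟩)
      ?_ fun U ↦ ?_
    · have h1 : (⨆ U : FramedSite L, (s.coverSpec hL).hom ⁻¹ᵁ U.1.toOpens) =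
          (s.coverSpec hL).hom ⁻¹ᵁ (⨆ U : FramedSite L, U.1.toOpens) :=
        (Scheme.Hom.preimage_iSup _ _).symm
      refine h1.trans ?_
      rw [iSup_framedSite hL]
      rfl
    · obtain ⟨_, e, _⟩ := s.exists_iso_coverSpec hL U
      have h1 : IsNoetherianRing Γ(Z, U.1.toOpens) :=
        IsLocallyNoetherian.component_noetherian ⟨U.1.toOpens, U.1.2⟩
      have := finite_adjoinRoot hd (s.loc U)
      have : IsNoetherianRing (s.Alg U) := IsNoetherianRing.of_finite Γ(Z, U.1.toOpens) _
      exact isNoetherianRing_of_ringEquiv (s.Alg U) e.commRingCatIsoToRingEquiv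
  have hq : QuasiCompact (s.coverSpec hL).hom := by
    have : IsAffineHom (s.coverSpec hL).hom := isAffineHom_of_forall_exists_isAffineOpen _ fun z ↦ by
      obtain ⟨U, hU⟩ := FramedSite.exists_mem hL z
      exact ⟨U.1.toOpens, hU, U.1.2, (s.exists_iso_coverSpec hL U).1⟩
    infer_instance
  have : CompactSpace (s.coverSpec hL).left := by
    have h1 := QuasiCompact.isCompact_preimage (f := (s.coverSpec hL).hom) Set.univ isOpen_univ isCompact_univ
    exact isCompact_univ_iff.1 h1
  exact {}

/-- Over a framed affine open `U`, the normal cyclic cover is the spectrum of the integral closure of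
`O(U)` in the total ring of fractions of `O(U)[y]/(y^d - s_U)`. -/
lemma PowerSection.exists_isIntegralClosure_cover [IsNoetherian Z] (hd : 0 < d) (hL : IsLineBundle L)
    (U : FramedSite L) [IsReduced (s.Alg U)] :
    IsAffineOpen ((normalCyclicCover hL s).hom ⁻¹ᵁ U.1.toOpens) ∧
      ∃ (F : Type) (_ : CommRing F) (_ : Algebra (s.Alg U) F)
        (ψ : Γ((normalCyclicCover hL s).left, (normalCyclicCover hL s).hom ⁻¹ᵁ U.1.toOpens) →+* F),
        IsFractionRing (s.Alg U) F ∧ Function.Injective ψ ∧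
        (∀ z, IsIntegral (s.Alg U) z ↔ ∃ t, ψ t = z) ∧
        ψ.comp ((normalCyclicCover hL s).hom.app U.1.toOpens).hom =
          (algebraMap (s.Alg U) F).comp (AdjoinRoot.of _) := by
  have := s.isNoetherian_coverSpec hd hL
  obtain ⟨hV, e, he⟩ := s.exists_iso_coverSpec hL U
  let e' := e.commRingCatIsoToRingEquiv
  have : IsReduced Γ((s.coverSpec hL).left, (s.coverSpec hL).hom ⁻¹ᵁ U.1.toOpens) :=
    isReduced_of_injective e'.symm e'.symm.injective
  obtain ⟨haff, F, _, _, ψ, hF, hinj, hint, hψ⟩ :=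
    exists_isIntegralClosure_normalization (s.coverSpec hL).left hV
  refine ⟨haff, F, _, ((algebraMap Γ((s.coverSpec hL).left, (s.coverSpec hL).hom ⁻¹ᵁ U.1.toOpens) F).comp
    (e' : s.Alg U →+* _)).toAlgebra, ψ, ?_, hinj, fun z ↦ ?_, ?_⟩
  · let _ := ((algebraMap Γ((s.coverSpec hL).left, (s.coverSpec hL).hom ⁻¹ᵁ U.1.toOpens) F).comp
      (e' : s.Alg U →+* _)).toAlgebra
    exact isFractionRing_of_ringEquiv e' fun r ↦ rfl
  · refine Iff.trans ?_ (hint z)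
    let A := s.Alg U
    let B : Type := Γ((s.coverSpec hL).left, (s.coverSpec hL).hom ⁻¹ᵁ U.1.toOpens)
    change RingHom.IsIntegralElem ((algebraMap B F).comp (e' : A →+* B)) z ↔
      RingHom.IsIntegralElem (algebraMap B F) z
    refine ⟨fun h ↦ ?_, fun h ↦ ?_⟩
    · exact RingHom.IsIntegralElem.of_comp h
    · obtain ⟨P, hP, hz⟩ := h
      refine ⟨P.map (e'.symm : B →+* A), hP.map _, ?_⟩
      have h3 : ((algebraMap B F).comp (e' : A →+* B)).comp (e'.symm : B →+* A) = algebraMap B F :=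
        RingHom.ext fun x ↦ congrArg (algebraMap B F) (e'.apply_symm_apply x)
      rw [Polynomial.eval₂_map, h3]
      exact hz
  · refine RingHom.ext fun r ↦ ?_
    have h1 := congrArg (fun k ↦ k ((s.coverSpec hL).hom.app U.1.toOpens r)) hψ
    have h2 := congrArg (fun k ↦ k.hom r) he
    exact h1.trans (congrArg (algebraMap Γ((s.coverSpec hL).left, (s.coverSpec hL).hom ⁻¹ᵁ U.1.toOpens) F) h2)

/-! ### The local equation of the branch divisor -/

lemma map_self_apply {Z : Scheme.{0}} (L : Z.Modules) {U : Z.Opens} (h : U ≤ U) (e : Γ(L, U)) :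
    (L.presheaf.map (homOfLE h).op e : Γ(L, U)) = e := by
  have : (homOfLE h).op = 𝟙 _ := rfl
  rw [this, L.presheaf.map_id]
  rfl

/-- The coordinates of a section in two frames differ by a unit. -/
lemma PowerSection.exists_isUnit_coord_mul {Z : Scheme.{0}} {L : Z.Modules} {d : ℕ} (s : PowerSection L d)
    {U : Z.Opens} {e e' : Γ(L, U)} (he : IsFrame L e) (he' : IsFrame L e') :
    ∃ w, IsUnit w ∧ s.coord e' he' * w ^ d = s.coord e he := by
  obtain ⟨w, hw⟩ := (he U le_rfl).2 e'
  obtain ⟨v, hv⟩ := (he' U le_rfl).2 e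
  simp only [map_self_apply] at hw hv
  refine ⟨w, .of_mul_eq_one v ?_, ?_⟩
  · apply FramedSite.smul_injective he
    rw [mul_comm, mul_smul, hw, hv, one_smul]
  · subst hw
    exact s.coord_smul w e he he'

/-- Near a complex point the variety is étale over affine space through given parameters, and the
section is a unit times the given monomial in them. -/
lemma exists_local_equation {n d : ℕ} (Z : CScheme) [IsIntegral Z.left] [SmoothOfRelativeDimension n Z.hom]
    {L : Z.left.Modules} (hL : IsLineBundle L) (s : PowerSection L d) (D : Z.left.IdealSheafData)
    (hD : s.IsDivisorOfZeros D) (p : CPoint Z) (x : Fin n → Z.left.presheaf.stalk p.pt) (a : Fin n → ℕ)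
    (hx : Ideal.span (Set.range x) = IsLocalRing.maximalIdeal _)
    (hc : IsCutOutAt D p.pt (∏ i, x i ^ a i)) :
    ∃ (U : FramedSite L) (hU : p.pt ∈ U.1.toOpens) (f : Fin n → Γ(Z.left, U.1.toOpens)) 
      (u : Γ(Z.left, U.1.toOpens)), (∀ i, Z.left.presheaf.germ _ p.pt hU (f i) = x i) ∧
      (MvPolynomial.eval₂Hom (scalarHom Z U.1.toOpens) f).Etale ∧ IsUnit u ∧
      s.loc U = u * ∏ i, f i ^ a i := by
  -- the germs of the section and of the monomial generate the same ideal, so they differ by a unit; its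
  -- inverse is represented by a section `û`, which is invertible on `D(û)`
  obtain ⟨W, hW⟩ := FramedSite.exists_mem hL p.pt
  have h1 : Ideal.span {Z.left.presheaf.germ _ p.pt hW (s.loc W)} = Ideal.span {∏ i, x i ^ a i} := by
    rw [← hc ⟨W.1.toOpens, W.1.2⟩ hW, hD ⟨W.1.toOpens, W.1.2⟩ W.frame W.isFrame_frame, Ideal.map_span,
      Set.image_singleton]
    rfl
  obtain ⟨v, hv⟩ := Ideal.span_singleton_eq_span_singleton.1 h1
  obtain ⟨W', hW', û, hû⟩ := TopCat.Presheaf.exists_germ_eq Z.left.presheaf ((v⁻¹ : _ˣ) : Z.left.presheaf.stalk p.pt)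
  have hb : p.pt ∈ Z.left.basicOpen û := by
    rw [Scheme.mem_basicOpen _ _ _ hW', hû]
    exact Units.isUnit _
  obtain ⟨V, hV, hVW, hpV, f, hf, het⟩ := exists_etale_coordinates Z p x hx
    (W := W.1.toOpens ⊓ Z.left.basicOpen û) ⟨hW, hb⟩
  have hVW1 : V ≤ W.1.toOpens := hVW.trans inf_le_left
  have hVb : V ≤ Z.left.basicOpen û := hVW.trans inf_le_right
  let U : FramedSite L := ⟨⟨V, hV⟩, _, W.isFrame_frame.map hVW1⟩
  -- the frame of `U` as a framed open set need not be the restriction of that of `W`; they differ by a unit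
  -- `w`, which changes the coordinate of the section by `w^d`
  obtain ⟨w, hw, hwU⟩ := s.exists_isUnit_coord_mul (W.isFrame_frame.map hVW1) U.isFrame_frame
  rw [s.coord_map hVW1 _ W.isFrame_frame] at hwU
  obtain ⟨w, rfl⟩ := hw
  have hVW' : V ≤ W' := hVb.trans (Z.left.basicOpen_le û)
  let û' : Γ(Z.left, V) := Z.left.presheaf.map (homOfLE hVW').op û
  have hunit : IsUnit û' := by
    have h2 := (RingedSpace.isUnit_res_basicOpen Z.left.toRingedSpace û).map
      (Z.left.presheaf.map (homOfLE hVb).op).hom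
    have h3 : Z.left.presheaf.map (homOfLE hVb).op (Z.left.presheaf.map (homOfLE (Z.left.basicOpen_le û)).op û) = û' := by
      rw [← ConcreteCategory.comp_apply, ← Functor.map_comp]
      rfl
    rw [← h3]
    exact h2
  -- the equation holds in the local ring, hence on the integral scheme `V`
  have hloc : Z.left.presheaf.map (homOfLE hVW1).op (s.loc W) = û' * ∏ i, f i ^ a i := by
    refine germ_injective_of_isIntegral Z.left p.pt hpV ?_
    rw [map_mul, map_prod]
    simp only [map_pow, hf, û', TopCat.Presheaf.germ_res_apply]
    rw [hû, ← hv, mul_comm, Units.mul_inv_cancel_right]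
  refine ⟨U, hpV, f, û' * ↑(w⁻¹ ^ d), hf, het, hunit.mul (Units.isUnit _), ?_⟩
  have h4 : s.loc U * ↑(w ^ d) = û' * ∏ i, f i ^ a i := by
    rw [← hloc, Units.val_pow_eq_pow_val]
    exact hwU
  rw [mul_right_comm, ← h4, mul_assoc, ← Units.val_mul, inv_pow, mul_inv_cancel, Units.val_one, mul_one]

/-! ### The analytic germs of the normal cyclic cover -/

/-- The algebraic form of the comparison with the model: `A` has étale coordinates, `s = u x^a` with a unit
`u`, and `B` is the integral closure of `A[y]/(y^d - s)` in its total ring of fractions. -/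
lemma exists_model_point {n d : ℕ} (hd : 0 < d) (a : Fin n → ℕ) {A B F : Type} [CommRing A] [IsDomain A]
    [Algebra ℂ A] [Algebra (MvPolynomial (Fin n) ℂ) A] [IsScalarTower ℂ (MvPolynomial (Fin n) ℂ) A]
    [Algebra.Etale (MvPolynomial (Fin n) ℂ) A] [CommRing B] [Algebra ℂ B] [Algebra A B]
    [IsScalarTower ℂ A B] {u s : A} (hu : IsUnit u)
    (hs : s = u * ∏ i, algebraMap (MvPolynomial (Fin n) ℂ) A (MvPolynomial.X i) ^ a i) [CommRing F]
    [Algebra (AdjoinRoot (Polynomial.X ^ d - Polynomial.C s)) F]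
    [IsFractionRing (AdjoinRoot (Polynomial.X ^ d - Polynomial.C s)) F] (ψ : B →+* F)
    (hψ : Function.Injective ψ)
    (hint : ∀ z, IsIntegral (AdjoinRoot (Polynomial.X ^ d - Polynomial.C s)) z ↔ ∃ t, ψ t = z)
    (hcomp : ψ.comp (algebraMap A B) =
      (algebraMap (AdjoinRoot (Polynomial.X ^ d - Polynomial.C s)) F).comp (AdjoinRoot.of _))
    (p : CPoint (specC B))
    (hp : ∀ i, p.evalSpec (algebraMap A B (algebraMap (MvPolynomial (Fin n) ℂ) A (MvPolynomial.X i))) = 0) :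
    ∃ t : CPoint (specC (NormalizedModelRing a d)),
      (∀ i, t.evalSpec (algebraMap (ModelRing a d) _ (ModelRing.x a d i)) = 0) ∧
        LocallyAnalyticallyIso p t := by
  let R := AdjoinRoot (Polynomial.X ^ d - Polynomial.C s)
  let K := FractionRing A
  let _ : Algebra A F := ((algebraMap R F).comp (algebraMap A R)).toAlgebra
  have : IsScalarTower A R F := .of_algebraMap_eq fun _ ↦ rfl
  let _ : Algebra B F := ψ.toAlgebra
  have : IsScalarTower A B F := .of_algebraMap_eq fun r ↦ (congrArg (fun k ↦ k r) hcomp).symm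
  have : Module.Finite A R := finite_adjoinRoot hd s
  -- since `A[y]/(y^d - s)` is finite over `A`, integrality over the two rings is the same
  have : IsIntegralClosure B A F := by
    refine ⟨hψ, fun {z} ↦ ?_⟩
    rw [← show IsIntegral R z ↔ ∃ t, algebraMap B F t = z from hint z]
    exact ⟨fun h ↦ h.tower_top, fun h ↦ isIntegral_trans z h⟩
  obtain ⟨_, _, hli, hsp⟩ := exists_algebra_fractions (K := K) (F := F) hd s
  have hy : (algebraMap R F (AdjoinRoot.root _)) ^ d = algebraMap A F (u * ∏ i,
      algebraMap (MvPolynomial (Fin n) ℂ) A (MvPolynomial.X i) ^ a i) := by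
    rw [← hs, ← map_pow, IsScalarTower.algebraMap_apply A R F]
    congr 1
    have := AdjoinRoot.eval₂_root (Polynomial.X ^ d - Polynomial.C s)
    simp only [Polynomial.eval₂_sub, Polynomial.eval₂_pow, Polynomial.eval₂_X, Polynomial.eval₂_C,
      sub_eq_zero] at this
    exact this
  obtain ⟨b, hb, _⟩ := exists_isCyclicBasis (B := B) hd a hu hy hli hsp
  obtain ⟨b', hb', _⟩ := exists_isCyclicBasis_normalizedModelRing hd a
  obtain ⟨t, ht, h⟩ := exists_locallyAnalyticallyIso_model hd hu hb hb' p
  refine ⟨t, fun i ↦ ?_, h⟩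
  rw [← hp i, ← ht i]
  rfl

/-- A complex point of an affine open subset as a point of a spectrum, with the same analytic germ. -/
lemma exists_affine_point (Y : CScheme) {O : Y.left.Opens} (hO : IsAffineOpen O) (y : CPoint Y)
    (hy : y.pt ∈ O) [Algebra ℂ Γ(Y.left, O)] (h : algebraMap ℂ Γ(Y.left, O) = scalarHom Y O) :
    ∃ q : CPoint (specC Γ(Y.left, O)), LocallyAnalyticallyIso y q ∧
      ∀ g : Γ(Y.left, O), q.evalSpec g = 0 ↔ y.pt ∉ Y.left.basicOpen g := by
  let f : specC Γ(Y.left, O) ⟶ Y := Over.homMk hO.fromSpec (by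
    refine (spec_scalarHom_eq hO).trans ?_
    rw [← h]
    rfl)
  have : IsOpenImmersion f.left := inferInstanceAs (IsOpenImmersion hO.fromSpec)
  obtain ⟨q, rfl⟩ := CPoint.exists_map_eq f (q := y) (by
    change y.pt ∈ hO.fromSpec.opensRange
    rw [hO.opensRange_fromSpec]
    exact hy)
  refine ⟨q, (LocallyAnalyticallyIso.of_isOpenImmersion f q).symm, fun g ↦ ?_⟩
  rw [← not_iff_not, ← ne_eq, ← CPoint.pt_mem_basicOpen, not_not]
  have h1 := hO.fromSpec_preimage_basicOpen g
  have h2 : q.pt ∈ hO.fromSpec ⁻¹ᵁ Y.left.basicOpen g ↔ (CPoint.map f q).pt ∈ Y.left.basicOpen g := Iff.rfl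
  rw [← h2, h1]
  exact Iff.rfl

/-- The analytic germ of the normal cyclic cover at a point is that of the normalized local model. -/
lemma exists_locallyAnalyticallyIso_normalizedModelRing {n d : ℕ} (hd : 0 < d) (Z : CScheme)
    [IsIntegral Z.left] [QuasiCompact Z.hom] [SmoothOfRelativeDimension n Z.hom]
    {L : Z.left.Modules} (hL : IsLineBundle L) (s : PowerSection L d) (D : Z.left.IdealSheafData)
    (hD : s.IsDivisorOfZeros D) (y : CPoint (normalCyclicCoverC hL s))
    (x : Fin n → Z.left.presheaf.stalk (coverProj hL s y)) (a : Fin n → ℕ)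
    (hx : Ideal.span (Set.range x) = IsLocalRing.maximalIdeal _)
    (hc : IsCutOutAt D (coverProj hL s y) (∏ i, x i ^ a i)) :
    ∃ t : CPoint (specC (NormalizedModelRing a d)),
      (∀ i, t.evalSpec (algebraMap (ModelRing a d) _ (ModelRing.x a d i)) = 0) ∧
        LocallyAnalyticallyIso y t := by
  have := SmoothOfRelativeDimension.smooth n Z.hom
  have hfin : LocallyOfFiniteType Z.hom := inferInstance
  have hlN : IsLocallyNoetherian Z.left := LocallyOfFiniteType.isLocallyNoetherian Z.hom
  have hcpt : CompactSpace Z.left :=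
    isCompact_univ_iff.1 (QuasiCompact.isCompact_preimage (f := Z.hom) Set.univ isOpen_univ isCompact_univ)
  have hN : IsNoetherian Z.left := {}
  let π : normalCyclicCoverC hL s ⟶ Z := Over.homMk (normalCyclicCover hL s).hom rfl
  let p : CPoint Z := CPoint.map π y
  obtain ⟨U, hU, f, u, hf, het, hu, hloc⟩ := exists_local_equation Z hL s D hD p x a hx hc
  have : Nonempty U.1.toOpens := ⟨⟨_, hU⟩⟩
  let P := MvPolynomial (Fin n) ℂ
  let _ : Algebra ℂ Γ(Z.left, U.1.toOpens) := (scalarHom Z U.1.toOpens).toAlgebra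
  let _ : Algebra P Γ(Z.left, U.1.toOpens) := (MvPolynomial.eval₂Hom (scalarHom Z U.1.toOpens) f).toAlgebra
  have : Algebra.Etale P Γ(Z.left, U.1.toOpens) := het
  have : IsScalarTower ℂ P Γ(Z.left, U.1.toOpens) :=
    .of_algebraMap_eq fun c ↦ (MvPolynomial.eval₂Hom_C _ f c).symm
  have hX (i) : algebraMap P Γ(Z.left, U.1.toOpens) (MvPolynomial.X i) = f i := MvPolynomial.eval₂Hom_X' _ f i
  have hloc' : s.loc U = u * ∏ i, algebraMap P Γ(Z.left, U.1.toOpens) (MvPolynomial.X i) ^ a i := by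
    simp only [hX]
    exact hloc
  have hinj : Function.Injective (algebraMap P Γ(Z.left, U.1.toOpens)) :=
    FaithfulSMul.algebraMap_injective P _
  have hne : s.loc U ≠ 0 := by
    rw [hloc]
    refine mul_ne_zero hu.ne_zero (Finset.prod_ne_zero_iff.2 fun i _ ↦ pow_ne_zero _ ?_)
    rw [← hX]
    exact (map_ne_zero_iff _ hinj).2 (MvPolynomial.X_ne_zero i)
  have : CharZero Γ(Z.left, U.1.toOpens) := charZero_of_injective_algebraMap (algebraMap ℂ Γ(Z.left, U.1.toOpens)).injective
  have : IsReduced (s.Alg U) := isReduced_adjoinRoot hd hne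
  obtain ⟨hO, F, _, _, ψ, hF, hψ, hint, hcomp⟩ := s.exists_isIntegralClosure_cover hd hL U
  let O : (normalCyclicCoverC hL s).left.Opens := (normalCyclicCover hL s).hom ⁻¹ᵁ U.1.toOpens
  let _ : Algebra ℂ Γ((normalCyclicCoverC hL s).left, O) := (scalarHom (normalCyclicCoverC hL s) O).toAlgebra
  let _ : Algebra Γ(Z.left, U.1.toOpens) Γ((normalCyclicCoverC hL s).left, O) :=
    ((normalCyclicCover hL s).hom.app U.1.toOpens).hom.toAlgebra
  have : IsScalarTower ℂ Γ(Z.left, U.1.toOpens) Γ((normalCyclicCoverC hL s).left, O) :=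
    .of_algebraMap_eq fun c ↦ (congrArg (fun k ↦ k c) (app_comp_scalarHom π U.1.toOpens)).symm
  obtain ⟨q, hq, hq0⟩ := exists_affine_point (normalCyclicCoverC hL s) (O := O) hO y hU rfl
  obtain ⟨t, ht, h⟩ := exists_model_point hd a (B := Γ((normalCyclicCoverC hL s).left, O)) hu
    hloc' ψ hψ hint hcomp q (fun i ↦ by
      rw [hX, hq0]
      intro hy
      have h1 : y.pt ∈ (normalCyclicCover hL s).hom ⁻¹ᵁ Z.left.basicOpen (f i) := by
        rw [Scheme.preimage_basicOpen]
        exact hy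
      have h2 : p.pt ∈ Z.left.basicOpen (f i) := h1
      rw [Scheme.mem_basicOpen _ _ _ hU, hf] at h2
      have h3 : x i ∈ IsLocalRing.maximalIdeal (Z.left.presheaf.stalk (coverProj hL s y)) := by
        rw [← hx]
        exact Ideal.subset_span ⟨i, rfl⟩
      exact (IsLocalRing.mem_maximalIdeal _).1 h3 h2)
  exact ⟨t, ht, hq.trans h⟩

/-! ### Components and dimension -/

/-- The length of a regular system of parameters at a complex point is the relative dimension. -/
lemma eq_of_ringKrullDim_stalk_eq {n k : ℕ} (Z : CScheme) [SmoothOfRelativeDimension n Z.hom]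
    (p : CPoint Z) (x : Fin k → Z.left.presheaf.stalk p.pt)
    (hdim : ringKrullDim (Z.left.presheaf.stalk p.pt) = k)
    (hx : Ideal.span (Set.range x) = IsLocalRing.maximalIdeal _) : k = n := by
  have := SmoothOfRelativeDimension.smooth n Z.hom
  have hfin : LocallyOfFiniteType Z.hom := inferInstance
  have hlN : IsLocallyNoetherian Z.left := LocallyOfFiniteType.isLocallyNoetherian Z.hom
  let S := Z.left.presheaf.stalk p.pt
  have hz : p.pt ∈ (⊤ : Z.left.Opens) := trivial
  let _ : Algebra ℂ S := ((Z.left.presheaf.germ ⊤ p.pt hz).hom.comp (scalarHom Z ⊤)).toAlgebra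
  have hS (V : Z.left.Opens) (hV : p.pt ∈ V) :
      (Z.left.presheaf.germ V p.pt hV).hom.comp (scalarHom Z V) = algebraMap ℂ S :=
    germ_comp_scalarHom le_top hV
  obtain ⟨hsm, ⟨b⟩⟩ := exists_basis_kaehlerDifferential_stalk (n := n) Z p.pt hS
  let ε : S →ₐ[ℂ] ℂ := ⟨p.stalkEval, fun c ↦ stalkEval_germ_scalarHom p hz c⟩
  have h1 := ringKrullDim_le_of_basis (S := S) b ε
  rw [hdim] at h1
  exact le_antisymm (by exact_mod_cast h1) (card_le_of_span_eq_maximalIdeal b ε x hx)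

/-- A point of a finite disjoint union lies on one of the components. -/
lemma exists_locallyAnalyticallyIso_component {ι R M : Type} [Finite ι] [CommRing R] [Algebra ℂ R]
    [CommRing M] [Algebra ℂ M] (Φ : R ≃ₐ[ℂ] (ι → M)) (t : CPoint (specC R)) :
    ∃ t' : CPoint (specC M), LocallyAnalyticallyIso t t' := by
  classical
  cases nonempty_fintype ι
  let ε := t.evalAlgHom.comp Φ.symm.toAlgHom
  obtain ⟨k, hk⟩ : ∃ k, ε (Pi.single k 1) ≠ 0 := by
    by_contra! h
    have h1 : ε 1 = 0 := by
      rw [← Finset.univ_sum_single (1 : ι → M), map_sum]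
      exact Finset.sum_eq_zero fun i _ ↦ h i
    rw [map_one] at h1
    exact one_ne_zero h1
  -- the value of an idempotent that does not vanish is `1`
  have hidem : (Pi.single k 1 : ι → M) * Pi.single k 1 = Pi.single k 1 := by
    rw [← Pi.single_mul, one_mul]
  have hone : ε (Pi.single k 1) = 1 := by
    have h1 := congrArg ε hidem
    rw [map_mul] at h1
    exact mul_left_cancel₀ hk (h1.trans (mul_one _).symm)
  let φ : R →ₐ[ℂ] M := (Pi.evalAlgHom ℂ (fun _ ↦ M) k).comp Φ.toAlgHom
  let δ : M →ₐ[ℂ] ℂ := AlgHom.ofLinearMap (ε.toLinearMap.comp (LinearMap.single ℂ (fun _ ↦ M) k))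
    hone fun x y ↦ by
      change ε (Pi.single k (x * y)) = ε (Pi.single k x) * ε (Pi.single k y)
      rw [Pi.single_mul, map_mul]
  have hδ : CPoint.map (specCMap φ) (CPoint.ofAlgHom δ) = t := by
    refine CPoint.evalSpec_injective (RingHom.ext fun r ↦ ?_)
    rw [CPoint.evalSpec_map, CPoint.evalSpec_ofAlgHom]
    change ε (Pi.single k (Φ r k)) = _
    have h1 : (Pi.single k (Φ r k) : ι → M) = Pi.single k 1 * Φ r := by
      ext l
      by_cases h : l = k
      · subst h; simp
      · simp [h]
    rw [h1, map_mul, hone, one_mul]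
    exact congrArg t.evalSpec (Φ.symm_apply_apply r)
  have : IsOpenImmersion (specCMap φ).left := by
    refine isOpenImmersion_of_isLocalization_away φ.toRingHom (Φ.symm (Pi.single k 1)) ?_
    let _ := φ.toRingHom.toAlgebra
    refine IsLocalization.away_of_isIdempotentElem_of_mul ?_ (fun x y ↦ ?_) ?_
    · rw [IsIdempotentElem, ← map_mul, hidem]
    · change Φ x k = Φ y k ↔ _
      rw [← Φ.injective.eq_iff, map_mul, map_mul, Φ.apply_symm_apply]
      refine ⟨fun h ↦ ?_, fun h ↦ ?_⟩
      · ext l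
        by_cases hl : l = k
        · subst hl; simp [h]
        · simp [hl]
      · simpa using congrFun h k
    · exact fun m ↦ ⟨Φ.symm fun _ ↦ m, congrFun (Φ.apply_symm_apply _) k⟩
  refine ⟨CPoint.ofAlgHom δ, ?_⟩
  have h2 := LocallyAnalyticallyIso.of_isOpenImmersion (specCMap φ) (CPoint.ofAlgHom δ)
  rw [hδ] at h2
  exact h2.symm

end

end CyclicCover

theorem lemma1p1 (n d : ℕ) (hd : 0 < d)
    -- a smooth variety of dimension `n` over `ℂ`
    (Z : CScheme) [IsIntegral Z.left] [IsSeparated Z.hom] [QuasiCompact Z.hom]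
    [SmoothOfRelativeDimension n Z.hom]
    -- a line bundle and a section of its `d`-th power whose divisor of zeros `D` is SNC
    (L : Z.left.Modules) (hL : IsLineBundle L) (s : PowerSection L d)
    (D : Z.left.IdealSheafData) (hD : s.IsDivisorOfZeros D) (hSNC : IsSNCDivisor D) :
    -- the normal cyclic cover is locally analytically a toric variety with quotient singularities
    (∀ y : CPoint (normalCyclicCoverC hL s),
      ∃ T : CScheme, IsToricVariety T ∧ HasFiniteQuotientSingularities T ∧
        ∃ t : CPoint T, LocallyAnalyticallyIso y t) ∧
    -- it looks at `y` like the normalization of `y^d = x_1^{a_1} ⋯ x_n^{a_n}` at a point over `0`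
    (∀ (y : CPoint (normalCyclicCoverC hL s))
      (x : Fin n → Z.left.presheaf.stalk (coverProj hL s y)) (a : Fin n → ℕ),
      Ideal.span (Set.range x) = IsLocalRing.maximalIdeal _ →
      IsCutOutAt D (coverProj hL s y) (∏ i, x i ^ a i) →
      ∃ t : CPoint (specC (NormalizedModelRing a d)),
        (∀ i, t.evalSpec (algebraMap (ModelRing a d) _ (ModelRing.x a d i)) = 0) ∧
        LocallyAnalyticallyIso y t) ∧
    -- the local model consists of `g` copies of the spectrum of a simplicial semigroup ring
    (∀ a : Fin n → ℕ,
      (∃ Φ : NormalizedModelRing a d ≃ₐ[ℂ]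
          (Fin (Nat.gcd (Finset.univ.gcd a) d) → ModelSemigroupRing a d),
        (∀ i k, Φ (algebraMap (ModelRing a d) _ (ModelRing.x a d i)) k =
          AddMonoidAlgebra.single (modelGenS a d (some i)) 1) ∧
        (∀ k, Φ (algebraMap (ModelRing a d) _ (ModelRing.y a d)) k =
          AddMonoidAlgebra.single (modelGenS a d none)
            (Complex.exp (2 * Real.pi * Complex.I * (k : ℕ) / d)))) ∧
      IsSimplicialIn (modelSemigroup a d) (modelLattice a d) ∧
      IsToricVariety (specC (ModelSemigroupRing a d)) ∧
      HasFiniteQuotientSingularities (specC (ModelSemigroupRing a d))) := by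
  refine ⟨fun y ↦ ?_, fun y x a hx hc ↦
    exists_locallyAnalyticallyIso_normalizedModelRing hd Z hL s D hD y x a hx hc, fun a ↦
    ⟨exists_normalizedModelRing_algEquiv hd a, isSimplicialIn_modelSemigroup a hd,
      isToricVariety_model a hd, hasFiniteQuotientSingularities_model a hd⟩⟩
  obtain ⟨k, x, a, hdim, hx, hc⟩ := hSNC (coverProj hL s y)
  let π : normalCyclicCoverC hL s ⟶ Z := Over.homMk (normalCyclicCover hL s).hom rfl
  obtain rfl : k = n := eq_of_ringKrullDim_stalk_eq Z (CPoint.map π y) x hdim hx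
  obtain ⟨t, _, ht⟩ := exists_locallyAnalyticallyIso_normalizedModelRing hd Z hL s D hD y x a hx hc
  obtain ⟨Φ, _⟩ := exists_normalizedModelRing_algEquiv hd a
  obtain ⟨t', ht'⟩ := exists_locallyAnalyticallyIso_component Φ t
  exact ⟨_, isToricVariety_model a hd, hasFiniteQuotientSingularities_model a hd, t', ht.trans ht'⟩
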